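/- We work over $\mathbb{C}$. Let $R\in|\mathcal{O}_{\mathbb{P}^1\times\mathbb{P}^2}(2,1)|$ be a smooth and irreducible divisor, and let $\mathcal{O}_R(a,b)$ denote the restriction of $\mathcal{O}_{\mathbb{P}^1\times\mathbb{P}^2}(a,b)$ to $R$. For $n\ge 0$ let $\mathbb{F}_n=\mathbb{P}(\mathcal{O}\oplus\mathcal{O}(-n))\to\mathbb{P}^1$ be the Hirzebruch surface, $f$ a fibre of it, and $e$ its minimal section, with $e^2=-n$ (for $n=0$, a fibre of the other ruling). (1) There are $n\in\{0,2\}$ and an isomorphism $R\cong\mathbb{F}_n$ under which $$\mathcal{O}_R(1,0)\cong\mathcal{O}_R(f),\qquad \mathcal{O}_R(0,1)\cong\mathcal{O}_R\Big(\tfrac{n+2}{2}f+e\Big).$$ (2) A cubic Segre product is a subvariety $S\subset\mathbb{P}^5$ that is the image of an embedding $\mathbb{P}^1\times\mathbb{P}^2\hookrightarrow\mathbb{P}^5$ given by the complete linear system $|\mathcal{O}(1,1)|$ and a choice of linear coordinates. Fix one such embedding and regard $R$ as a surface in $\mathbb{P}^5$ by means of it. Then the family of all cubic Segre products $S\subset\mathbb{P}^5$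 that contain $R$ as an element of $|\mathcal{O}_S(2,1)|$ is naturally parametrized by a Zariski open subset $U$ of the dual projective space $|\mathcal{O}_R(0,1)|^*$, whose points are the hyperplanes of $H^0(R,\mathcal{O}_R(0,1))$. Precisely: for each such $S\cong\mathbb{P}^1\times\mathbb{P}^2$ the line bundles $\mathcal{O}_S(0,1)|_R$ and $\mathcal{O}_R(0,1)$ are isomorphic; under every such isomorphism the image of the restriction map $H^0(S,\mathcal{O}_S(0,1))\to H^0(R,\mathcal{O}_S(0,1)|_R)\cong H^0(R,\mathcal{O}_R(0,1))$ is one and the same hyperplane $\Phi(S)$; the map $\Phi$ is a bijection from the family onto an open subset $U\subset|\mathcal{O}_R(0,1)|^*$; and the incidence set $\{(p,y)\in U\times\mathbb{P}^5 : y\in\Phi^{-1}(p)\}$ is the zero set in $U\times\mathbb{P}^5$ of a set of bihomogeneous polynomials. -/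

import Mathlib

open TopologicalSpace

namespace SegreScroll

/-! ### Bihomogeneous polynomials and the variety `ℙ¹ × ℙ²` over `ℂ` -/

/-- `F` is bihomogeneous of bidegree `d` in the two groups of variables `σ` and `τ`. -/
def IsBihomogeneous {σ τ : Type*} (F : MvPolynomial (σ ⊕ τ) ℂ) (d : ℕ × ℕ) : Prop :=
  MvPolynomial.IsWeightedHomogeneous
    (Sum.elim (fun _ => ((1, 0) : ℕ × ℕ)) (fun _ => ((0, 1) : ℕ × ℕ))) F d

/-- The polynomial ring `ℂ[Z₀, Z₁; X₀, X₁, X₂]`. -/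
abbrev BiPoly : Type := MvPolynomial (Fin 2 ⊕ Fin 3) ℂ

/-- The points of `ℙ¹ × ℙ²`. -/
def BiProj : Type := Projectivization ℂ (Fin 2 → ℂ) × Projectivization ℂ (Fin 3 → ℂ)

/-- Bihomogeneous coordinates of points of `ℙ¹ × ℙ²`: pairs of nonzero vectors. -/
structure Vec where
  z : Fin 2 → ℂ
  x : Fin 3 → ℂ
  z_ne : z ≠ 0
  x_ne : x ≠ 0

/-- The point `([z], [x])` with bihomogeneous coordinates `(z, x)`. -/
noncomputable def Vec.point (v : Vec) : BiProj :=
  (Projectivization.mk ℂ v.z v.z_ne, Projectivization.mk ℂ v.x v.x_ne)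

/-- The value of a polynomial at a pair of vectors. -/
noncomputable def Vec.eval (v : Vec) (F : BiPoly) : ℂ :=
  MvPolynomial.eval (Sum.elim v.z v.x) F

/-- The zero locus in `ℙ¹ × ℙ²` of a bihomogeneous polynomial. -/
def zeroLocus (F : BiPoly) : Set BiProj := {p | ∀ v : Vec, v.point = p → v.eval F = 0}

/-- The Zariski topology of `ℙ¹ × ℙ²`: the complements of the zero loci of bihomogeneous
polynomials are a basis. -/
instance : TopologicalSpace BiProj :=
  generateFrom {U | ∃ (F : BiPoly) (d : ℕ × ℕ), IsBihomogeneous F d ∧ U = (zeroLocus F)ᶜ}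

/-- The divisor `F = 0` (with its scheme structure) is smooth: the gradient of `F` vanishes at
no zero of `F`. -/
def IsSmooth (F : BiPoly) : Prop :=
  ∀ v : Vec, v.eval F = 0 → ∃ i, v.eval (MvPolynomial.pderiv i F) ≠ 0

/-! ### Regular functions and twisted sections -/

/-- The (punctured) cone over a subset of `ℙ¹ × ℙ²`. -/
def Cone (X : Set BiProj) : Type := {v : Vec // v.point ∈ X}

/-- The projection of the cone to its base. -/
noncomputable def Cone.base {X : Set BiProj} (v : Cone X) : X := ⟨v.1.point, v.2⟩

/-- `s` is a section over `U` of the line bundle `𝒪_X(k)`, `k = (a, b)`: a function on the cone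
over `U` which is locally a quotient of bihomogeneous polynomials whose bidegrees differ
by `(a, b)`. -/
def IsTwistedSection {X : Set BiProj} (k : ℕ × ℕ) (U : Opens X)
    (s : {v : Cone X // v.base ∈ U} → ℂ) : Prop :=
  ∀ x ∈ U, ∃ V : Opens X, ∃ hV : V ≤ U, x ∈ V ∧ ∃ (m : ℕ × ℕ) (P Q : BiPoly),
    IsBihomogeneous P (k + m) ∧ IsBihomogeneous Q m ∧
    ∀ (v : Cone X) (hv : v.base ∈ V), v.1.eval Q ≠ 0 ∧
      s ⟨v, hV hv⟩ * v.1.eval Q = v.1.eval P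

/-- `g` is a regular function on the open subset `U` of `X`: it is locally a quotient of
bihomogeneous polynomials of the same bidegree. -/
def IsRegular {X : Set BiProj} (U : Opens X) (g : U → ℂ) : Prop :=
  IsTwistedSection 0 U (fun v => g ⟨v.1.base, v.2⟩)

section helpers

variable {X : Set BiProj}

theorem IsBihomogeneous.mul {σ τ : Type*} {F G : MvPolynomial (σ ⊕ τ) ℂ} {d e : ℕ × ℕ}
    (hF : IsBihomogeneous F d) (hG : IsBihomogeneous G e) : IsBihomogeneous (F * G) (d + e) :=
  MvPolynomial.IsWeightedHomogeneous.mul hF hG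

theorem IsTwistedSection.add {k : ℕ × ℕ} {U : Opens X} {s t : {v : Cone X // v.base ∈ U} → ℂ}
    (hs : IsTwistedSection k U s) (ht : IsTwistedSection k U t) :
    IsTwistedSection k U (s + t) := by
  intro x hx
  obtain ⟨V, hV, hxV, m, P, Q, hP, hQ, h⟩ := hs x hx
  obtain ⟨V', hV', hxV', m', P', Q', hP', hQ', h'⟩ := ht x hx
  refine ⟨V ⊓ V', inf_le_left.trans hV, ⟨hxV, hxV'⟩, m + m', P * Q' + P' * Q, Q * Q', ?_,
    hQ.mul hQ', ?_⟩
  · have h1 := hP.mul hQ'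
    have h2 := hP'.mul hQ
    rw [add_assoc] at h1 h2
    rw [add_comm m' m] at h2
    exact Submodule.add_mem
      (MvPolynomial.weightedHomogeneousSubmodule ℂ _ (k + (m + m'))) h1 h2
  · intro v hv
    obtain ⟨q, e⟩ := h v hv.1
    obtain ⟨q', e'⟩ := h' v hv.2
    simp only [Vec.eval, map_mul, map_add, Pi.add_apply] at q e q' e' ⊢
    refine ⟨mul_ne_zero q q', ?_⟩
    rw [← e, ← e']
    ring

theorem IsTwistedSection.mul {k : ℕ × ℕ} {U : Opens X} {s : {v : Cone X // v.base ∈ U} → ℂ}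
    {g : U → ℂ} (hg : IsRegular U g) (hs : IsTwistedSection k U s) :
    IsTwistedSection k U (fun v => g ⟨v.1.base, v.2⟩ * s v) := by
  intro x hx
  obtain ⟨V, hV, hxV, m, P, Q, hP, hQ, h⟩ := hs x hx
  obtain ⟨V', hV', hxV', m', P', Q', hP', hQ', h'⟩ := hg x hx
  refine ⟨V ⊓ V', inf_le_left.trans hV, ⟨hxV, hxV'⟩, m + m', P * P', Q * Q', ?_,
    hQ.mul hQ', ?_⟩
  · have h1 := hP.mul hP'
    rwa [zero_add, add_assoc] at h1
  · intro v hv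
    obtain ⟨q, e⟩ := h v hv.1
    obtain ⟨q', e'⟩ := h' v hv.2
    simp only [Vec.eval, map_mul] at q e q' e' ⊢
    refine ⟨mul_ne_zero q q', ?_⟩
    rw [← e, ← e']
    ring

theorem IsTwistedSection.res {k : ℕ × ℕ} {U W : Opens X} (hW : W ≤ U)
    {s : {v : Cone X // v.base ∈ U} → ℂ} (hs : IsTwistedSection k U s) :
    IsTwistedSection k W (fun v => s ⟨v.1, hW v.2⟩) := by
  intro x hx
  obtain ⟨V, hV, hxV, m, P, Q, hP, hQ, h⟩ := hs x (hW hx)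
  exact ⟨V ⊓ W, inf_le_right, ⟨hxV, hx⟩, m, P, Q, hP, hQ, fun v hv => h v hv.1⟩

theorem isTwistedSection_zero (k : ℕ × ℕ) (U : Opens X) : IsTwistedSection k U 0 := by
  intro x hx
  refine ⟨U, le_rfl, hx, 0, 0, 1, MvPolynomial.isWeightedHomogeneous_zero ℂ _ _,
    MvPolynomial.isWeightedHomogeneous_one ℂ _, fun v hv => ?_⟩
  simp [Vec.eval]

theorem isRegular_const (U : Opens X) (c : ℂ) : IsRegular U (fun _ => c) := by
  intro x hx
  refine ⟨U, le_rfl, hx, 0, MvPolynomial.C c, 1, MvPolynomial.isWeightedHomogeneous_C _ _,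
    MvPolynomial.isWeightedHomogeneous_one ℂ _, fun v hv => ?_⟩
  simp [Vec.eval]

end helpers

/-! ### Modules over the structure sheaf, realised by functions -/

/-- An `𝒪_X`-module whose sections over `U` are complex functions on the preimage of `U` in some
space `total` lying over `X`; restriction and the action of regular functions are the obvious
ones. -/
structure FunctionModule (X : Set BiProj) where
  total : Type
  base : total → X
  sections : ∀ U : Opens X, Submodule ℂ ({t : total // base t ∈ U} → ℂ)
  smul_mem : ∀ (U : Opens X) (g : U → ℂ), IsRegular U g → ∀ s ∈ sections U,
    (fun t => g ⟨base t.1, t.2⟩ * s t) ∈ sections U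
  res_mem : ∀ (U V : Opens X) (h : V ≤ U), ∀ s ∈ sections U,
    (fun t => s ⟨t.1, h t.2⟩) ∈ sections V

/-- The line bundle `𝒪_X(a, b)`, the restriction to `X` of `𝒪(a, b)` on `ℙ¹ × ℙ²`. -/
noncomputable def twist (X : Set BiProj) (a b : ℕ) : FunctionModule X where
  total := Cone X
  base := Cone.base
  sections U :=
    { carrier := {s | IsTwistedSection (a, b) U s}
      add_mem' := fun hs ht => hs.add ht
      zero_mem' := isTwistedSection_zero _ U
      smul_mem' := fun c _ hs => hs.mul (isRegular_const U c) }
  smul_mem _ _ hg _ hs := IsTwistedSection.mul hg hs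
  res_mem _ _ h _ hs := IsTwistedSection.res h hs

/-- The line bundle `𝒪_X(D)` of the effective divisor `D = ∑ᵢ Dᵢ` on a smooth variety `X`, the
`Dᵢ` being (not necessarily distinct) prime divisors. It is the dual of the ideal sheaf
`∏ᵢ I(Dᵢ)`: its sections over `U` are the functions `s` on `U ∖ ⋃ᵢ Dᵢ` such that, on each open
`V ⊆ U`, the product of `s` with functions `τᵢ` in the ideals of the `Dᵢ` extends to a regular
function on `V`. -/
noncomputable def ofDivisor (X : Set BiProj) {ι : Type} [Fintype ι] (D : ι → Set X) : FunctionModule X where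
  total := {y : X // ∀ i, y ∉ D i}
  base y := y.1
  sections U :=
    { carrier := {s | ∀ (V : Opens X) (hV : V ≤ U) (τ : ι → V → ℂ),
        (∀ i, IsRegular V (τ i)) → (∀ i (y : V), (y : X) ∈ D i → τ i y = 0) →
        ∃ h : V → ℂ, IsRegular V h ∧ ∀ (y : V) (hy : ∀ i, (y : X) ∉ D i),
          h y = s ⟨⟨y, hy⟩, hV y.2⟩ * ∏ i, τ i y}
      add_mem' := by
        intro s t hs ht V hV τ h1 h2
        obtain ⟨h, hr, he⟩ := hs V hV τ h1 h2
        obtain ⟨h', hr', he'⟩ := ht V hV τ h1 h2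
        refine ⟨h + h', IsTwistedSection.add hr hr', fun y hy => ?_⟩
        rw [Pi.add_apply, Pi.add_apply, he y hy, he' y hy, add_mul]
      zero_mem' := by
        intro V hV τ h1 h2
        exact ⟨0, isTwistedSection_zero _ V, fun y hy => by simp⟩
      smul_mem' := by
        intro c s hs V hV τ h1 h2
        obtain ⟨h, hr, he⟩ := hs V hV τ h1 h2
        refine ⟨fun y => c * h y, IsTwistedSection.mul (isRegular_const V c) hr,
          fun y hy => ?_⟩
        simp only [he y hy, Pi.smul_apply, smul_eq_mul, mul_assoc] }
  smul_mem := by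
    intro U g hg s hs V hV τ h1 h2
    obtain ⟨h, hr, he⟩ := hs V hV τ h1 h2
    refine ⟨fun y => g ⟨y, hV y.2⟩ * h y,
      IsTwistedSection.mul (g := fun y : V => g ⟨y, hV y.2⟩) (IsTwistedSection.res hV hg) hr,
      fun y hy => ?_⟩
    simp only [he y hy, mul_assoc]
  res_mem := by
    intro U W hW s hs V hV τ h1 h2
    exact hs V (hV.trans hW) τ h1 h2

/-- An isomorphism of varieties: a homeomorphism for the Zariski topologies which identifies
the regular functions on corresponding open sets. -/
structure VarietyIso (X Y : Set BiProj) where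
  toHomeomorph : X ≃ₜ Y
  isRegular_iff : ∀ (V : Opens Y) (g : V → ℂ), IsRegular V g ↔
    IsRegular (V.comap (toHomeomorph : C(X, Y))) (fun x => g ⟨toHomeomorph x.1, x.2⟩)

/-- The preimage of an open set under an isomorphism of varieties. -/
def VarietyIso.preimage {X Y : Set BiProj} (φ : VarietyIso X Y) (V : Opens Y) : Opens X :=
  V.comap (φ.toHomeomorph : C(X, Y))

/-- An isomorphism of `𝒪_X`-modules `φ^* M ≅ L`, for an isomorphism of varieties `φ : X → Y`:
compatible linear isomorphisms between the sections of `M` over `V` and those of `L` over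
`φ⁻¹(V)`, which respect restriction and multiplication by regular functions. -/
structure ModuleIso {X Y : Set BiProj} (φ : VarietyIso X Y) (L : FunctionModule X)
    (M : FunctionModule Y) where
  equiv : ∀ V : Opens Y, M.sections V ≃ₗ[ℂ] L.sections (φ.preimage V)
  map_smul : ∀ (V : Opens Y) (g : V → ℂ) (hg : IsRegular V g) (s : M.sections V)
    (t : {t : L.total // L.base t ∈ φ.preimage V}),
    (equiv V ⟨_, M.smul_mem V g hg s.1 s.2⟩).1 t =
      g ⟨φ.toHomeomorph (L.base t.1), t.2⟩ * (equiv V s).1 t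
  map_res : ∀ (U V : Opens Y) (h : V ≤ U) (s : M.sections U)
    (t : {t : L.total // L.base t ∈ φ.preimage V}),
    (equiv V ⟨_, M.res_mem U V h s.1 s.2⟩).1 t = (equiv U s).1 ⟨t.1, h t.2⟩

/-! ### Hirzebruch surfaces -/

/-- The Hirzebruch surface `𝔽ₙ`, as the hypersurface `Z₀ⁿ X₁ = Z₁ⁿ X₀` in `ℙ¹ × ℙ²`. The first
projection makes it the projective bundle over `ℙ¹` of the lines in the subbundle of `𝒪³`
generated by `(Z₀ⁿ, Z₁ⁿ, 0)` and `(0, 0, 1)`, which is `𝒪(-n) ⊕ 𝒪`. -/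
noncomputable def hirzebruch (n : ℕ) : Set BiProj :=
  zeroLocus (MvPolynomial.X (Sum.inl 0) ^ n * MvPolynomial.X (Sum.inr 1)
    - MvPolynomial.X (Sum.inl 1) ^ n * MvPolynomial.X (Sum.inr 0))

/-- The fibre `f` of `𝔽ₙ → ℙ¹` over the point `z`. -/
def hirzebruchFibre (n : ℕ) (z : Projectivization ℂ (Fin 2 → ℂ)) : Set (hirzebruch n) :=
  {p | p.1.1 = z}

/-- The minimal section `e` of `𝔽ₙ → ℙ¹`, namely `ℙ¹ × {[0 : 0 : 1]}`. Its normal bundle is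
`Hom(𝒪, 𝒪(-n)) = 𝒪(-n)`, so that its self-intersection is `-n`. -/
def hirzebruchSection (n : ℕ) : Set (hirzebruch n) :=
  {p | ∃ v : Vec, v.point = p.1 ∧ v.x 0 = 0 ∧ v.x 1 = 0}

/-! ### Cubic Segre products in `ℙ⁵` -/

/-- `ℙ⁵`. -/
abbrev P5 : Type := Projectivization ℂ (Fin 6 → ℂ)

/-- The tensor `z ⊗ x`, as the vector of the products `zᵢ xⱼ`. -/
def tensor (z : Fin 2 → ℂ) (x : Fin 3 → ℂ) : Fin 2 × Fin 3 → ℂ := fun i => z i.1 * x i.2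

theorem tensor_ne_zero {z : Fin 2 → ℂ} {x : Fin 3 → ℂ} (hz : z ≠ 0) (hx : x ≠ 0) :
    tensor z x ≠ 0 := by
  obtain ⟨i, hi⟩ := Function.ne_iff.1 hz
  obtain ⟨j, hj⟩ := Function.ne_iff.1 hx
  exact Function.ne_iff.2 ⟨(i, j), mul_ne_zero hi hj⟩

/-- The Segre embedding `([z], [x]) ↦ [A (z ⊗ x)]` of `ℙ¹ × ℙ²` in `ℙ⁵`, given by the complete
linear system of `𝒪(1, 1)` and a choice `A` of linear coordinates. -/
noncomputable def segre (A : (Fin 2 × Fin 3 → ℂ) ≃ₗ[ℂ] (Fin 6 → ℂ)) (p : BiProj) : P5 :=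
  Projectivization.mk ℂ (A (tensor p.1.rep p.2.rep))
    (A.map_ne_zero_iff.2 (tensor_ne_zero p.1.rep_nonzero p.2.rep_nonzero))

theorem segre_point (A : (Fin 2 × Fin 3 → ℂ) ≃ₗ[ℂ] (Fin 6 → ℂ)) (v : Vec) :
    segre A v.point = Projectivization.mk ℂ (A (tensor v.z v.x))
      (A.map_ne_zero_iff.2 (tensor_ne_zero v.z_ne v.x_ne)) := by
  obtain ⟨a, ha⟩ := Projectivization.exists_smul_eq_mk_rep ℂ v.z v.z_ne
  obtain ⟨b, hb⟩ := Projectivization.exists_smul_eq_mk_rep ℂ v.x v.x_ne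
  refine (Projectivization.mk_eq_mk_iff' ℂ _ _ _ _).2 ⟨a * b, ?_⟩
  rw [← map_smul]
  congr 1
  ext i
  have h1 := congrFun ha i.1
  have h2 := congrFun hb i.2
  simp only [Vec.point, tensor, Pi.smul_apply, smul_eq_mul, Units.smul_def] at h1 h2 ⊢
  rw [← h1, ← h2]
  ring

/-- `A` parametrizes `S ⊆ ℙ⁵` as a cubic Segre product in which `Y ⊆ ℙ⁵` is the smooth
divisor `G = 0` of bidegree `(2, 1)`. -/
def IsPresentation (Y S : Set P5) (A : (Fin 2 × Fin 3 → ℂ) ≃ₗ[ℂ] (Fin 6 → ℂ)) (G : BiPoly) :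
    Prop :=
  S = Set.range (segre A) ∧ IsBihomogeneous G (2, 1) ∧ IsSmooth G ∧ segre A '' zeroLocus G = Y

/-- The family of the cubic Segre products in `ℙ⁵` which contain the smooth surface `Y ⊆ ℙ⁵` as
an element of `|𝒪(2, 1)|`. -/
def SegreProductsContaining (Y : Set P5) : Set (Set P5) :=
  {S | ∃ A G, IsPresentation Y S A G}

/-! ### Linear systems -/

/-- `H⁰(X, 𝒪_X(0, 1))`. -/
abbrev H0 (X : Set BiProj) : Type := (twist X 0 1).sections ⊤

/-- The projective space `|𝒪_X(0, 1)|^*`, dual to `|𝒪_X(0, 1)| = ℙ(H⁰(X, 𝒪_X(0, 1)))`: its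
points are the nonzero linear forms on `H⁰(X, 𝒪_X(0, 1))` up to scalars, that is, the
hyperplanes of `H⁰(X, 𝒪_X(0, 1))`. -/
abbrev DualSystem (X : Set BiProj) : Type := Projectivization ℂ (Module.Dual ℂ (H0 X))

/-- Zariski open subsets of `|𝒪_X(0, 1)|^*`: each section `s` is a homogeneous coordinate
`p ↦ p s` on it, and the complement has to be the set of common zeros of a set of homogeneous
polynomials in these coordinates. -/
def IsZariskiOpen {X : Set BiProj} (W : Set (DualSystem X)) : Prop :=
  ∃ T : Set (MvPolynomial (H0 X) ℂ), (∀ F ∈ T, ∃ d : ℕ, F.IsHomogeneous d) ∧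
    ∀ p, p ∈ W ↔ ∃ F ∈ T, MvPolynomial.eval (fun s => p.rep s) F ≠ 0

/-- The section `s` of `𝒪_X(0, 1)` is the restriction of a global section of `𝒪(0, 1)` on
`ℙ¹ × ℙ²`, that is, of a bihomogeneous polynomial of bidegree `(0, 1)`. -/
def IsRestriction {X : Set BiProj} {U : Opens X} (s : (twist X 0 1).sections U) : Prop :=
  ∃ P : BiPoly, IsBihomogeneous P (0, 1) ∧ ∀ v : {v : Cone X // v.base ∈ U},
    s.1 v = v.1.1.eval P

end SegreScroll

open SegreScroll

open TopologicalSpace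

namespace SegreScroll

/-! ### Evaluation of bihomogeneous polynomials -/

/-! Write `F` as `q(z) · x` with `q` a triple of binary quadratic forms. Smoothness forces `q` to
have no zero: over a zero of `q` only the two `z`-derivatives of `F` can survive, and these are
linear forms in the three variables `x`, so they have a common zero. Hence `R` is the bundle of
lines in the kernel of `q : 𝒪³ → 𝒪(2)`. This kernel splits, with explicit generators `σ`, `τ` of
degrees `a ≥ b`, `a + b = 2`, normalized by `σ × τ = q`: the degrees are `(1, 1)` if the components
of `q` are independent and `(2, 0)` otherwise (`exists_cross_of_independent`,
`exists_cross_of_dependent`). Every point of the cone over `R` is uniquely `x = S σ(z) + T τ(z)`,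
with `S`, `T` of weights `(-a, 1)`, `(-b, 1)`.

With `n = a - b`, the map `(z; S, T) ↦ (z; z₀ⁿ S, z₁ⁿ S, T)` identifies `R` with `𝔽ₙ`, and `𝒪_R(1,
0)`, `𝒪_R(0, 1)` with `𝒪(1, 0)`, `𝒪(b, 1)`. If `s` is the coordinate cutting out `e` and `ℓ` a
linear form in `z`, then `s ℓᵃ` is a section of `𝒪(b, 1)` with divisor `a f + e`, and `a = (n + 2) /
2`. Division by such a section is an isomorphism onto `𝒪(D)`
(`IsDivisorSection.nonempty_moduleIso`).

For the second assertion, restriction to the fibres and to the sections `σ`, `τ` shows that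
`H⁰(𝒪_R(0, 1))` consists of the `S α(z) + T β(z)` with `α`, `β` of degrees `a`, `b`; its dimension
is 4. The analogous space with degrees `a + 1`, `b + 1` has dimension 6 and consists exactly of the
bilinear forms in `z`, `x`, which inject into functions on the cone. So each `zᵢ s` comes from a
unique linear form `rᵢ(s)` on the space of tensors (`mulZ`). A hyperplane `ker p` with basis `h₀,
h₁, h₂` gives a 2 × 3 matrix `rᵢ(hⱼ)`. If its entries are independent, its minors cut out a Segre
product containing `R` (`exists_presentation`). Independence is the nonvanishing of determinants
polynomial in `p`, so it is an open condition, and the minors give the incidence equations.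

Conversely, a second Segre presentation of the surface yields a linear isomorphism of tensor spaces
between two cones. The key point is that it respects the projections to `ℙ¹`
(`exists_ruling_equiv`): at most one fibre can go to a line of the other ruling, so the rank-one
relations hold for infinitely many fibres, hence identically, and the matrix of components factors.
It follows that the two bundles `𝒪(0, 1)` correspond, and that the sections restricted from the
Segre product form a hyperplane. Isomorphisms between these bundles differ by constants, because
global regular functions are constant; and the locus of the minors determines `p` up to a scalar
(`exists_smul_of_minorLocus_subset`). -/

theorem IsBihomogeneous.sum_inl_eq {σ τ : Type*} [Fintype σ] [Fintype τ]
    {F : MvPolynomial (σ ⊕ τ) ℂ} {d : ℕ × ℕ} (hF : IsBihomogeneous F d) {m : σ ⊕ τ →₀ ℕ}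
    (hm : MvPolynomial.coeff m F ≠ 0) :
    ∑ i, m (Sum.inl i) = d.1 ∧ ∑ j, m (Sum.inr j) = d.2 := by
  have h := hF hm
  rw [Finsupp.weight_apply, Finsupp.sum_fintype _ _ (by simp), Fintype.sum_sum_type] at h
  rw [← h]
  simp [Prod.fst_sum, Prod.snd_sum]

theorem IsBihomogeneous.eval_smul {σ τ : Type*} [Fintype σ] [Fintype τ]
    {F : MvPolynomial (σ ⊕ τ) ℂ} {d : ℕ × ℕ} (hF : IsBihomogeneous F d) (a b : ℂ)
    (z : σ → ℂ) (x : τ → ℂ) :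
    MvPolynomial.eval (Sum.elim (a • z) (b • x)) F =
      a ^ d.1 * b ^ d.2 * MvPolynomial.eval (Sum.elim z x) F := by
  rw [MvPolynomial.eval_eq', MvPolynomial.eval_eq', Finset.mul_sum]
  refine Finset.sum_congr rfl fun m hm => ?_
  obtain ⟨h1, h2⟩ := hF.sum_inl_eq (MvPolynomial.mem_support_iff.1 hm)
  simp only [Fintype.prod_sum_type, Sum.elim_inl, Sum.elim_inr, Pi.smul_apply, smul_eq_mul,
    mul_pow, Finset.prod_mul_distrib, Finset.prod_pow_eq_pow_sum, h1, h2]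
  ring

theorem isBihomogeneous_C {σ τ : Type*} (c : ℂ) :
    IsBihomogeneous (MvPolynomial.C c : MvPolynomial (σ ⊕ τ) ℂ) 0 :=
  MvPolynomial.isWeightedHomogeneous_C _ _

theorem isBihomogeneous_X_inl {σ τ : Type*} (i : σ) :
    IsBihomogeneous (MvPolynomial.X (Sum.inl i) : MvPolynomial (σ ⊕ τ) ℂ) (1, 0) :=
  MvPolynomial.isWeightedHomogeneous_X _ _ _

theorem isBihomogeneous_X_inr {σ τ : Type*} (i : τ) :
    IsBihomogeneous (MvPolynomial.X (Sum.inr i) : MvPolynomial (σ ⊕ τ) ℂ) (0, 1) :=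
  MvPolynomial.isWeightedHomogeneous_X _ _ _

theorem IsBihomogeneous.add {σ τ : Type*} {F G : MvPolynomial (σ ⊕ τ) ℂ} {d : ℕ × ℕ}
    (hF : IsBihomogeneous F d) (hG : IsBihomogeneous G d) : IsBihomogeneous (F + G) d :=
  Submodule.add_mem (MvPolynomial.weightedHomogeneousSubmodule ℂ _ d) hF hG

theorem IsBihomogeneous.sub {σ τ : Type*} {F G : MvPolynomial (σ ⊕ τ) ℂ} {d : ℕ × ℕ}
    (hF : IsBihomogeneous F d) (hG : IsBihomogeneous G d) : IsBihomogeneous (F - G) d :=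
  Submodule.sub_mem (MvPolynomial.weightedHomogeneousSubmodule ℂ _ d) hF hG

theorem IsBihomogeneous.sum {σ τ ι : Type*} {s : Finset ι} {F : ι → MvPolynomial (σ ⊕ τ) ℂ}
    {d : ℕ × ℕ} (hF : ∀ i ∈ s, IsBihomogeneous (F i) d) : IsBihomogeneous (∑ i ∈ s, F i) d :=
  Submodule.sum_mem (MvPolynomial.weightedHomogeneousSubmodule ℂ _ d) hF

theorem IsBihomogeneous.pow {σ τ : Type*} {F : MvPolynomial (σ ⊕ τ) ℂ} {d : ℕ × ℕ}
    (hF : IsBihomogeneous F d) (n : ℕ) : IsBihomogeneous (F ^ n) (n • d) :=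
  MvPolynomial.IsWeightedHomogeneous.pow hF n

theorem IsBihomogeneous.C_mul {σ τ : Type*} {F : MvPolynomial (σ ⊕ τ) ℂ} {d : ℕ × ℕ}
    (hF : IsBihomogeneous F d) (c : ℂ) : IsBihomogeneous (MvPolynomial.C c * F) d := by
  simpa using (isBihomogeneous_C c).mul hF

theorem Vec.ext' {v w : Vec} (hz : v.z = w.z) (hx : v.x = w.x) : v = w := by
  cases v; cases w; simp_all

theorem Vec.point_eq_iff {v w : Vec} :
    v.point = w.point ↔ ∃ a b : ℂ, a ≠ 0 ∧ b ≠ 0 ∧ v.z = a • w.z ∧ v.x = b • w.x := by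
  constructor
  · intro h
    obtain ⟨a, ha⟩ := (Projectivization.mk_eq_mk_iff' ℂ _ _ _ _).1 (congrArg Prod.fst h)
    obtain ⟨b, hb⟩ := (Projectivization.mk_eq_mk_iff' ℂ _ _ _ _).1 (congrArg Prod.snd h)
    refine ⟨a, b, ?_, ?_, ha.symm, hb.symm⟩
    · rintro rfl; exact v.z_ne (by rw [← ha, zero_smul])
    · rintro rfl; exact v.x_ne (by rw [← hb, zero_smul])
  · rintro ⟨a, b, -, -, ha, hb⟩
    exact Prod.ext ((Projectivization.mk_eq_mk_iff' ℂ _ _ _ _).2 ⟨a, ha.symm⟩)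
      ((Projectivization.mk_eq_mk_iff' ℂ _ _ _ _).2 ⟨b, hb.symm⟩)

theorem Vec.exists_point (p : BiProj) : ∃ v : Vec, v.point = p :=
  ⟨⟨p.1.rep, p.2.rep, p.1.rep_nonzero, p.2.rep_nonzero⟩,
    Prod.ext (Projectivization.mk_rep _) (Projectivization.mk_rep _)⟩

theorem Vec.eval_eq_zero_iff_of_point_eq {v w : Vec} (h : v.point = w.point) {F : BiPoly}
    {d : ℕ × ℕ} (hF : IsBihomogeneous F d) : v.eval F = 0 ↔ w.eval F = 0 := by
  obtain ⟨a, b, ha, hb, hz, hx⟩ := Vec.point_eq_iff.1 h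
  simp [Vec.eval, hz, hx, hF.eval_smul, ha, hb]

theorem point_mem_zeroLocus {v : Vec} {F : BiPoly} {d : ℕ × ℕ} (hF : IsBihomogeneous F d) :
    v.point ∈ zeroLocus F ↔ v.eval F = 0 :=
  ⟨fun h => h v rfl, fun h _ hw => (Vec.eval_eq_zero_iff_of_point_eq hw hF).2 h⟩

/-! ### The Zariski topology -/

theorem isOpen_nonvanishing {F : BiPoly} {d : ℕ × ℕ} (hF : IsBihomogeneous F d) :
    IsOpen ((zeroLocus F)ᶜ) := isOpen_generateFrom_of_mem ⟨F, d, hF, rfl⟩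

/-- Products of polynomials realize finite intersections, so the generating nonvanishing sets form a
basis. -/
theorem exists_nonvanishing_subset {U : Set BiProj} (hU : IsOpen U) (v : Vec)
    (hv : v.point ∈ U) : ∃ (F : BiPoly) (d : ℕ × ℕ), IsBihomogeneous F d ∧ v.eval F ≠ 0 ∧
      ∀ w : Vec, w.eval F ≠ 0 → w.point ∈ U := by
  induction hU with
  | basic s hs =>
    obtain ⟨F, d, hF, rfl⟩ := hs
    exact ⟨F, d, hF, fun h => hv ((point_mem_zeroLocus hF).2 h),
      fun w hw h => hw ((point_mem_zeroLocus hF).1 h)⟩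
  | univ => exact ⟨1, 0, MvPolynomial.isWeightedHomogeneous_one ℂ _, by simp [Vec.eval], by simp⟩
  | inter s t _ _ ihs iht =>
    obtain ⟨F, d, hF, h1, h2⟩ := ihs hv.1
    obtain ⟨G, e, hG, h3, h4⟩ := iht hv.2
    refine ⟨F * G, d + e, hF.mul hG, by simpa [Vec.eval] using ⟨h1, h3⟩, fun w hw => ?_⟩
    simp only [Vec.eval, map_mul, ne_eq, mul_eq_zero, not_or] at hw
    exact ⟨h2 w hw.1, h4 w hw.2⟩
  | sUnion S _ ih =>
    obtain ⟨s, hs, hvs⟩ := hv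
    obtain ⟨F, d, hF, h1, h2⟩ := ih s hs hvs
    exact ⟨F, d, hF, h1, fun w hw => ⟨s, hs, h2 w hw⟩⟩

theorem Cone.exists_base {X : Set BiProj} (x : X) : ∃ v : Cone X, v.base = x := by
  obtain ⟨v, hv⟩ := Vec.exists_point x.1
  exact ⟨⟨v, hv ▸ x.2⟩, Subtype.ext hv⟩

theorem Cone.base_eq_iff {X : Set BiProj} {v w : Cone X} :
    v.base = w.base ↔ v.1.point = w.1.point := Subtype.ext_iff

/-- The open set of `X` on which the bihomogeneous polynomial `F` does not vanish. -/
def nonvanishing (X : Set BiProj) {F : BiPoly} {d : ℕ × ℕ} (hF : IsBihomogeneous F d) :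
    Opens X :=
  ⟨Subtype.val ⁻¹' (zeroLocus F)ᶜ, (isOpen_nonvanishing hF).preimage continuous_subtype_val⟩

theorem base_mem_nonvanishing {X : Set BiProj} {F : BiPoly} {d : ℕ × ℕ}
    (hF : IsBihomogeneous F d) (v : Cone X) : v.base ∈ nonvanishing X hF ↔ v.1.eval F ≠ 0 :=
  not_congr (point_mem_zeroLocus hF)

theorem exists_nonvanishing_le {X : Set BiProj} (V : Opens X) (v : Cone X) (hv : v.base ∈ V) :
    ∃ (F : BiPoly) (d : ℕ × ℕ), IsBihomogeneous F d ∧ v.1.eval F ≠ 0 ∧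
      ∀ w : Cone X, w.1.eval F ≠ 0 → w.base ∈ V := by
  obtain ⟨U, hU, hUV⟩ := isOpen_induced_iff.1 V.2
  have h : ∀ w : Cone X, w.base ∈ V ↔ w.1.point ∈ U := fun w => by
    rw [← SetLike.mem_coe, ← Opens.carrier_eq_coe, ← hUV]; rfl
  obtain ⟨F, d, hF, h1, h2⟩ := exists_nonvanishing_subset hU v.1 ((h v).1 hv)
  exact ⟨F, d, hF, h1, fun w hw => (h w).2 (h2 w.1 hw)⟩

/-! ### Germs of sections with weights in `ℤ²` -/

/-- A bidegree, as a weight. -/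
def wt (p : ℕ × ℕ) : ℤ × ℤ := (p.1, p.2)

theorem wt_add (p q : ℕ × ℕ) : wt (p + q) = wt p + wt q := by simp [wt]

theorem wt_zero : wt 0 = 0 := rfl

theorem wt_injective : Function.Injective wt := by
  rintro ⟨a, b⟩ ⟨c, d⟩ h
  simpa [wt] using h

/-- Near the point `x`, the function `f` on the cone is a quotient of bihomogeneous polynomials
whose bidegrees differ by `k`. -/
def IsSecAt {X : Set BiProj} (k : ℤ × ℤ) (x : X) (f : Cone X → ℂ) : Prop :=
  ∃ V : Opens X, x ∈ V ∧ ∃ (p q : ℕ × ℕ) (P Q : BiPoly),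
    IsBihomogeneous P p ∧ IsBihomogeneous Q q ∧ wt p = wt q + k ∧
    ∀ v : Cone X, v.base ∈ V → v.1.eval Q ≠ 0 ∧ f v * v.1.eval Q = v.1.eval P

section germs

variable {X Y : Set BiProj} {k l : ℤ × ℤ} {x : X} {f g : Cone X → ℂ}

theorem IsSecAt.congr (hf : IsSecAt k x f) (V : Opens X) (hx : x ∈ V)
    (h : ∀ v : Cone X, v.base ∈ V → f v = g v) : IsSecAt k x g := by
  obtain ⟨W, hxW, p, q, P, Q, hP, hQ, e, H⟩ := hf
  refine ⟨W ⊓ V, ⟨hxW, hx⟩, p, q, P, Q, hP, hQ, e, fun v hv => ?_⟩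
  rw [← h v hv.2]
  exact H v hv.1

theorem IsSecAt.eventually (hf : IsSecAt k x f) :
    ∃ V : Opens X, x ∈ V ∧ ∀ y ∈ V, IsSecAt k y f := by
  obtain ⟨W, hxW, h⟩ := hf
  exact ⟨W, hxW, fun y hy => ⟨W, hy, h⟩⟩

theorem IsSecAt.add (hf : IsSecAt k x f) (hg : IsSecAt k x g) :
    IsSecAt k x (fun v => f v + g v) := by
  obtain ⟨V, hxV, p, q, P, Q, hP, hQ, e, H⟩ := hf
  obtain ⟨W, hxW, p', q', P', Q', hP', hQ', e', H'⟩ := hg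
  have h2 := hP'.mul hQ
  have : p' + q = p + q' := wt_injective (by rw [wt_add, wt_add, e, e']; abel)
  rw [this] at h2
  refine ⟨V ⊓ W, ⟨hxV, hxW⟩, p + q', q + q', P * Q' + P' * Q, Q * Q', (hP.mul hQ').add h2,
    hQ.mul hQ', by rw [wt_add, wt_add, e]; abel, fun v hv => ?_⟩
  obtain ⟨h1, h2⟩ := H v hv.1
  obtain ⟨h3, h4⟩ := H' v hv.2
  simp only [Vec.eval, map_mul, map_add] at *
  refine ⟨mul_ne_zero h1 h3, ?_⟩
  rw [← h2, ← h4]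
  ring

theorem IsSecAt.mul (hf : IsSecAt k x f) (hg : IsSecAt l x g) :
    IsSecAt (k + l) x (fun v => f v * g v) := by
  obtain ⟨V, hxV, p, q, P, Q, hP, hQ, e, H⟩ := hf
  obtain ⟨W, hxW, p', q', P', Q', hP', hQ', e', H'⟩ := hg
  refine ⟨V ⊓ W, ⟨hxV, hxW⟩, p + p', q + q', P * P', Q * Q', hP.mul hP',
    hQ.mul hQ', by rw [wt_add, wt_add, e, e']; abel, fun v hv => ?_⟩
  obtain ⟨h1, h2⟩ := H v hv.1
  obtain ⟨h3, h4⟩ := H' v hv.2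
  simp only [Vec.eval, map_mul] at *
  refine ⟨mul_ne_zero h1 h3, ?_⟩
  rw [← h2, ← h4]
  ring

theorem isSecAt_eval {P : BiPoly} {p : ℕ × ℕ} (hP : IsBihomogeneous P p) (x : X) :
    IsSecAt (wt p) x (fun v => v.1.eval P) :=
  ⟨⊤, trivial, p, 0, P, 1, hP, MvPolynomial.isWeightedHomogeneous_one ℂ _, by simp [wt_zero],
    fun v _ => by simp [Vec.eval]⟩

theorem isSecAt_const (c : ℂ) (x : X) : IsSecAt 0 x (fun _ => c) :=
  (isSecAt_eval (isBihomogeneous_C c) x).congr ⊤ trivial fun v _ => by simp [Vec.eval]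

theorem isSecAt_zero (k : ℤ × ℤ) (x : X) : IsSecAt k x (fun _ => 0) := by
  obtain ⟨v, rfl⟩ := Cone.exists_base x
  obtain ⟨i, hi⟩ := Function.ne_iff.1 v.1.z_ne
  obtain ⟨j, hj⟩ := Function.ne_iff.1 v.1.x_ne
  -- Bidegrees are natural but `k` may be negative: the zero numerator gets the positive parts of
  -- `k`, the denominator the negative parts, as powers of coordinates nonzero at the point.
  have hQ := ((isBihomogeneous_X_inl (τ := Fin 3) i).pow (-k.1).toNat).mul
    ((isBihomogeneous_X_inr (σ := Fin 2) j).pow (-k.2).toNat)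
  refine ⟨nonvanishing X hQ, (base_mem_nonvanishing hQ v).2 ?_, (k.1.toNat, k.2.toNat), _, 0, _,
    MvPolynomial.isWeightedHomogeneous_zero ℂ _ _, hQ, ?_,
    fun w hw => ⟨(base_mem_nonvanishing hQ w).1 hw, by simp [Vec.eval]⟩⟩
  · simpa [Vec.eval] using ⟨fun h => absurd h hi, fun h => absurd h hj⟩
  · ext <;> simp [wt] <;> omega

theorem isSecAt_z (i : Fin 2) (x : X) : IsSecAt (1, 0) x (fun v => v.1.z i) :=
  (isSecAt_eval (isBihomogeneous_X_inl i) x).congr ⊤ trivial fun v _ => by simp [Vec.eval]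

theorem isSecAt_x (i : Fin 3) (x : X) : IsSecAt (0, 1) x (fun v => v.1.x i) :=
  (isSecAt_eval (isBihomogeneous_X_inr i) x).congr ⊤ trivial fun v _ => by simp [Vec.eval]

theorem IsSecAt.const_mul (hf : IsSecAt k x f) (c : ℂ) : IsSecAt k x (fun v => c * f v) := by
  simpa using (isSecAt_const c x).mul hf

theorem IsSecAt.sub (hf : IsSecAt k x f) (hg : IsSecAt k x g) :
    IsSecAt k x (fun v => f v - g v) := by
  simpa [sub_eq_add_neg] using hf.add (hg.const_mul (-1))

theorem IsSecAt.pow (hf : IsSecAt k x f) (n : ℕ) : IsSecAt (n • k) x (fun v => f v ^ n) := by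
  induction n with
  | zero => simpa using isSecAt_const 1 x
  | succ n ih => simpa only [pow_succ, succ_nsmul] using ih.mul hf

theorem IsSecAt.prod {ι : Type*} (s : Finset ι) {k : ι → ℤ × ℤ} {f : ι → Cone X → ℂ}
    (h : ∀ i ∈ s, IsSecAt (k i) x (f i)) :
    IsSecAt (∑ i ∈ s, k i) x (fun v => ∏ i ∈ s, f i v) := by
  classical
  induction s using Finset.induction_on with
  | empty => simpa using isSecAt_const 1 x
  | insert a s ha ih =>
    simp only [Finset.sum_insert ha, Finset.prod_insert ha]
    exact (h a (by simp)).mul (ih fun i hi => h i (by simp [hi]))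

theorem IsSecAt.eval_eq_smul {v w : Cone X} (hf : IsSecAt k w.base f) {a b : ℂ} (ha : a ≠ 0)
    (hb : b ≠ 0) (hz : v.1.z = a • w.1.z) (hx : v.1.x = b • w.1.x) :
    f v = a ^ k.1 * b ^ k.2 * f w := by
  obtain ⟨V, hxV, p, q, P, Q, hP, hQ, e, H⟩ := hf
  have hvw : v.base = w.base :=
    Cone.base_eq_iff.2 (Vec.point_eq_iff.2 ⟨a, b, ha, hb, hz, hx⟩)
  obtain ⟨h1, h2⟩ := H w hxV
  obtain ⟨h3, h4⟩ := H v (hvw ▸ hxV)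
  simp only [Vec.eval, hz, hx, hP.eval_smul, hQ.eval_smul] at h1 h2 h3 h4
  rw [← h2] at h4
  have e1 : (p.1 : ℤ) = q.1 + k.1 := congrArg Prod.fst e
  have e2 : (p.2 : ℤ) = q.2 + k.2 := congrArg Prod.snd e
  have ea : a ^ p.1 = a ^ q.1 * a ^ k.1 := by
    rw [← zpow_natCast, ← zpow_natCast, e1, zpow_add₀ ha]
  have eb : b ^ p.2 = b ^ q.2 * b ^ k.2 := by
    rw [← zpow_natCast, ← zpow_natCast, e2, zpow_add₀ hb]
  rw [ea, eb] at h4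
  refine mul_right_cancel₀ h3 ?_
  rw [h4]
  ring

theorem IsSecAt.eq_of_base_eq {v w : Cone X} (h : v.base = w.base)
    (hf : IsSecAt 0 w.base f) : f v = f w := by
  obtain ⟨a, b, ha, hb, hz, hx⟩ := Vec.point_eq_iff.1 (Cone.base_eq_iff.1 h)
  rw [hf.eval_eq_smul ha hb hz hx]
  simp

theorem IsSecAt.exists_ne_zero {v : Cone X} (hf : IsSecAt k v.base f) (hv : f v ≠ 0) :
    ∃ V : Opens X, v.base ∈ V ∧ ∀ w : Cone X, w.base ∈ V → f w ≠ 0 := by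
  obtain ⟨V, hxV, p, q, P, Q, hP, hQ, e, H⟩ := hf
  refine ⟨V ⊓ nonvanishing X hP, ⟨hxV, (base_mem_nonvanishing hP v).2 ?_⟩, fun w hw h0 => ?_⟩
  · rw [← (H v hxV).2]
    exact mul_ne_zero hv (H v hxV).1
  · refine (base_mem_nonvanishing hP w).1 hw.2 ?_
    rw [← (H w hw.1).2, h0, zero_mul]

theorem IsSecAt.inv {v : Cone X} (hf : IsSecAt k v.base f) (hv : f v ≠ 0) :
    IsSecAt (-k) v.base (fun v => (f v)⁻¹) := by
  obtain ⟨W, hvW, hW⟩ := hf.exists_ne_zero hv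
  obtain ⟨V, hxV, p, q, P, Q, hP, hQ, e, H⟩ := hf
  refine ⟨V ⊓ W, ⟨hxV, hvW⟩, q, p, Q, P, hQ, hP, by rw [e]; abel, fun w hw => ?_⟩
  obtain ⟨h1, h2⟩ := H w hw.1
  have h3 := hW w hw.2
  rw [← h2]
  exact ⟨mul_ne_zero h3 h1, by field_simp⟩

theorem IsSecAt.div {v : Cone X} (hf : IsSecAt k v.base f) (hg : IsSecAt l v.base g)
    (hv : g v ≠ 0) : IsSecAt (k - l) v.base (fun v => f v / g v) := by
  simpa only [div_eq_mul_inv, sub_eq_add_neg] using hf.mul (hg.inv hv)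

theorem IsSecAt.sum {ι : Type*} (s : Finset ι) {f : ι → Cone X → ℂ}
    (h : ∀ i ∈ s, IsSecAt k x (f i)) : IsSecAt k x (fun v => ∑ i ∈ s, f i v) := by
  classical
  induction s using Finset.induction_on with
  | empty => simpa using isSecAt_zero k x
  | insert a s ha ih =>
    simp only [Finset.sum_insert ha]
    exact (h a (by simp)).add (ih fun i hi => h i (by simp [hi]))

end germs

/-! ### Sections as functions on the whole cone -/

section extension

variable {X : Set BiProj} {U : Opens X}

open Classical in
/-- Extension by zero of a function on the cone over `U`. -/
noncomputable def extendCone (s : {v : Cone X // v.base ∈ U} → ℂ) (v : Cone X) : ℂ :=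
  if h : v.base ∈ U then s ⟨v, h⟩ else 0

theorem extendCone_of_mem (s : {v : Cone X // v.base ∈ U} → ℂ) {v : Cone X} (h : v.base ∈ U) :
    extendCone s v = s ⟨v, h⟩ := dif_pos h

/-- The condition is local on `U`, so values off the cone over `U` do not matter; working with total
functions removes the subtypes. -/
theorem isTwistedSection_iff_extendCone {k : ℕ × ℕ} {s : {v : Cone X // v.base ∈ U} → ℂ} :
    IsTwistedSection k U s ↔ ∀ x ∈ U, IsSecAt (wt k) x (extendCone s) := by
  constructor
  · intro h x hx
    obtain ⟨V, hV, hxV, m, P, Q, hP, hQ, H⟩ := h x hx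
    refine ⟨V, hxV, k + m, m, P, Q, hP, hQ, by rw [wt_add, add_comm], fun v hv => ?_⟩
    rw [extendCone_of_mem s (hV hv)]
    exact H v hv
  · intro h x hx
    obtain ⟨V, hxV, p, q, P, Q, hP, hQ, e, H⟩ := h x hx
    have : p = k + q := wt_injective (by rw [wt_add, e, add_comm])
    subst this
    refine ⟨V ⊓ U, inf_le_right, ⟨hxV, hx⟩, q, P, Q, hP, hQ, fun v hv => ?_⟩
    have := H v hv.1
    rwa [extendCone_of_mem s hv.2] at this

theorem isTwistedSection_iff {k : ℕ × ℕ} {s : {v : Cone X // v.base ∈ U} → ℂ} {f : Cone X → ℂ}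
    (hf : ∀ v (h : v.base ∈ U), f v = s ⟨v, h⟩) :
    IsTwistedSection k U s ↔ ∀ x ∈ U, IsSecAt (wt k) x f := by
  rw [isTwistedSection_iff_extendCone]
  refine forall₂_congr fun x hx => ⟨fun h => h.congr U hx fun v hv => ?_,
    fun h => h.congr U hx fun v hv => ?_⟩
  · rw [extendCone_of_mem s hv, hf v hv]
  · rw [extendCone_of_mem s hv, hf v hv]

open Classical in
/-- The pullback to the cone of a function on `U`, extended by zero. -/
noncomputable def extendBase (g : U → ℂ) (v : Cone X) : ℂ :=
  if h : v.base ∈ U then g ⟨v.base, h⟩ else 0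

theorem extendBase_of_mem (g : U → ℂ) {v : Cone X} (h : v.base ∈ U) :
    extendBase g v = g ⟨v.base, h⟩ := dif_pos h

theorem isRegular_iff {g : U → ℂ} {f : Cone X → ℂ}
    (hf : ∀ v (h : v.base ∈ U), f v = g ⟨v.base, h⟩) :
    IsRegular U g ↔ ∀ x ∈ U, IsSecAt 0 x f :=
  isTwistedSection_iff (k := 0) hf

theorem isRegular_iff_extendBase {g : U → ℂ} :
    IsRegular U g ↔ ∀ x ∈ U, IsSecAt 0 x (extendBase g) :=
  isRegular_iff fun _ h => extendBase_of_mem g h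

end extension

/-! ### Maps of cones -/

/-- The homogeneous coordinates of `Ψ` on the first factor are sections of weight `α`, those on
the second factor are sections of weight `β`. -/
structure IsConeMap {X Y : Set BiProj} (α β : ℤ × ℤ) (Ψ : Cone X → Cone Y) : Prop where
  z : ∀ x i, IsSecAt α x (fun v => (Ψ v).1.z i)
  x : ∀ x j, IsSecAt β x (fun v => (Ψ v).1.x j)

namespace IsConeMap

variable {X Y : Set BiProj} {α β : ℤ × ℤ} {Ψ : Cone X → Cone Y}

/-- Every monomial of `P` has the same numbers of `z`- and `x`-factors, so all terms acquire the
same weight. Continuity and the pullback of sections both rest on this. -/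
theorem isSecAt_eval (hΨ : IsConeMap α β Ψ) {P : BiPoly} {d : ℕ × ℕ} (hP : IsBihomogeneous P d)
    (x : X) : IsSecAt (d.1 • α + d.2 • β) x (fun v => (Ψ v).1.eval P) := by
  simp only [Vec.eval, MvPolynomial.eval_eq', Fintype.prod_sum_type, Sum.elim_inl, Sum.elim_inr]
  refine IsSecAt.sum _ fun m hm => IsSecAt.const_mul ?_ _
  obtain ⟨h1, h2⟩ := hP.sum_inl_eq (MvPolynomial.mem_support_iff.1 hm)
  rw [← h1, ← h2, Finset.sum_smul, Finset.sum_smul]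
  exact (IsSecAt.prod _ fun i _ => (hΨ.z x i).pow _).mul
    (IsSecAt.prod _ fun i _ => (hΨ.x x i).pow _)

theorem base_eq (hΨ : IsConeMap α β Ψ) {v w : Cone X} (h : v.base = w.base) :
    (Ψ v).base = (Ψ w).base := by
  obtain ⟨a, b, ha, hb, hz, hx⟩ := Vec.point_eq_iff.1 (Cone.base_eq_iff.1 h)
  refine Cone.base_eq_iff.2 (Vec.point_eq_iff.2 ⟨a ^ α.1 * b ^ α.2, a ^ β.1 * b ^ β.2, ?_, ?_,
    funext fun i => (hΨ.z _ i).eval_eq_smul ha hb hz hx,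
    funext fun j => (hΨ.x _ j).eval_eq_smul ha hb hz hx⟩)
  · exact mul_ne_zero (zpow_ne_zero _ ha) (zpow_ne_zero _ hb)
  · exact mul_ne_zero (zpow_ne_zero _ ha) (zpow_ne_zero _ hb)

theorem exists_open (hΨ : IsConeMap α β Ψ) (V : Opens Y) (v : Cone X) (hv : (Ψ v).base ∈ V) :
    ∃ W : Opens X, v.base ∈ W ∧ ∀ w : Cone X, w.base ∈ W → (Ψ w).base ∈ V := by
  obtain ⟨F, d, hF, h1, h2⟩ := exists_nonvanishing_le V (Ψ v) hv
  obtain ⟨W, hvW, hW⟩ := (hΨ.isSecAt_eval hF v.base).exists_ne_zero h1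
  exact ⟨W, hvW, fun w hw => h2 _ (hW w hw)⟩

theorem isSecAt_comp (hΨ : IsConeMap α β Ψ) {k : ℤ × ℤ} {f : Cone Y → ℂ} {v : Cone X}
    (hf : IsSecAt k (Ψ v).base f) :
    IsSecAt (k.1 • α + k.2 • β) v.base (fun v => f (Ψ v)) := by
  obtain ⟨V, hxV, p, q, P, Q, hP, hQ, e, H⟩ := hf
  obtain ⟨W, hvW, hW⟩ := hΨ.exists_open V v hxV
  have h := ((hΨ.isSecAt_eval hP v.base).div (hΨ.isSecAt_eval hQ v.base)
    (H _ hxV).1).congr W hvW fun w hw => (div_eq_iff (H _ (hW w hw)).1).2 (H _ (hW w hw)).2.symm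
  convert h using 1
  have e1 : (p.1 : ℤ) = q.1 + k.1 := congrArg Prod.fst e
  have e2 : (p.2 : ℤ) = q.2 + k.2 := congrArg Prod.snd e
  rw [← natCast_zsmul, ← natCast_zsmul, ← natCast_zsmul, ← natCast_zsmul, e1, e2, add_smul,
    add_smul]
  abel

variable {α' β' : ℤ × ℤ} {Ψ' : Cone Y → Cone X}

/-- The map on points induced by a map of cones. -/
noncomputable def pointMap (Ψ : Cone X → Cone Y) (x : X) : Y :=
  (Ψ (Cone.exists_base x).choose).base

theorem pointMap_base (hΨ : IsConeMap α β Ψ) (v : Cone X) :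
    pointMap Ψ v.base = (Ψ v).base :=
  hΨ.base_eq (Cone.exists_base v.base).choose_spec

theorem continuous_pointMap (hΨ : IsConeMap α β Ψ) : Continuous (pointMap Ψ) := by
  refine continuous_def.2 fun V hV => isOpen_iff_forall_mem_open.2 fun x hx => ?_
  obtain ⟨v, rfl⟩ := Cone.exists_base x
  rw [Set.mem_preimage, hΨ.pointMap_base] at hx
  obtain ⟨W, hvW, hW⟩ := hΨ.exists_open ⟨V, hV⟩ v hx
  refine ⟨W, fun y hy => ?_, W.2, hvW⟩
  obtain ⟨w, rfl⟩ := Cone.exists_base y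
  rw [Set.mem_preimage, hΨ.pointMap_base]
  exact hW w hy

/-- The isomorphism of varieties induced by mutually inverse maps of cones. -/
noncomputable def varietyIso (hΨ : IsConeMap α β Ψ) (hΨ' : IsConeMap α' β' Ψ')
    (h : ∀ v, Ψ' (Ψ v) = v) (h' : ∀ w, Ψ (Ψ' w) = w) : VarietyIso X Y where
  toHomeomorph :=
    { toFun := pointMap Ψ
      invFun := pointMap Ψ'
      left_inv := fun x => by
        obtain ⟨v, rfl⟩ := Cone.exists_base x
        rw [hΨ.pointMap_base, hΨ'.pointMap_base, h]
      right_inv := fun y => by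
        obtain ⟨v, rfl⟩ := Cone.exists_base y
        rw [hΨ'.pointMap_base, hΨ.pointMap_base, h']
      continuous_toFun := hΨ.continuous_pointMap
      continuous_invFun := hΨ'.continuous_pointMap }
  isRegular_iff := fun V g => by
    rw [isRegular_iff_extendBase, isRegular_iff (f := fun v => extendBase g (Ψ v))]
    · constructor
      · intro H x hx
        obtain ⟨v, rfl⟩ := Cone.exists_base x
        have := hΨ.isSecAt_comp (k := 0) (H (Ψ v).base (by
          rw [← hΨ.pointMap_base]; exact hx))
        simpa using this
      · intro H y hy
        obtain ⟨w, rfl⟩ := Cone.exists_base y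
        have := hΨ'.isSecAt_comp (k := 0) (H (Ψ' w).base (by
          change pointMap Ψ _ ∈ V
          rw [hΨ.pointMap_base, h']
          exact hy))
        simpa [h'] using this
    · intro v hv
      have hv' : (Ψ v).base ∈ V := by rw [← hΨ.pointMap_base]; exact hv
      rw [extendBase_of_mem g hv']
      congr 2
      exact (hΨ.pointMap_base v).symm

theorem varietyIso_base (hΨ : IsConeMap α β Ψ) (hΨ' : IsConeMap α' β' Ψ')
    (h : ∀ v, Ψ' (Ψ v) = v) (h' : ∀ w, Ψ (Ψ' w) = w) (v : Cone X) :
    (hΨ.varietyIso hΨ' h h').toHomeomorph v.base = (Ψ v).base := hΨ.pointMap_base v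

theorem mem_preimage (hΨ : IsConeMap α β Ψ) (hΨ' : IsConeMap α' β' Ψ')
    (h : ∀ v, Ψ' (Ψ v) = v) (h' : ∀ w, Ψ (Ψ' w) = w) (V : Opens Y) (v : Cone X) :
    v.base ∈ (hΨ.varietyIso hΨ' h h').preimage V ↔ (Ψ v).base ∈ V := by
  rw [← hΨ.pointMap_base]; rfl

theorem isTwistedSection_comp (hΨ : IsConeMap α β Ψ) {a b c d : ℕ}
    (e : wt (a, b) = c • α + d • β) {V : Opens Y} {W : Opens X}
    (hW : ∀ v : Cone X, v.base ∈ W → (Ψ v).base ∈ V)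
    {s : {w : Cone Y // w.base ∈ V} → ℂ} (hs : IsTwistedSection (c, d) V s) :
    IsTwistedSection (a, b) W (fun v => s ⟨Ψ v.1, hW v.1 v.2⟩) := by
  refine (isTwistedSection_iff (f := fun v => extendCone s (Ψ v)) fun v hv => ?_).2
    fun x hx => ?_
  · exact extendCone_of_mem s (hW v hv)
  · obtain ⟨v, rfl⟩ := Cone.exists_base x
    rw [e]
    simpa [wt] using hΨ.isSecAt_comp (isTwistedSection_iff_extendCone.1 hs _ (hW v hx))

theorem mem_preimage_of_mem (hΨ : IsConeMap α β Ψ) (hΨ' : IsConeMap α' β' Ψ')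
    (h : ∀ v, Ψ' (Ψ v) = v) (h' : ∀ w, Ψ (Ψ' w) = w) (V : Opens Y) (w : Cone Y)
    (hw : w.base ∈ V) : (Ψ' w).base ∈ (hΨ.varietyIso hΨ' h h').preimage V :=
  (hΨ.mem_preimage hΨ' h h' V _).2 (by rwa [h'])

/-- The pullback of twisted sections along mutually inverse maps of cones. -/
noncomputable def pullback (hΨ : IsConeMap α β Ψ) (hΨ' : IsConeMap α' β' Ψ')
    (h : ∀ v, Ψ' (Ψ v) = v) (h' : ∀ w, Ψ (Ψ' w) = w) {a b c d : ℕ}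
    (e : wt (a, b) = c • α + d • β) (e' : wt (c, d) = a • α' + b • β') (V : Opens Y) :
    (twist Y c d).sections V ≃ₗ[ℂ]
      (twist X a b).sections ((hΨ.varietyIso hΨ' h h').preimage V) where
  toFun s := ⟨fun v => s.1 ⟨Ψ v.1, (hΨ.mem_preimage hΨ' h h' V v.1).1 v.2⟩,
    hΨ.isTwistedSection_comp e (fun v => (hΨ.mem_preimage hΨ' h h' V v).1) s.2⟩
  map_add' _ _ := rfl
  map_smul' _ _ := rfl
  invFun s := ⟨fun w => s.1 ⟨Ψ' w.1, hΨ.mem_preimage_of_mem hΨ' h h' V w.1 w.2⟩,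
    hΨ'.isTwistedSection_comp e' (hΨ.mem_preimage_of_mem hΨ' h h' V) s.2⟩
  left_inv s := Subtype.ext (funext fun w => congrArg s.1 (Subtype.ext (h' w.1)))
  right_inv s := Subtype.ext (funext fun w => congrArg s.1 (Subtype.ext (h w.1)))

/-- The isomorphism of twisting sheaves induced by mutually inverse maps of cones. -/
noncomputable def moduleIso (hΨ : IsConeMap α β Ψ) (hΨ' : IsConeMap α' β' Ψ')
    (h : ∀ v, Ψ' (Ψ v) = v) (h' : ∀ w, Ψ (Ψ' w) = w) {a b c d : ℕ}
    (e : wt (a, b) = c • α + d • β) (e' : wt (c, d) = a • α' + b • β') :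
    ModuleIso (hΨ.varietyIso hΨ' h h') (twist X a b) (twist Y c d) where
  equiv V := hΨ.pullback hΨ' h h' e e' V
  map_smul V g hg s t := by
    change g ⟨(Ψ t.1).base, _⟩ * _ = g ⟨pointMap Ψ t.1.base, _⟩ * _
    congr 3
    exact (hΨ.pointMap_base _).symm
  map_res U V hVU s t := rfl

end IsConeMap

/-! ### Binary forms -/

/-- The value at `z` of the binary form of degree `m` whose dehomogenization is `c`. -/
noncomputable def binForm (m : ℕ) (z : Fin 2 → ℂ) : Polynomial ℂ →ₗ[ℂ] ℂ where
  toFun c := ∑ i ∈ Finset.range (m + 1), c.coeff i * (z 0 ^ (m - i) * z 1 ^ i)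
  map_add' c d := by simp [add_mul, Finset.sum_add_distrib]
  map_smul' a c := by simp [Finset.mul_sum, mul_assoc]

theorem binForm_apply (m : ℕ) (z : Fin 2 → ℂ) (c : Polynomial ℂ) :
    binForm m z c = ∑ i ∈ Finset.range (m + 1), c.coeff i * (z 0 ^ (m - i) * z 1 ^ i) := rfl

theorem binForm_one_left {m : ℕ} {c : Polynomial ℂ} (hc : c.natDegree ≤ m) (y : ℂ) :
    binForm m ![1, y] c = c.eval y := by
  rw [Polynomial.eval_eq_sum_range' (Nat.lt_succ_of_le hc)]
  simp [binForm_apply]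

theorem exists_binForm_one_right (m : ℕ) (c : Polynomial ℂ) :
    ∃ d : Polynomial ℂ, ∀ y, binForm m ![y, 1] c = d.eval y :=
  ⟨∑ i ∈ Finset.range (m + 1), Polynomial.C (c.coeff i) * Polynomial.X ^ (m - i), fun y => by
    simp [binForm_apply, Polynomial.eval_finsetSum]⟩

theorem binForm_smul (m : ℕ) (a : ℂ) (z : Fin 2 → ℂ) (c : Polynomial ℂ) :
    binForm m (a • z) c = a ^ m * binForm m z c := by
  rw [binForm_apply, binForm_apply, Finset.mul_sum]
  refine Finset.sum_congr rfl fun i hi => ?_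
  obtain ⟨j, rfl⟩ : ∃ j, m = i + j := Nat.exists_eq_add_of_le (Finset.mem_range_succ_iff.1 hi)
  simp only [Pi.smul_apply, smul_eq_mul, Nat.add_sub_cancel_left]
  ring

theorem binForm_zero_deg (z : Fin 2 → ℂ) (c : ℂ) : binForm 0 z (Polynomial.C c) = c := by
  simp [binForm_apply]

theorem z_zero_mul_binForm {m : ℕ} {c : Polynomial ℂ} (hc : c.natDegree ≤ m) (z : Fin 2 → ℂ) :
    z 0 * binForm m z c = binForm (m + 1) z c := by
  rw [binForm_apply, binForm_apply, Finset.sum_range_succ _ (m + 1), Finset.mul_sum,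
    Polynomial.coeff_eq_zero_of_natDegree_lt (Nat.lt_succ_of_le hc), zero_mul, add_zero]
  refine Finset.sum_congr rfl fun i hi => ?_
  obtain ⟨j, rfl⟩ : ∃ j, m = i + j := Nat.exists_eq_add_of_le (Finset.mem_range_succ_iff.1 hi)
  rw [Nat.add_assoc, Nat.add_sub_cancel_left, Nat.add_sub_cancel_left]
  ring

theorem z_one_mul_binForm (m : ℕ) (c : Polynomial ℂ) (z : Fin 2 → ℂ) :
    z 1 * binForm m z c = binForm (m + 1) z (Polynomial.X * c) := by
  rw [binForm_apply, binForm_apply, Finset.sum_range_succ' _ (m + 1), Finset.mul_sum]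
  simp only [Polynomial.coeff_X_mul, Polynomial.coeff_X_mul_zero, zero_mul, add_zero,
    Nat.add_sub_add_right]
  refine Finset.sum_congr rfl fun i _ => ?_
  ring

theorem binForm_one_mul {m : ℕ} {g h : Polynomial ℂ} (hg : g.natDegree ≤ 1)
    (hh : h.natDegree ≤ m) (z : Fin 2 → ℂ) :
    binForm (m + 1) z (g * h) = binForm 1 z g * binForm m z h := by
  have e : g * h = g.coeff 0 • h + g.coeff 1 • (Polynomial.X * h) := by
    conv_lhs => rw [Polynomial.eq_X_add_C_of_natDegree_le_one hg]
    simp only [Polynomial.smul_eq_C_mul]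
    ring
  rw [e, map_add, map_smul, map_smul, ← z_zero_mul_binForm hh, ← z_one_mul_binForm]
  simp [binForm_apply, Finset.sum_range_succ]
  ring

theorem eq_zero_of_binForm_eq_zero {m : ℕ} {c : Polynomial ℂ} (hc : c.natDegree ≤ m)
    (h : ∀ z : Fin 2 → ℂ, z ≠ 0 → binForm m z c = 0) : c = 0 := by
  refine Polynomial.funext fun y => ?_
  rw [← binForm_one_left hc, h _ (fun h => by simpa using congrFun h 0), Polynomial.eval_zero]

theorem exists_binForm_eq_zero {m : ℕ} (hm : 0 < m) (c : Polynomial ℂ) :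
    ∃ z : Fin 2 → ℂ, z ≠ 0 ∧ binForm m z c = 0 := by
  by_cases h : c.coeff m = 0
  -- A vanishing top coefficient is a zero at infinity.
  · refine ⟨![0, 1], fun h => by simpa using congrFun h 1, ?_⟩
    rw [binForm_apply, Finset.sum_eq_single m]
    · simp [h]
    · intro i hi hne
      have : m - i ≠ 0 := by have := Finset.mem_range_succ_iff.1 hi; omega
      simp [this]
    · simp
  -- `binForm` ignores the coefficients of `c` beyond `m`, so the root is sought for the truncation;
  -- its nonzero coefficient in degree `m > 0` keeps it from being constant.
  · set d : Polynomial ℂ := ∑ i ∈ Finset.range (m + 1), Polynomial.C (c.coeff i) * Polynomial.X ^ i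
    have hd : d.coeff m = c.coeff m := by simp [d]
    have hdeg : d.degree ≠ 0 := by
      intro h0
      rw [Polynomial.eq_C_of_degree_eq_zero h0, Polynomial.coeff_C_of_ne_zero hm.ne'] at hd
      exact h hd.symm
    obtain ⟨y, hy⟩ := IsAlgClosed.exists_root d hdeg
    refine ⟨![1, y], fun h => by simpa using congrFun h 0, ?_⟩
    rw [← hy]
    simp [binForm_apply, d, Polynomial.eval_finsetSum]

theorem vec_two_eq {z : Fin 2 → ℂ} (h : z 0 ≠ 0) : z = z 0 • ![1, z 1 / z 0] := by
  ext i; fin_cases i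
  · simp
  · simp [mul_div_cancel₀, h]

theorem vec_two_eq' {z : Fin 2 → ℂ} (h : z 1 ≠ 0) : z = z 1 • ![z 0 / z 1, 1] := by
  ext i; fin_cases i
  · simp [mul_div_cancel₀, h]
  · simp

/-- The binary form as a polynomial in `Z₀, Z₁`. -/
noncomputable def binPoly (m : ℕ) (c : Polynomial ℂ) : BiPoly :=
  ∑ i ∈ Finset.range (m + 1), MvPolynomial.C (c.coeff i) *
    (MvPolynomial.X (Sum.inl 0) ^ (m - i) * MvPolynomial.X (Sum.inl 1) ^ i)

theorem isBihomogeneous_binPoly (m : ℕ) (c : Polynomial ℂ) :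
    IsBihomogeneous (binPoly m c) (m, 0) := by
  refine IsBihomogeneous.sum fun i hi => IsBihomogeneous.C_mul ?_ _
  obtain ⟨j, rfl⟩ : ∃ j, m = i + j := Nat.exists_eq_add_of_le (Finset.mem_range_succ_iff.1 hi)
  convert ((isBihomogeneous_X_inl (τ := Fin 3) (0 : Fin 2)).pow (i + j - i)).mul
    ((isBihomogeneous_X_inl (τ := Fin 3) (1 : Fin 2)).pow i) using 1
  ext <;> simp [add_comm]

theorem eval_binPoly (m : ℕ) (c : Polynomial ℂ) (z : Fin 2 → ℂ) (x : Fin 3 → ℂ) :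
    MvPolynomial.eval (Sum.elim z x) (binPoly m c) = binForm m z c := by
  simp [binPoly, binForm_apply]

theorem pderiv_inr_binPoly (m : ℕ) (c : Polynomial ℂ) (j : Fin 3) :
    MvPolynomial.pderiv (Sum.inr j) (binPoly m c) = 0 := by
  simp only [binPoly, map_sum]
  refine Finset.sum_eq_zero fun i _ => ?_
  simp [Derivation.leibniz, Derivation.leibniz_pow]

theorem isSecAt_binForm {X : Set BiProj} (m : ℕ) (c : Polynomial ℂ) (x : X) :
    IsSecAt (m, 0) x (fun v => binForm m v.1.z c) :=
  (isSecAt_eval (isBihomogeneous_binPoly m c) x).congr ⊤ trivial fun _ _ => eval_binPoly _ _ _ _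

/-! ### Functions which are locally quotients of polynomials -/

theorem exists_coprime_factorization {p q : Polynomial ℂ} (h : p ≠ 0 ∨ q ≠ 0) :
    ∃ d g₀ g₁ : Polynomial ℂ, d ≠ 0 ∧ p = g₀ * d ∧ q = g₁ * d ∧ IsCoprime g₀ g₁ := by
  have hd : EuclideanDomain.gcd p q ≠ 0 := fun h0 => by
    rw [EuclideanDomain.gcd_eq_zero_iff] at h0
    tauto
  obtain ⟨g₀, h₀⟩ := EuclideanDomain.gcd_dvd_left p q
  obtain ⟨g₁, h₁⟩ := EuclideanDomain.gcd_dvd_right p q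
  refine ⟨_, g₀, g₁, hd, by rw [mul_comm]; exact h₀, by rw [mul_comm]; exact h₁,
    EuclideanDomain.gcdA p q, EuclideanDomain.gcdB p q, mul_left_cancel₀ hd ?_⟩
  have e := EuclideanDomain.gcd_eq_gcd_ab p q
  generalize EuclideanDomain.gcd p q = d at *
  generalize EuclideanDomain.gcdA p q = s at *
  generalize EuclideanDomain.gcdB p q = t at *
  linear_combination -e - s * h₀ - t * h₁

/-- Reduce one local expression to `p / q` with `p`, `q` coprime. Any other local expression `P' /
Q'` agrees with it off a finite set, so `p Q' = q P'` and `q` divides `Q'`. As some such `Q'` is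
nonzero at each given point, `q` has no root and is constant. -/
theorem exists_polynomial_of_locally_quotient {f : ℂ → ℂ}
    (h : ∀ y₀ : ℂ, ∃ P Q : Polynomial ℂ, Q.eval y₀ ≠ 0 ∧ ∃ s : Set ℂ, s.Finite ∧ y₀ ∉ s ∧
      ∀ y ∉ s, f y * Q.eval y = P.eval y) : ∃ p : Polynomial ℂ, ∀ y, f y = p.eval y := by
  have key : ∀ (A B : Polynomial ℂ) (s : Set ℂ), s.Finite →
      (∀ y ∉ s, A.eval y = B.eval y) → A = B := fun A B s hs hAB =>
    Polynomial.eq_of_infinite_eval_eq A B (hs.infinite_compl.mono fun y hy => hAB y hy)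
  obtain ⟨P, Q, hQ, s, hs, -, hf⟩ := h 0
  obtain ⟨d, p, q, hd, hp, hq, hpq⟩ := exists_coprime_factorization (p := P) (q := Q)
    (Or.inr (by rintro rfl; simp at hQ))
  have main : ∀ (P' Q' : Polynomial ℂ) (s' : Set ℂ), s'.Finite →
      (∀ y ∉ s', f y * Q'.eval y = P'.eval y) → p * Q' = q * P' := by
    intro P' Q' s' hs' hf'
    refine mul_left_cancel₀ hd (key _ _ (s ∪ s') (hs.union hs') fun y hy => ?_)
    simp only [Set.mem_union, not_or] at hy
    have h1 := hf y hy.1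
    have h2 := hf' y hy.2
    simp only [hp, hq, Polynomial.eval_mul] at h1 h2 ⊢
    linear_combination (- Polynomial.eval y Q') * h1 +
      Polynomial.eval y q * Polynomial.eval y d * h2
  have hunit : ∀ y, q.eval y ≠ 0 := by
    intro y hy
    obtain ⟨P', Q', hQ', s', hs', -, hf'⟩ := h y
    obtain ⟨r, rfl⟩ : q ∣ Q' := hpq.symm.dvd_of_dvd_mul_left ⟨_, main P' Q' s' hs' hf'⟩
    simp [hy] at hQ'
  have hqdeg : q.degree = 0 := by
    by_contra h0
    obtain ⟨y, hy⟩ := IsAlgClosed.exists_root q h0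
    exact hunit y hy
  obtain ⟨c, rfl⟩ : ∃ c, q = Polynomial.C c := ⟨_, Polynomial.eq_C_of_degree_eq_zero hqdeg⟩
  have hc : c ≠ 0 := by simpa using hunit 0
  refine ⟨Polynomial.C c⁻¹ * p, fun y => ?_⟩
  obtain ⟨P', Q', hQ', s', hs', hys', hf'⟩ := h y
  have h1 := congrArg (Polynomial.eval y) (main P' Q' s' hs' hf')
  have h2 := hf' y hys'
  simp only [Polynomial.eval_mul, Polynomial.eval_C] at h1 ⊢
  rw [← h2] at h1
  have h3 : p.eval y = c * f y := mul_right_cancel₀ hQ' (by rw [h1, mul_assoc])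
  rw [h3, inv_mul_cancel_left₀ hc]

theorem eval_curve (pz : Fin 2 → Polynomial ℂ) (px : Fin 3 → Polynomial ℂ) (y : ℂ)
    (F : BiPoly) :
    (MvPolynomial.aeval (Sum.elim pz px) F).eval y =
      MvPolynomial.eval (Sum.elim (fun i => (pz i).eval y) (fun j => (px j).eval y)) F := by
  have h : (Polynomial.evalRingHom y).comp
      (MvPolynomial.aeval (R := ℂ) (Sum.elim pz px)).toRingHom =
      MvPolynomial.eval (Sum.elim (fun i => (pz i).eval y) (fun j => (px j).eval y)) := by
    refine MvPolynomial.ringHom_ext (fun r => by simp) fun i => ?_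
    cases i <;> simp
  exact congrArg (fun φ => φ F) h

/-- Along a polynomial curve, a neighbourhood of a point contains the complement of the root set of
a nonzero polynomial, so a section becomes locally a quotient of one-variable polynomials. -/
theorem exists_polynomial_of_curve {X : Set BiProj} {k : ℤ × ℤ} {f : Cone X → ℂ}
    (hf : ∀ x, IsSecAt k x f) (c : ℂ → Cone X) (pz : Fin 2 → Polynomial ℂ)
    (px : Fin 3 → Polynomial ℂ) (hz : ∀ y i, (c y).1.z i = (pz i).eval y)
    (hx : ∀ y j, (c y).1.x j = (px j).eval y) :
    ∃ p : Polynomial ℂ, ∀ y, f (c y) = p.eval y := by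
  have he : ∀ y F, (c y).1.eval F = (MvPolynomial.aeval (Sum.elim pz px) F).eval y := by
    intro y F
    rw [eval_curve, Vec.eval, funext (hz y), funext (hx y)]
  refine exists_polynomial_of_locally_quotient fun y₀ => ?_
  obtain ⟨V, hxV, p, q, P, Q, hP, hQ, e, H⟩ := hf (c y₀).base
  obtain ⟨F, d, hF, h1, h2⟩ := exists_nonvanishing_le V (c y₀) hxV
  set Fc := MvPolynomial.aeval (Sum.elim pz px) F with hFc
  have h0 : Fc.eval y₀ ≠ 0 := by rwa [← he]
  refine ⟨MvPolynomial.aeval (Sum.elim pz px) P, MvPolynomial.aeval (Sum.elim pz px) Q,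
    by rw [← he]; exact (H _ hxV).1, {y | Fc.eval y = 0}, ?_, h0, fun y hy => ?_⟩
  · exact Polynomial.finite_setOfPred_isRoot (by rintro h; simp [h] at h0)
  · rw [← he, ← he]
    exact (H _ (h2 _ (by rw [he]; exact hy))).2

/-- Transition between the two charts of `ℙ¹`: `φ(1, y) = yᵏ φ(1/y, 1)`, with the denominators of
`r(1/y)` cleared by `reverse`. -/
theorem eval_reverse_of_homogeneous {k : ℤ} {φ : (Fin 2 → ℂ) → ℂ}
    (hφ : ∀ (a : ℂ) (z : Fin 2 → ℂ), a ≠ 0 → z ≠ 0 → φ (a • z) = a ^ k * φ z)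
    {p r : Polynomial ℂ} (hp : ∀ y, φ ![1, y] = p.eval y) (hr : ∀ y, φ ![y, 1] = r.eval y)
    {y : ℂ} (hy : y ≠ 0) : p.eval y * y ^ r.natDegree = y ^ k * r.reverse.eval y := by
  let _ := invertibleOfNonzero (inv_ne_zero hy)
  have h1 := Polynomial.eval₂_reverse_mul_pow (RingHom.id ℂ) y⁻¹ r
  have h2 : ⅟(y⁻¹) = y := by simp
  rw [h2] at h1
  change r.reverse.eval y * _ = r.eval y⁻¹ at h1
  have h3 : (![1, y] : Fin 2 → ℂ) = y • ![y⁻¹, 1] := by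
    ext i; fin_cases i <;> simp [hy]
  rw [← hp, h3, hφ _ _ hy (fun h => by simpa using congrFun h 1), hr, ← h1,
    inv_pow]
  field_simp

/-- The sections of `𝒪(m)` on `ℙ¹`: since `r.reverse` has degree at most that of `r`, the transition
identity bounds the degree of `p` by `m`. -/
theorem exists_binForm_of_homogeneous {m : ℕ} {φ : (Fin 2 → ℂ) → ℂ}
    (hφ : ∀ (a : ℂ) (z : Fin 2 → ℂ), a ≠ 0 → z ≠ 0 → φ (a • z) = a ^ m * φ z)
    (hp : ∃ p : Polynomial ℂ, ∀ y, φ ![1, y] = p.eval y)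
    (hr : ∃ r : Polynomial ℂ, ∀ y, φ ![y, 1] = r.eval y) :
    ∃ c : Polynomial ℂ, c.natDegree ≤ m ∧ ∀ z, z ≠ 0 → φ z = binForm m z c := by
  obtain ⟨p, hp⟩ := hp
  obtain ⟨r, hr⟩ := hr
  have key : p * Polynomial.X ^ r.natDegree = Polynomial.X ^ m * r.reverse := by
    refine Polynomial.eq_of_infinite_eval_eq _ _
      ((Set.finite_singleton (0 : ℂ)).infinite_compl.mono fun y hy => ?_)
    simpa using eval_reverse_of_homogeneous (k := m) (by simpa using hφ) hp hr hy
  have hdeg : p.natDegree ≤ m := by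
    rcases eq_or_ne p 0 with rfl | hp0
    · simp
    have h1 := congrArg Polynomial.natDegree key
    rw [Polynomial.natDegree_mul_X_pow _ hp0] at h1
    have h2 := Polynomial.natDegree_mul_le (p := Polynomial.X ^ m) (q := r.reverse)
    have h3 := Polynomial.reverse_natDegree_le r
    rw [Polynomial.natDegree_X_pow] at h2
    omega
  have h0 : ∀ z : Fin 2 → ℂ, z 0 ≠ 0 → φ z = binForm m z p := by
    intro z hz
    rw [vec_two_eq hz, hφ _ _ hz (fun h => by simpa using congrFun h 0), binForm_smul,
      binForm_one_left hdeg, hp]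
  refine ⟨p, hdeg, fun z hz => ?_⟩
  by_cases hz0 : z 0 = 0
  · have hz1 : z 1 ≠ 0 := fun h => hz (by ext i; fin_cases i <;> simp [hz0, h])
    obtain ⟨d, hd⟩ := exists_binForm_one_right m p
    -- The point at infinity is reached by continuity: both polynomials agree at all `y ≠ 0`.
    have : r = d := by
      refine Polynomial.eq_of_infinite_eval_eq _ _
        ((Set.finite_singleton (0 : ℂ)).infinite_compl.mono fun y hy => ?_)
      change r.eval y = d.eval y
      rw [← hd, ← hr, h0 _ (by simpa using hy)]
    rw [vec_two_eq' hz1, hφ _ _ hz1 (fun h => by simpa using congrFun h 1), binForm_smul, hd,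
      hr, this]
  · exact h0 z hz0

/-- `𝒪(-m)` has no sections: a nonzero `p` would give `r.reverse` a degree larger than that of `r`.
-/
theorem eq_zero_of_homogeneous_neg {m : ℕ} (hm : 0 < m) {φ : (Fin 2 → ℂ) → ℂ}
    (hφ : ∀ (a : ℂ) (z : Fin 2 → ℂ), a ≠ 0 → z ≠ 0 → φ (a • z) = a ^ (-(m : ℤ)) * φ z)
    (hp : ∃ p : Polynomial ℂ, ∀ y, φ ![1, y] = p.eval y)
    (hr : ∃ r : Polynomial ℂ, ∀ y, φ ![y, 1] = r.eval y) (z : Fin 2 → ℂ) (hz : z ≠ 0) :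
    φ z = 0 := by
  obtain ⟨p, hp⟩ := hp
  obtain ⟨r, hr⟩ := hr
  have key : p * Polynomial.X ^ (r.natDegree + m) = r.reverse := by
    refine Polynomial.eq_of_infinite_eval_eq _ _
      ((Set.finite_singleton (0 : ℂ)).infinite_compl.mono fun y hy => ?_)
    have h1 := eval_reverse_of_homogeneous hφ hp hr hy
    change Polynomial.eval y (p * Polynomial.X ^ (r.natDegree + m)) = r.reverse.eval y
    have hy' : y ≠ 0 := hy
    simp only [Polynomial.eval_mul, Polynomial.eval_pow, Polynomial.eval_X, pow_add]
    rw [← mul_assoc, h1, zpow_neg, zpow_natCast]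
    field_simp
  have hp0 : p = 0 := by
    by_contra hp0
    have h1 := congrArg Polynomial.natDegree key
    rw [Polynomial.natDegree_mul_X_pow _ hp0] at h1
    have h3 := Polynomial.reverse_natDegree_le r
    omega
  have hr0 : r = 0 := by rwa [hp0, zero_mul, eq_comm, Polynomial.reverse_eq_zero] at key
  by_cases hz0 : z 0 = 0
  · have hz1 : z 1 ≠ 0 := fun h => hz (by ext i; fin_cases i <;> simp [hz0, h])
    rw [vec_two_eq' hz1, hφ _ _ hz1 (fun h => by simpa using congrFun h 1), hr, hr0]
    simp
  · rw [vec_two_eq hz0, hφ _ _ hz0 (fun h => by simpa using congrFun h 0), hp, hp0]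
    simp

/-! ### Divisors of bidegree `(2, 1)` as scrolls -/

theorem IsBihomogeneous.exists_binForm {F : BiPoly} {m : ℕ} (hF : IsBihomogeneous F (m, 1)) :
    ∃ q : Fin 3 → Polynomial ℂ, (∀ j, (q j).natDegree ≤ m) ∧
      ∀ z x, MvPolynomial.eval (Sum.elim z x) F = ∑ j, binForm m z (q j) * x j := by
  have key : ∀ s : Finset (Fin 2 ⊕ Fin 3 →₀ ℕ), s ⊆ F.support →
      ∃ q : Fin 3 → Polynomial ℂ, (∀ j, (q j).natDegree ≤ m) ∧
        ∀ (z : Fin 2 → ℂ) (x : Fin 3 → ℂ), ∑ d ∈ s, MvPolynomial.coeff d F *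
          ∏ i, Sum.elim z x i ^ d i = ∑ j, binForm m z (q j) * x j := by
    classical
    intro s
    induction s using Finset.induction_on with
    | empty => exact fun _ => ⟨0, by simp, by simp⟩
    | insert d s hd ih =>
      intro hs
      obtain ⟨q, hq, e⟩ := ih ((Finset.subset_insert _ _).trans hs)
      obtain ⟨h1, h2⟩ := hF.sum_inl_eq
        (MvPolynomial.mem_support_iff.1 (hs (Finset.mem_insert_self _ _)))
      simp only [Fin.sum_univ_two, Fin.sum_univ_three] at h1 h2
      -- Total degree one in `x` means that exactly one exponent is 1, so each monomial contributes
      -- to a single coefficient `q j`.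
      obtain ⟨j, hj⟩ : ∃ j : Fin 3, ∀ x : Fin 3 → ℂ, ∏ i, x i ^ d (Sum.inr i) = x j := by
        simp only [Fin.prod_univ_three]
        rcases Nat.eq_zero_or_pos (d (Sum.inr 0)) with h | h
        · rcases Nat.eq_zero_or_pos (d (Sum.inr 1)) with h' | h'
          · exact ⟨2, fun x => by
              rw [h, h', show d (Sum.inr 2) = 1 by omega]; simp⟩
          · exact ⟨1, fun x => by
              rw [h, show d (Sum.inr 1) = 1 by omega, show d (Sum.inr 2) = 0 by omega]; simp⟩
        · exact ⟨0, fun x => by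
            rw [show d (Sum.inr 0) = 1 by omega, show d (Sum.inr 1) = 0 by omega,
              show d (Sum.inr 2) = 0 by omega]; simp⟩
      set r := Polynomial.monomial (d (Sum.inl 1)) (MvPolynomial.coeff d F) with hr
      have hr' : r.natDegree ≤ m := (Polynomial.natDegree_monomial_le _).trans (by omega)
      have hrz : ∀ z : Fin 2 → ℂ, binForm m z r =
          MvPolynomial.coeff d F * (z 0 ^ d (Sum.inl 0) * z 1 ^ d (Sum.inl 1)) := by
        intro z
        rw [binForm_apply, Finset.sum_eq_single (d (Sum.inl 1))]
        · rw [hr, Polynomial.coeff_monomial_same, show m - d (Sum.inl 1) = d (Sum.inl 0) by omega]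
        · intro i _ hi
          rw [hr, Polynomial.coeff_monomial_of_ne _ hi, zero_mul]
        · intro h
          exact absurd (Finset.mem_range.2 (by omega)) h
      refine ⟨Function.update q j (q j + r), fun i => ?_, fun z x => ?_⟩
      · rcases eq_or_ne i j with rfl | h
        · rw [Function.update_self]
          exact (Polynomial.natDegree_add_le _ _).trans (max_le (hq i) hr')
        · rw [Function.update_of_ne h]
          exact hq i
      · have h3 : ∀ i, binForm m z (Function.update q j (q j + r) i) * x i =
            binForm m z (q i) * x i + if i = j then binForm m z r * x j else 0 := by
          intro i
          rcases eq_or_ne i j with rfl | h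
          · rw [Function.update_self, map_add, if_pos rfl, add_mul]
          · rw [Function.update_of_ne h, if_neg h, add_zero]
        rw [Finset.sum_insert hd, e, Finset.sum_congr rfl fun i _ => h3 i,
          Finset.sum_add_distrib, Finset.sum_ite_eq' Finset.univ j, if_pos (Finset.mem_univ _),
          hrz, Fintype.prod_sum_type]
        simp only [Sum.elim_inl, Sum.elim_inr, hj, Fin.prod_univ_two]
        ring
  obtain ⟨q, hq, e⟩ := key F.support subset_rfl
  exact ⟨q, hq, fun z x => by rw [MvPolynomial.eval_eq', e]⟩

/-- The vector of values at `z` of a triple of binary forms of degree `m`. -/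
noncomputable def formVec (m : ℕ) (z : Fin 2 → ℂ) (c : Fin 3 → Polynomial ℂ) : Fin 3 → ℂ :=
  fun j => binForm m z (c j)

open Matrix in
/-- The divisor `F = 0` of bidegree `(2, 1)` is the projective bundle of the lines in the
subbundle of `𝒪³` spanned by two vectors `σ`, `τ` of binary forms of degrees `a` and `b`. -/
structure ScrollData (F : BiPoly) where
  q : Fin 3 → Polynomial ℂ
  a : ℕ
  b : ℕ
  σ : Fin 3 → Polynomial ℂ
  τ : Fin 3 → Polynomial ℂ
  eval_eq : ∀ z x, MvPolynomial.eval (Sum.elim z x) F = formVec 2 z q ⬝ᵥ x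
  natDegree_q : ∀ j, (q j).natDegree ≤ 2
  q_ne : ∀ z, z ≠ 0 → formVec 2 z q ≠ 0
  add_eq : a + b = 2
  le : b ≤ a
  natDegree_σ : ∀ j, (σ j).natDegree ≤ a
  natDegree_τ : ∀ j, (τ j).natDegree ≤ b
  cross : ∀ z, crossProduct (formVec a z σ) (formVec b z τ) = formVec 2 z q

open Matrix in
theorem eval_pderiv_inl_of_eval_eq {F : BiPoly} {q : Fin 3 → Polynomial ℂ}
    (h : ∀ z x, MvPolynomial.eval (Sum.elim z x) F = formVec 2 z q ⬝ᵥ x) (z : Fin 2 → ℂ) :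
    (∀ i, ∃ r : Fin 3 → ℂ, ∀ x, MvPolynomial.eval (Sum.elim z x)
      (MvPolynomial.pderiv (Sum.inl i) F) = r ⬝ᵥ x) ∧
    ∀ j x, MvPolynomial.eval (Sum.elim z x) (MvPolynomial.pderiv (Sum.inr j) F) =
      formVec 2 z q j := by
  have hF : F = ∑ j, binPoly 2 (q j) * MvPolynomial.X (Sum.inr j) := by
    refine MvPolynomial.funext fun u => ?_
    obtain ⟨z, x, rfl⟩ : ∃ z x, u = Sum.elim z x := ⟨_, _, (Sum.elim_comp_inl_inr u).symm⟩
    rw [h, map_sum]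
    simp [dotProduct, eval_binPoly, formVec]
  constructor
  · intro i
    -- The coefficients `binPoly` do not involve `x`, so their `z`-derivatives may be evaluated at
    -- `x = 0`.
    refine ⟨fun j => MvPolynomial.eval (Sum.elim z 0)
      (MvPolynomial.pderiv (Sum.inl i) (binPoly 2 (q j))), fun x => ?_⟩
    have h1 : ∀ j, MvPolynomial.eval (Sum.elim z x)
        (MvPolynomial.pderiv (Sum.inl i) (binPoly 2 (q j))) = MvPolynomial.eval (Sum.elim z 0)
        (MvPolynomial.pderiv (Sum.inl i) (binPoly 2 (q j))) := by
      intro j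
      simp only [binPoly, map_sum]
      refine Finset.sum_congr rfl fun k _ => ?_
      simp [Derivation.leibniz, Derivation.leibniz_pow, MvPolynomial.pderiv_X, Pi.single_apply,
        apply_ite (MvPolynomial.eval _)]
    rw [hF, map_sum, map_sum]
    simp [dotProduct, Derivation.leibniz, h1, mul_comm]
  · intro j x
    rw [hF, map_sum, map_sum]
    simp [Derivation.leibniz, pderiv_inr_binPoly, MvPolynomial.pderiv_X, Pi.single_apply,
      apply_ite (MvPolynomial.eval _), eval_binPoly, formVec]

open Matrix in
-- At a zero `z` of `q` the `x`-derivatives of `F` vanish for every `x`, while the two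
-- `z`-derivatives are linear forms in three variables and have a common nontrivial zero, which is a
-- singular point.
theorem IsSmooth.formVec_ne_zero {F : BiPoly} (hF : IsSmooth F) {q : Fin 3 → Polynomial ℂ}
    (h : ∀ z x, MvPolynomial.eval (Sum.elim z x) F = formVec 2 z q ⬝ᵥ x) (z : Fin 2 → ℂ)
    (hz : z ≠ 0) : formVec 2 z q ≠ 0 := by
  intro h0
  obtain ⟨h1, h2⟩ := eval_pderiv_inl_of_eval_eq h z
  choose r hr using h1
  have hker := LinearMap.ker_ne_bot_of_finrank_lt (f := (Matrix.of r).mulVecLin) (by simp)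
  obtain ⟨x, hx, hx0⟩ := (Submodule.ne_bot_iff _).1 hker
  obtain ⟨i, hi⟩ := hF ⟨z, x, hz, hx0⟩ (by rw [Vec.eval, h, h0, zero_dotProduct])
  apply hi
  rcases i with i | j
  · exact (hr i x).trans (congrFun hx i)
  · exact (h2 j x).trans (congrFun h0 j)

open Matrix in
-- Take the constant relation `g · q = 0` as `τ`, choose `κ` with `κ · g = 1` and put `σ = κ × q`:
-- then `(κ × q) × g = (κ · g) q - (q · g) κ = q`.
theorem exists_cross_of_dependent {q : Fin 3 → Polynomial ℂ} (hq : ∀ j, (q j).natDegree ≤ 2)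
    (h : ¬ LinearIndependent ℂ q) : ∃ σ τ : Fin 3 → Polynomial ℂ, (∀ j, (σ j).natDegree ≤ 2) ∧
      (∀ j, (τ j).natDegree ≤ 0) ∧
      ∀ z, crossProduct (formVec 2 z σ) (formVec 0 z τ) = formVec 2 z q := by
  obtain ⟨g, hg, i, hi⟩ := Fintype.not_linearIndependent_iff.1 h
  obtain ⟨κ, hκ⟩ : ∃ κ : Fin 3 → ℂ, κ 0 * g 0 + κ 1 * g 1 + κ 2 * g 2 = 1 := by
    refine ⟨Pi.single i (g i)⁻¹, ?_⟩
    rw [← Fin.sum_univ_three (fun j => (Pi.single i (g i)⁻¹ : Fin 3 → ℂ) j * g j),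
      Finset.sum_eq_single i]
    · simp [hi]
    · intro j _ hj
      simp [hj]
    · simp
  have hdeg : ∀ (c d : ℂ) (j k : Fin 3), (c • q j - d • q k).natDegree ≤ 2 := fun c d j k =>
    (Polynomial.natDegree_sub_le _ _).trans (max_le
      ((Polynomial.natDegree_smul_le _ _).trans (hq j))
      ((Polynomial.natDegree_smul_le _ _).trans (hq k)))
  refine ⟨![κ 1 • q 2 - κ 2 • q 1, κ 2 • q 0 - κ 0 • q 2, κ 0 • q 1 - κ 1 • q 0],
    fun j => Polynomial.C (g j), ?_, fun j => (Polynomial.natDegree_C _).le, fun z => ?_⟩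
  · intro j; fin_cases j <;> exact hdeg _ _ _ _
  · have h0 := congrArg (binForm 2 z) hg
    simp only [Fin.sum_univ_three, map_add, map_smul, smul_eq_mul, map_zero] at h0
    ext j
    fin_cases j <;> simp only [formVec, cross_apply, binForm_zero_deg, Matrix.cons_val,
      map_sub, map_smul, smul_eq_mul, Fin.zero_eta, Fin.mk_one, Fin.reduceFinMk, Fin.isValue]
    · linear_combination binForm 2 z (q 0) * hκ - κ 0 * h0
    · linear_combination binForm 2 z (q 1) * hκ - κ 1 * h0
    · linear_combination binForm 2 z (q 2) * hκ - κ 2 * h0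

open Matrix in
-- The components of `q` form a basis of the quadratic forms, so there are constant vectors `e₀, e₁,
-- e₂` with `eₘ · q = z₀²⁻ᵐ z₁ᵐ`. Then `z₁ e₀ - z₀ e₁` and `z₁ e₁ - z₀ e₂` are syzygies of `q`.
-- Their cross product is `det(e) q`, by the dual basis formula, which explains the factor `D⁻¹` in
-- `τ`.
theorem exists_cross_of_independent {q : Fin 3 → Polynomial ℂ} (hq : ∀ j, (q j).natDegree ≤ 2)
    (h : LinearIndependent ℂ q) : ∃ σ τ : Fin 3 → Polynomial ℂ, (∀ j, (σ j).natDegree ≤ 1) ∧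
      (∀ j, (τ j).natDegree ≤ 1) ∧
      ∀ z, crossProduct (formVec 1 z σ) (formVec 1 z τ) = formVec 2 z q := by
  have hspan : Submodule.span ℂ (Set.range q) = Polynomial.degreeLT ℂ 3 := by
    refine Submodule.eq_of_le_of_finrank_le (Submodule.span_le.2 ?_) ?_
    · rintro _ ⟨j, rfl⟩
      exact Polynomial.mem_degreeLT.2 ((Polynomial.degree_le_of_natDegree_le (hq j)).trans_lt
        (by norm_num))
    · rw [finrank_span_eq_card h, (Polynomial.degreeLTEquiv ℂ 3).finrank_eq]
      simp
  have he : ∀ m : Fin 3, ∃ e : Fin 3 → ℂ, ∑ j, e j • q j = Polynomial.X ^ (m : ℕ) := fun m => by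
    refine (Submodule.mem_span_range_iff_exists_fun ℂ).1 (hspan ▸ ?_)
    exact Polynomial.mem_degreeLT.2 (by
      rw [Polynomial.degree_X_pow]; exact_mod_cast m.2)
  choose e he using he
  set Q : Matrix (Fin 3) (Fin 3) ℂ := fun j m => (q j).coeff m
  have hdet : (Matrix.of e).det ≠ 0 := by
    have : Matrix.of e * Q = 1 := by
      ext k m
      have := congrArg (fun p => Polynomial.coeff p m) (he k)
      simp only [Polynomial.finsetSum_coeff, Polynomial.coeff_smul, smul_eq_mul,
        Polynomial.coeff_X_pow] at this
      rw [Matrix.mul_apply, Matrix.one_apply]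
      simp only [Matrix.of_apply, Q, this, Fin.ext_iff, eq_comm]
    exact fun h0 => by simpa [h0] using congrArg Matrix.det this
  set D := (Matrix.of e).det with hD
  have hdeg : ∀ c d : ℂ, (Polynomial.C c + Polynomial.C d * Polynomial.X).natDegree ≤ 1 :=
    fun c d => by rw [add_comm]; exact Polynomial.natDegree_linear_le
  refine ⟨fun j => Polynomial.C (-e 1 j) + Polynomial.C (e 0 j) * Polynomial.X,
    fun j => Polynomial.C (-D⁻¹ * e 2 j) + Polynomial.C (D⁻¹ * e 1 j) * Polynomial.X,
    fun j => hdeg _ _, fun j => hdeg _ _, fun z => ?_⟩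
  have h0 := congrArg (binForm 2 z) (he 0)
  have h1 := congrArg (binForm 2 z) (he 1)
  have h2 := congrArg (binForm 2 z) (he 2)
  have hX : ∀ m : Fin 3, binForm 2 z (Polynomial.X ^ (m : ℕ)) =
      z 0 ^ (2 - (m : ℕ)) * z 1 ^ (m : ℕ) := by
    intro m
    fin_cases m <;> simp [binForm_apply, Polynomial.coeff_X, Polynomial.coeff_one]
  rw [hX] at h0 h1 h2
  have hl : ∀ c d : ℂ, binForm 1 z (Polynomial.C c + Polynomial.C d * Polynomial.X) =
      c * z 0 + d * z 1 := by
    intro c d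
    simp [binForm_apply, Finset.sum_range_succ]
  simp only [Fin.sum_univ_three, map_add, map_smul, smul_eq_mul] at h0 h1 h2
  norm_num at h0 h1 h2
  rw [Matrix.det_fin_three] at hD
  simp only [Matrix.of_apply] at hD
  have hDD : D⁻¹ * D = 1 := inv_mul_cancel₀ hdet
  ext j
  fin_cases j <;> simp only [formVec, cross_apply, Matrix.cons_val, hl,
      Fin.zero_eta, Fin.mk_one, Fin.reduceFinMk, Fin.isValue]
  · linear_combination binForm 2 z (q 0) * hDD - D⁻¹ * binForm 2 z (q 0) * hD
      - D⁻¹ * (e 1 1 * e 2 2 - e 1 2 * e 2 1) * h0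
      - D⁻¹ * (e 2 1 * e 0 2 - e 2 2 * e 0 1) * h1
      - D⁻¹ * (e 0 1 * e 1 2 - e 0 2 * e 1 1) * h2
  · linear_combination binForm 2 z (q 1) * hDD - D⁻¹ * binForm 2 z (q 1) * hD
      - D⁻¹ * (e 1 2 * e 2 0 - e 1 0 * e 2 2) * h0
      - D⁻¹ * (e 2 2 * e 0 0 - e 2 0 * e 0 2) * h1
      - D⁻¹ * (e 0 2 * e 1 0 - e 0 0 * e 1 2) * h2
  · linear_combination binForm 2 z (q 2) * hDD - D⁻¹ * binForm 2 z (q 2) * hD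
      - D⁻¹ * (e 1 0 * e 2 1 - e 1 1 * e 2 0) * h0
      - D⁻¹ * (e 2 0 * e 0 1 - e 2 1 * e 0 0) * h1
      - D⁻¹ * (e 0 0 * e 1 1 - e 0 1 * e 1 0) * h2

theorem IsSmooth.nonempty_scrollData {F : BiPoly} (hF : IsBihomogeneous F (2, 1))
    (hs : IsSmooth F) : Nonempty (ScrollData F) := by
  obtain ⟨q, hq, he⟩ := hF.exists_binForm
  by_cases h : LinearIndependent ℂ q
  · obtain ⟨σ, τ, hσ, hτ, hc⟩ := exists_cross_of_independent hq h
    exact ⟨⟨q, 1, 1, σ, τ, he, hq, hs.formVec_ne_zero he, rfl, le_rfl, hσ, hτ, hc⟩⟩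
  · obtain ⟨σ, τ, hσ, hτ, hc⟩ := exists_cross_of_dependent hq h
    exact ⟨⟨q, 2, 0, σ, τ, he, hq, hs.formVec_ne_zero he, rfl, Nat.zero_le _, hσ, hτ, hc⟩⟩

open Matrix in
-- Cramer's rule in the plane orthogonal to `s × t`, read off at a nonzero component of `q`.
theorem exists_coord_of_cross {s t q x : Fin 3 → ℂ} (h : crossProduct s t = q) (hq : q ≠ 0)
    (hx : q ⬝ᵥ x = 0) : ∃ w : Fin 2 → ℂ, x = w 0 • s + w 1 • t := by
  have h0 := congrFun h 0
  have h1 := congrFun h 1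
  have h2 := congrFun h 2
  simp only [cross_apply, Matrix.cons_val] at h0 h1 h2
  simp only [dotProduct, Fin.sum_univ_three] at hx
  obtain ⟨i, hi⟩ := Function.ne_iff.1 hq
  refine ⟨![crossProduct x t i / q i, crossProduct s x i / q i], ?_⟩
  simp only [Matrix.cons_val_zero, Matrix.cons_val_one]
  ext j
  refine mul_left_cancel₀ hi ?_
  simp only [Pi.add_apply, Pi.smul_apply, smul_eq_mul, mul_add]
  have e : ∀ u v : ℂ, q i * (u / q i * v) = u * v := fun u v => by
    rw [← mul_assoc, mul_div_cancel₀ _ hi]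
  rw [e, e]
  fin_cases i <;> fin_cases j <;> simp only [cross_apply, Matrix.cons_val, Fin.zero_eta,
    Fin.mk_one, Fin.reduceFinMk, Fin.isValue]
  · linear_combination hx + h1 * x 1 + h2 * x 2
  · linear_combination - h0 * x 1
  · linear_combination - h0 * x 2
  · linear_combination - h1 * x 0
  · linear_combination hx + h0 * x 0 + h2 * x 2
  · linear_combination - h1 * x 2
  · linear_combination - h2 * x 0
  · linear_combination - h2 * x 1
  · linear_combination hx + h0 * x 0 + h1 * x 1

open Matrix in
-- The orthogonal complement of the plane spanned by `s`, `t` is the line of `s × t`.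
theorem exists_smul_of_orthogonal {s t q r : Fin 3 → ℂ} (h : crossProduct s t = q) (hq : q ≠ 0)
    (hs : r ⬝ᵥ s = 0) (ht : r ⬝ᵥ t = 0) : ∃ c : ℂ, r = c • q := by
  obtain ⟨i, hi⟩ := Function.ne_iff.1 hq
  have e : ∀ j, r j * q i = r i * q j := by
    intro j
    subst h
    simp only [dotProduct, Fin.sum_univ_three] at hs ht
    fin_cases i <;> fin_cases j <;> simp only [cross_apply, Matrix.cons_val, Fin.zero_eta,
      Fin.mk_one, Fin.reduceFinMk, Fin.isValue]
    · linear_combination t 2 * hs - s 2 * ht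
    · linear_combination s 1 * ht - t 1 * hs
    · linear_combination s 2 * ht - t 2 * hs
    · linear_combination t 0 * hs - s 0 * ht
    · linear_combination t 1 * hs - s 1 * ht
    · linear_combination s 0 * ht - t 0 * hs
  refine ⟨r i / q i, funext fun j => ?_⟩
  rw [Pi.smul_apply, smul_eq_mul, div_mul_eq_mul_div, eq_div_iff hi, e j]

/-! ### Fibre coordinates on the cone over the scroll -/

namespace ScrollData

open Matrix

variable {F : BiPoly} (D : ScrollData F)

theorem isBihomogeneous {F : BiPoly} (D : ScrollData F) : IsBihomogeneous F (2, 1) := by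
  have hF : F = ∑ j, binPoly 2 (D.q j) * MvPolynomial.X (Sum.inr j) := by
    refine MvPolynomial.funext fun u => ?_
    obtain ⟨z, x, rfl⟩ : ∃ z x, u = Sum.elim z x := ⟨_, _, (Sum.elim_comp_inl_inr u).symm⟩
    rw [D.eval_eq, map_sum]
    simp [dotProduct, eval_binPoly, formVec]
  rw [hF]
  exact IsBihomogeneous.sum fun j _ => (isBihomogeneous_binPoly _ _).mul (isBihomogeneous_X_inr j)

theorem dot_eq_zero (v : Cone (zeroLocus F)) : formVec 2 v.1.z D.q ⬝ᵥ v.1.x = 0 := by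
  rw [← D.eval_eq]
  exact v.2 v.1 rfl

theorem exists_coord (v : Cone (zeroLocus F)) : ∃ w : Fin 2 → ℂ,
    v.1.x = w 0 • formVec D.a v.1.z D.σ + w 1 • formVec D.b v.1.z D.τ :=
  exists_coord_of_cross (D.cross _) (D.q_ne _ v.1.z_ne) (D.dot_eq_zero v)

/-- The coordinates of `x` with respect to `σ(z)`, `τ(z)`. -/
noncomputable def coord (v : Cone (zeroLocus F)) : Fin 2 → ℂ := (D.exists_coord v).choose

theorem x_eq (v : Cone (zeroLocus F)) : v.1.x =
    D.coord v 0 • formVec D.a v.1.z D.σ + D.coord v 1 • formVec D.b v.1.z D.τ :=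
  (D.exists_coord v).choose_spec

/-- The cross product with `τ` kills the `τ`-term and turns `σ` into `q`, which is nonzero;
symmetrically for `σ`. -/
theorem vec_unique {z : Fin 2 → ℂ} (hz : z ≠ 0) {S T S' T' : ℂ}
    (h : S • formVec D.a z D.σ + T • formVec D.b z D.τ =
      S' • formVec D.a z D.σ + T' • formVec D.b z D.τ) : S = S' ∧ T = T' := by
  obtain ⟨i, hi⟩ := Function.ne_iff.1 (D.q_ne z hz)
  constructor
  · have := congrFun (congrArg (fun x => crossProduct x (formVec D.b z D.τ)) h) i
    simp only [map_add, map_smul, LinearMap.add_apply, LinearMap.smul_apply, cross_self,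
      smul_zero, add_zero, D.cross, Pi.smul_apply, smul_eq_mul] at this
    exact mul_right_cancel₀ hi this
  · have := congrFun (congrArg (crossProduct (formVec D.a z D.σ)) h) i
    simp only [map_add, map_smul, cross_self,
      smul_zero, zero_add, D.cross, Pi.smul_apply, smul_eq_mul] at this
    exact mul_right_cancel₀ hi this

theorem coord_ne_zero (v : Cone (zeroLocus F)) : D.coord v ≠ 0 := fun h =>
  v.1.x_ne (by rw [D.x_eq v, h]; simp)

/-- The point of the cone with given coordinates. -/
noncomputable def conePoint (z : Fin 2 → ℂ) (hz : z ≠ 0) (w : Fin 2 → ℂ) (hw : w ≠ 0) :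
    Cone (zeroLocus F) :=
  ⟨⟨z, w 0 • formVec D.a z D.σ + w 1 • formVec D.b z D.τ, hz, fun h => hw (by
      have := D.vec_unique hz (S' := 0) (T' := 0) (h.trans (by simp))
      ext i; fin_cases i
      exacts [this.1, this.2])⟩, (point_mem_zeroLocus D.isBihomogeneous).2 (by
    rw [Vec.eval, D.eval_eq, ← D.cross, dotProduct_add, dotProduct_smul, dotProduct_smul,
      dotProduct_comm _ (formVec D.a z D.σ), dotProduct_comm _ (formVec D.b z D.τ)]
    simp)⟩

theorem coord_conePoint {z : Fin 2 → ℂ} (hz : z ≠ 0) {w : Fin 2 → ℂ} (hw : w ≠ 0) :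
    D.coord (D.conePoint z hz w hw) = w := by
  have := D.vec_unique hz (D.x_eq (D.conePoint z hz w hw)).symm
  ext i; fin_cases i
  exacts [this.1, this.2]

theorem conePoint_coord (v : Cone (zeroLocus F)) :
    D.conePoint v.1.z v.1.z_ne (D.coord v) (D.coord_ne_zero v) = v :=
  Subtype.ext (Vec.ext' rfl (D.x_eq v).symm)

/-- This exhibits the coordinate `S` as a quotient of polynomials wherever a component of `q` is
nonzero. -/
theorem coord_zero_mul (v : Cone (zeroLocus F)) (i : Fin 3) :
    D.coord v 0 * formVec 2 v.1.z D.q i = crossProduct v.1.x (formVec D.b v.1.z D.τ) i := by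
  conv_rhs => rw [D.x_eq v]
  simp [D.cross]

theorem coord_one_mul (v : Cone (zeroLocus F)) (i : Fin 3) :
    D.coord v 1 * formVec 2 v.1.z D.q i = crossProduct (formVec D.a v.1.z D.σ) v.1.x i := by
  conv_rhs => rw [D.x_eq v]
  simp [D.cross]

theorem isSecAt_coord_zero (x : zeroLocus F) :
    IsSecAt (-(D.a : ℤ), 1) x (fun v => D.coord v 0) := by
  obtain ⟨v, rfl⟩ := Cone.exists_base x
  obtain ⟨i, hi⟩ := Function.ne_iff.1 (D.q_ne v.1.z v.1.z_ne)
  have hq : IsSecAt (2, 0) v.base (fun v => formVec 2 v.1.z D.q i) := isSecAt_binForm _ _ _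
  have hc : IsSecAt ((D.b : ℤ), 1) v.base
      (fun v => crossProduct v.1.x (formVec D.b v.1.z D.τ) i) := by
    have hm : ∀ j k : Fin 3, IsSecAt ((D.b : ℤ), 1) v.base
        (fun v => v.1.x j * binForm D.b v.1.z (D.τ k)) := fun j k => by
      simpa using (isSecAt_x j v.base).mul (isSecAt_binForm D.b (D.τ k) v.base)
    fin_cases i <;> simp only [cross_apply, Matrix.cons_val, Fin.zero_eta,
      Fin.mk_one, Fin.reduceFinMk, Fin.isValue] <;>
      exact (hm _ _).sub (hm _ _)
  obtain ⟨W, hvW, hW⟩ := hq.exists_ne_zero hi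
  have h := (hc.div hq hi).congr W hvW fun w hw =>
    (div_eq_iff (hW w hw)).2 (D.coord_zero_mul w i).symm
  -- The weight of the quotient is `(b, 1) - (2, 0)`, and `b - 2 = -a`.
  convert h using 1
  have := D.add_eq
  ext <;> simp <;> omega

theorem isSecAt_coord_one (x : zeroLocus F) :
    IsSecAt (-(D.b : ℤ), 1) x (fun v => D.coord v 1) := by
  obtain ⟨v, rfl⟩ := Cone.exists_base x
  obtain ⟨i, hi⟩ := Function.ne_iff.1 (D.q_ne v.1.z v.1.z_ne)
  have hq : IsSecAt (2, 0) v.base (fun v => formVec 2 v.1.z D.q i) := isSecAt_binForm _ _ _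
  have hc : IsSecAt ((D.a : ℤ), 1) v.base
      (fun v => crossProduct (formVec D.a v.1.z D.σ) v.1.x i) := by
    have hm : ∀ j k : Fin 3, IsSecAt ((D.a : ℤ), 1) v.base
        (fun v => binForm D.a v.1.z (D.σ k) * v.1.x j) := fun j k => by
      simpa using (isSecAt_binForm D.a (D.σ k) v.base).mul (isSecAt_x j v.base)
    fin_cases i <;> simp only [cross_apply, Matrix.cons_val, Fin.zero_eta,
      Fin.mk_one, Fin.reduceFinMk, Fin.isValue] <;>
      exact (hm _ _).sub (hm _ _)
  obtain ⟨W, hvW, hW⟩ := hq.exists_ne_zero hi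
  have h := (hc.div hq hi).congr W hvW fun w hw =>
    (div_eq_iff (hW w hw)).2 (D.coord_one_mul w i).symm
  convert h using 1
  have := D.add_eq
  ext <;> simp <;> omega

/-! ### Global sections -/

theorem formVec_smul (m : ℕ) (c : ℂ) (z : Fin 2 → ℂ) (s : Fin 3 → Polynomial ℂ) :
    formVec m (c • z) s = c ^ m • formVec m z s :=
  funext fun j => binForm_smul m c z (s j)

/-- On a fibre `z` is fixed and `x` is linear in `w`, so the bundle of weight `(k, m)` restricts to
`𝒪(m)` on `ℙ¹`. -/
theorem exists_binForm_fibre {k : ℤ} {m : ℕ} {f : Cone (zeroLocus F) → ℂ}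
    (hf : ∀ x, IsSecAt (k, (m : ℤ)) x f) (z : Fin 2 → ℂ) (hz : z ≠ 0) :
    ∃ c : Polynomial ℂ, c.natDegree ≤ m ∧
      ∀ w (hw : w ≠ 0), f (D.conePoint z hz w hw) = binForm m w c := by
  classical
  have h1 : ∀ y : ℂ, (![1, y] : Fin 2 → ℂ) ≠ 0 := fun y h => by simpa using congrFun h 0
  have h2 : ∀ y : ℂ, (![y, 1] : Fin 2 → ℂ) ≠ 0 := fun y h => by simpa using congrFun h 1
  suffices h : ∃ c : Polynomial ℂ, c.natDegree ≤ m ∧ ∀ w, w ≠ 0 →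
      (fun w => if hw : w = 0 then 0 else f (D.conePoint z hz w hw)) w = binForm m w c by
    obtain ⟨c, hc, h⟩ := h
    exact ⟨c, hc, fun w hw => by
      have := h w hw
      dsimp only at this
      rwa [dif_neg hw] at this⟩
  refine exists_binForm_of_homogeneous ?_ ?_ ?_
  · intro a w ha hw
    rw [dif_neg hw, dif_neg (smul_ne_zero ha hw)]
    have := (hf (D.conePoint z hz w hw).base).eval_eq_smul
      (v := D.conePoint z hz (a • w) (smul_ne_zero ha hw))
      (a := 1) (b := a) one_ne_zero ha (by rw [one_smul]; rfl)
      (by simp [conePoint, smul_smul])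
    simpa using this
  · obtain ⟨p, hp⟩ := exists_polynomial_of_curve hf (fun y => D.conePoint z hz ![1, y] (h1 y))
      (fun i => Polynomial.C (z i)) (fun j => Polynomial.C (formVec D.a z D.σ j) +
        Polynomial.C (formVec D.b z D.τ j) * Polynomial.X) (by simp [conePoint])
        (fun y j => by simp [conePoint]; ring)
    exact ⟨p, fun y => by rw [← hp, dif_neg (h1 y)]⟩
  · obtain ⟨p, hp⟩ := exists_polynomial_of_curve hf (fun y => D.conePoint z hz ![y, 1] (h2 y))
      (fun i => Polynomial.C (z i)) (fun j => Polynomial.C (formVec D.a z D.σ j) * Polynomial.X +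
        Polynomial.C (formVec D.b z D.τ j)) (by simp [conePoint])
        (fun y j => by simp [conePoint]; ring)
    exact ⟨p, fun y => by rw [← hp, dif_neg (h2 y)]⟩

/-- On the curve with fixed fibre coordinates `w`, the vector `x` has degree `n` in `z`, so weight
`(k, l)` restricts to `𝒪(k + n l)`. The applications are `w = (1, 0)` with `ρ = σ` and `w = (0, 1)`
with `ρ = τ`. -/
theorem exists_binForm_section {k : ℤ} {l : ℤ} {m n : ℕ} {f : Cone (zeroLocus F) → ℂ}
    (hf : ∀ x, IsSecAt (k, l) x f) {ρ : Fin 3 → Polynomial ℂ} (hρ : ∀ j, (ρ j).natDegree ≤ n)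
    (w : Fin 2 → ℂ) (hw : w ≠ 0)
    (hρw : ∀ z, w 0 • formVec D.a z D.σ + w 1 • formVec D.b z D.τ = formVec n z ρ)
    (hm : (m : ℤ) = k + n * l) :
    ∃ c : Polynomial ℂ, c.natDegree ≤ m ∧
      ∀ z (hz : z ≠ 0), f (D.conePoint z hz w hw) = binForm m z c := by
  classical
  have h1 : ∀ y : ℂ, (![1, y] : Fin 2 → ℂ) ≠ 0 := fun y h => by simpa using congrFun h 0
  have h2 : ∀ y : ℂ, (![y, 1] : Fin 2 → ℂ) ≠ 0 := fun y h => by simpa using congrFun h 1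
  have hx : ∀ z (hz : z ≠ 0), (D.conePoint z hz w hw).1.x = formVec n z ρ := fun z hz => hρw z
  suffices h : ∃ c : Polynomial ℂ, c.natDegree ≤ m ∧ ∀ z, z ≠ 0 →
      (fun z => if hz : z = 0 then 0 else f (D.conePoint z hz w hw)) z = binForm m z c by
    obtain ⟨c, hc, h⟩ := h
    exact ⟨c, hc, fun z hz => by
      have := h z hz
      dsimp only at this
      rwa [dif_neg hz] at this⟩
  refine exists_binForm_of_homogeneous ?_ ?_ ?_
  · intro a z ha hz
    rw [dif_neg hz, dif_neg (smul_ne_zero ha hz)]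
    have := (hf (D.conePoint z hz w hw).base).eval_eq_smul
      (v := D.conePoint (a • z) (smul_ne_zero ha hz) w hw)
      (a := a) (b := a ^ n) ha (pow_ne_zero _ ha) rfl
      (by rw [hx, hx, formVec_smul])
    rw [this, ← zpow_natCast, ← _root_.zpow_mul, ← _root_.zpow_add₀ ha, ← hm, zpow_natCast]
  · obtain ⟨p, hp⟩ := exists_polynomial_of_curve hf (fun y => D.conePoint ![1, y] (h1 y) w hw)
      ![1, Polynomial.X] ρ (fun y i => by fin_cases i <;> simp [conePoint])
      (fun y j => by rw [hx, formVec, binForm_one_left (hρ j)])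
    exact ⟨p, fun y => by rw [← hp, dif_neg (h1 y)]⟩
  · choose d hd using fun j => exists_binForm_one_right n (ρ j)
    obtain ⟨p, hp⟩ := exists_polynomial_of_curve hf (fun y => D.conePoint ![y, 1] (h2 y) w hw)
      ![Polynomial.X, 1] d (fun y i => by fin_cases i <;> simp [conePoint])
      (fun y j => by rw [hx, formVec, hd])
    exact ⟨p, fun y => by rw [← hp, dif_neg (h2 y)]⟩

/-- The function is constant along the section `σ` and along every fibre, and each fibre meets that
section. -/
theorem const_of_isSecAt_zero {F : BiPoly} (D : ScrollData F)
    {f : Cone (zeroLocus F) → ℂ} (hf : ∀ x, IsSecAt 0 x f) :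
    ∃ c, ∀ v, f v = c := by
  have hw : (![1, 0] : Fin 2 → ℂ) ≠ 0 := fun h => by simpa using congrFun h 0
  obtain ⟨c, hc, h⟩ := D.exists_binForm_section (k := 0) (l := 0) (m := 0) hf D.natDegree_σ
    ![1, 0] hw (by simp) (by simp)
  refine ⟨c.coeff 0, fun v => ?_⟩
  obtain ⟨d, hd, h'⟩ := D.exists_binForm_fibre (k := 0) (m := 0) hf v.1.z v.1.z_ne
  have e : ∀ (w : Fin 2 → ℂ) (p : Polynomial ℂ), binForm 0 w p = p.coeff 0 := by
    simp [binForm_apply]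
  rw [← D.conePoint_coord v, h', e, ← e ![1, 0] d, ← h' _ hw, h, e]

/-- The function `S α(z) + T β(z)` on the cone, `α`, `β` binary forms of degrees `m`, `l`. -/
noncomputable def form (m l : ℕ) : Polynomial ℂ × Polynomial ℂ →ₗ[ℂ] Cone (zeroLocus F) → ℂ where
  toFun p v := D.coord v 0 * binForm m v.1.z p.1 + D.coord v 1 * binForm l v.1.z p.2
  map_add' p q := by ext v; simp; ring
  map_smul' c p := by ext v; simp; ring

theorem form_apply (m l : ℕ) (p : Polynomial ℂ × Polynomial ℂ) (v : Cone (zeroLocus F)) :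
    D.form m l p v = D.coord v 0 * binForm m v.1.z p.1 + D.coord v 1 * binForm l v.1.z p.2 := rfl

theorem form_eq_zero {m l : ℕ} {p : Polynomial ℂ × Polynomial ℂ} (h1 : p.1.natDegree ≤ m)
    (h2 : p.2.natDegree ≤ l) (h : D.form m l p = 0) : p = 0 := by
  refine Prod.ext (eq_zero_of_binForm_eq_zero h1 fun z hz => ?_)
    (eq_zero_of_binForm_eq_zero h2 fun z hz => ?_)
  · have hw : (![1, 0] : Fin 2 → ℂ) ≠ 0 := fun h => by simpa using congrFun h 0
    have := congrFun h (D.conePoint z hz _ hw)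
    rw [form_apply, coord_conePoint] at this
    simpa [conePoint] using this
  · have hw : (![0, 1] : Fin 2 → ℂ) ≠ 0 := fun h => by simpa using congrFun h 1
    have := congrFun h (D.conePoint z hz _ hw)
    rw [form_apply, coord_conePoint] at this
    simpa [conePoint] using this

theorem isSecAt_form (p : Polynomial ℂ × Polynomial ℂ) (x : zeroLocus F) :
    IsSecAt (0, 1) x (D.form D.a D.b p) := by
  refine IsSecAt.add ?_ ?_
  · simpa using (D.isSecAt_coord_zero x).mul (isSecAt_binForm D.a p.1 x)
  · simpa using (D.isSecAt_coord_one x).mul (isSecAt_binForm D.b p.2 x)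

/-- The restrictions to the sections `σ` and `τ` give `α` and `β`; as `f` is linear on each fibre,
its values at `(1, 0)` and `(0, 1)` determine it. -/
theorem exists_form_eq {f : Cone (zeroLocus F) → ℂ} (hf : ∀ x, IsSecAt (0, 1) x f) :
    ∃ p : Polynomial ℂ × Polynomial ℂ, p.1.natDegree ≤ D.a ∧ p.2.natDegree ≤ D.b ∧
      f = D.form D.a D.b p := by
  have hw : (![1, 0] : Fin 2 → ℂ) ≠ 0 := fun h => by simpa using congrFun h 0
  have hw' : (![0, 1] : Fin 2 → ℂ) ≠ 0 := fun h => by simpa using congrFun h 1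
  obtain ⟨α, hα, h⟩ := D.exists_binForm_section (m := D.a) hf D.natDegree_σ ![1, 0] hw
    (by simp) (by simp)
  obtain ⟨β, hβ, h'⟩ := D.exists_binForm_section (m := D.b) hf D.natDegree_τ ![0, 1] hw'
    (by simp) (by simp)
  refine ⟨(α, β), hα, hβ, funext fun v => ?_⟩
  obtain ⟨c, hc, e⟩ := D.exists_binForm_fibre (m := 1) hf v.1.z v.1.z_ne
  have e1 := e _ hw
  have e2 := e _ hw'
  rw [h] at e1
  rw [h'] at e2
  rw [form_apply, e1, e2]
  conv_lhs => rw [← D.conePoint_coord v, e]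
  simp [binForm_apply, Finset.sum_range_succ]
  ring

/-! ### Bilinear forms on the cone -/

/-- Write the form as `r(z) · x` with `r` linear in `z`. Vanishing on the scroll makes `r(z)`
orthogonal to `σ(z)` and `τ(z)`, so `r = c q`. Here `c` is homogeneous of degree `1 - 2 = -1` and,
being locally `rᵢ / qᵢ`, polynomial in both charts; hence `c = 0`. -/
theorem eq_zero_of_tensor_eq_zero {F : BiPoly} (D : ScrollData F)
    (β : (Fin 2 × Fin 3 → ℂ) →ₗ[ℂ] ℂ)
    (h : ∀ v : Cone (zeroLocus F), β (tensor v.1.z v.1.x) = 0) : β = 0 := by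
  classical
  set r : Fin 3 → Polynomial ℂ := fun j => Polynomial.C (β (Pi.single (0, j) 1)) +
    Polynomial.C (β (Pi.single (1, j) 1)) * Polynomial.X with hr
  have hrz : ∀ z j, formVec 1 z r j =
      β (Pi.single (0, j) 1) * z 0 + β (Pi.single (1, j) 1) * z 1 := by
    intro z j
    simp [hr, formVec, binForm_apply, Finset.sum_range_succ]
  have hdeg : ∀ j, (r j).natDegree ≤ 1 := fun j => by
    rw [hr]; dsimp only; rw [add_comm]; exact Polynomial.natDegree_linear_le
  have hβ : ∀ z x, β (tensor z x) = formVec 1 z r ⬝ᵥ x := by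
    intro z x
    rw [β.pi_apply_eq_sum_univ, Fintype.sum_prod_type_right]
    refine Finset.sum_congr rfl fun j _ => ?_
    have e : ∀ p : Fin 2 × Fin 3, (fun k => if p = k then (1 : ℂ) else 0) = Pi.single p 1 :=
      fun p => by ext k; simp [Pi.single_apply, eq_comm]
    rw [hrz, Fin.sum_univ_two, e, e]
    simp only [tensor, smul_eq_mul]
    ring
  have hex : ∀ z, z ≠ 0 → ∃ c : ℂ, formVec 1 z r = c • formVec 2 z D.q := by
    intro z hz
    have hw : (![1, 0] : Fin 2 → ℂ) ≠ 0 := fun h => by simpa using congrFun h 0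
    have hw' : (![0, 1] : Fin 2 → ℂ) ≠ 0 := fun h => by simpa using congrFun h 1
    refine exists_smul_of_orthogonal (D.cross z) (D.q_ne z hz) ?_ ?_
    · have := h (D.conePoint z hz _ hw)
      rw [hβ] at this
      simpa [conePoint] using this
    · have := h (D.conePoint z hz _ hw')
      rw [hβ] at this
      simpa [conePoint] using this
  choose! c hc using hex
  have h1 : ∀ y : ℂ, (![1, y] : Fin 2 → ℂ) ≠ 0 := fun y h => by simpa using congrFun h 0
  have h2 : ∀ y : ℂ, (![y, 1] : Fin 2 → ℂ) ≠ 0 := fun y h => by simpa using congrFun h 1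
  have hc0 : ∀ z, z ≠ 0 → c z = 0 := by
    refine eq_zero_of_homogeneous_neg one_pos ?_ ?_ ?_
    · intro a z ha hz
      obtain ⟨i, hi⟩ := Function.ne_iff.1 (D.q_ne z hz)
      have e1 := congrFun (hc z hz) i
      have e2 := congrFun (hc (a • z) (smul_ne_zero ha hz)) i
      rw [formVec_smul, formVec_smul, Pi.smul_apply, e1] at e2
      simp only [Pi.smul_apply, smul_eq_mul] at e2
      have hi' : formVec 2 z D.q i ≠ 0 := hi
      have : a * (c z * formVec 2 z D.q i) = a * (c (a • z) * a * formVec 2 z D.q i) := by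
        linear_combination e2
      have := mul_right_cancel₀ hi' ((mul_left_cancel₀ ha this).trans rfl)
      rw [this, Nat.cast_one, _root_.zpow_neg_one]
      field_simp
    · refine exists_polynomial_of_locally_quotient fun y₀ => ?_
      obtain ⟨i, hi⟩ := Function.ne_iff.1 (D.q_ne _ (h1 y₀))
      refine ⟨r i, D.q i, by rwa [← binForm_one_left (D.natDegree_q i)], ∅, Set.finite_empty,
        fun h => h, fun y _ => ?_⟩
      have := congrFun (hc _ (h1 y)) i
      simp only [formVec, Pi.smul_apply, smul_eq_mul, binForm_one_left (D.natDegree_q i),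
        binForm_one_left (hdeg i)] at this
      exact this.symm
    · refine exists_polynomial_of_locally_quotient fun y₀ => ?_
      obtain ⟨i, hi⟩ := Function.ne_iff.1 (D.q_ne _ (h2 y₀))
      obtain ⟨d, hd⟩ := exists_binForm_one_right 1 (r i)
      obtain ⟨d', hd'⟩ := exists_binForm_one_right 2 (D.q i)
      refine ⟨d, d', by rwa [← hd'], ∅, Set.finite_empty,
        fun h => h, fun y _ => ?_⟩
      have := congrFun (hc _ (h2 y)) i
      simp only [formVec, Pi.smul_apply, smul_eq_mul, hd, hd'] at this
      exact this.symm
  have hr0 : ∀ z, z ≠ 0 → formVec 1 z r = 0 := fun z hz => by rw [hc z hz, hc0 z hz, zero_smul]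
  refine LinearMap.pi_ext' fun p => LinearMap.ext_ring ?_
  obtain ⟨i, j⟩ := p
  have e0 := congrFun (hr0 ![1, 0] (h1 0)) j
  have e1 := congrFun (hr0 ![0, 1] (h2 0)) j
  rw [hrz] at e0 e1
  fin_cases i
  · simpa using e0
  · simpa using e1

end ScrollData

/-! ### The cone over a Hirzebruch surface -/

theorem mem_hirzebruch {n : ℕ} {v : Vec} : v.point ∈ hirzebruch n ↔
    v.z 0 ^ n * v.x 1 = v.z 1 ^ n * v.x 0 := by
  have h : IsBihomogeneous (MvPolynomial.X (Sum.inl 0) ^ n * MvPolynomial.X (Sum.inr 1)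
      - MvPolynomial.X (Sum.inl 1) ^ n * MvPolynomial.X (Sum.inr 0) : BiPoly) (n, 1) := by
    have e : ∀ i j, IsBihomogeneous (MvPolynomial.X (Sum.inl i) ^ n *
        MvPolynomial.X (Sum.inr j) : BiPoly) (n, 1) := fun i j => by
      simpa using ((isBihomogeneous_X_inl (τ := Fin 3) i).pow n).mul (isBihomogeneous_X_inr j)
    exact (e _ _).sub (e _ _)
  rw [hirzebruch, point_mem_zeroLocus h]
  simp [Vec.eval, sub_eq_zero]

namespace Hirzebruch

variable {n : ℕ}

/-- The equation of `𝔽ₙ` says that `(x₀, x₁)` is proportional to `(z₀ⁿ, z₁ⁿ)`. Here `castSucc` picks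
out the first two of the three coordinates. -/
theorem exists_coord (v : Cone (hirzebruch n)) :
    ∃ s : ℂ, ∀ i : Fin 2, v.1.x i.castSucc = v.1.z i ^ n * s := by
  have h := mem_hirzebruch.1 v.2
  obtain ⟨i, hi⟩ := Function.ne_iff.1 v.1.z_ne
  have hi' : v.1.z i ^ n ≠ 0 := pow_ne_zero _ hi
  refine ⟨v.1.x i.castSucc / v.1.z i ^ n, fun j => ?_⟩
  rw [mul_div_assoc', eq_div_iff hi']
  fin_cases i <;> fin_cases j <;> simp <;>
    first | ring1 | linear_combination h | linear_combination -h

/-- The fibre coordinate which vanishes on the minimal section. -/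
noncomputable def coord (v : Cone (hirzebruch n)) : ℂ := (exists_coord v).choose

theorem x_castSucc (v : Cone (hirzebruch n)) (i : Fin 2) :
    v.1.x i.castSucc = v.1.z i ^ n * coord v := (exists_coord v).choose_spec i

theorem isSecAt_coord (x : hirzebruch n) : IsSecAt (-(n : ℤ), 1) x coord := by
  obtain ⟨v, rfl⟩ := Cone.exists_base x
  obtain ⟨i, hi⟩ := Function.ne_iff.1 v.1.z_ne
  have hz := (isSecAt_z i v.base).pow n
  have hi' : v.1.z i ^ n ≠ 0 := pow_ne_zero _ hi
  obtain ⟨W, hvW, hW⟩ := hz.exists_ne_zero hi'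
  have := ((isSecAt_x i.castSucc v.base).div hz hi').congr (g := coord) W hvW fun w hw => by
    rw [x_castSucc, mul_div_cancel_left₀ _ (hW w hw)]
  simpa using this

theorem coord_or_x_two_ne_zero (v : Cone (hirzebruch n)) : coord v ≠ 0 ∨ v.1.x 2 ≠ 0 := by
  by_contra! h
  refine v.1.x_ne (funext fun j => ?_)
  have h0 := x_castSucc v 0
  have h1 := x_castSucc v 1
  rw [h.1, mul_zero] at h0 h1
  fin_cases j
  exacts [h0, h1, h.2]

/-- The point of the cone with given coordinates. -/
noncomputable def conePoint (n : ℕ) (z : Fin 2 → ℂ) (hz : z ≠ 0) (s t : ℂ)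
    (hw : s ≠ 0 ∨ t ≠ 0) : Cone (hirzebruch n) :=
  ⟨⟨z, ![z 0 ^ n * s, z 1 ^ n * s, t], hz, fun h => by
    have h0 := congrFun h 0
    have h1 := congrFun h 1
    have h2 := congrFun h 2
    simp only [Matrix.cons_val, Pi.zero_apply, mul_eq_zero, pow_eq_zero_iff'] at h0 h1 h2
    rcases hw with hw | hw
    · apply hz
      ext i; fin_cases i
      · simpa [hw] using (h0.resolve_right hw).1
      · simpa [hw] using (h1.resolve_right hw).1
    · exact hw h2⟩, mem_hirzebruch.2 (by simp; ring)⟩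

theorem coord_conePoint (z : Fin 2 → ℂ) (hz : z ≠ 0) (s t : ℂ) (hw : s ≠ 0 ∨ t ≠ 0) :
    coord (conePoint n z hz s t hw) = s := by
  obtain ⟨i, hi⟩ := Function.ne_iff.1 hz
  have hi' : z i ^ n ≠ 0 := pow_ne_zero _ hi
  have h := x_castSucc (conePoint n z hz s t hw) i
  refine mul_left_cancel₀ hi' (h.symm.trans ?_)
  fin_cases i <;> simp [conePoint]

theorem conePoint_coord (v : Cone (hirzebruch n)) :
    conePoint n v.1.z v.1.z_ne (coord v) (v.1.x 2) (coord_or_x_two_ne_zero v) = v := by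
  refine Subtype.ext (Vec.ext' rfl (funext fun j => ?_))
  fin_cases j
  exacts [(x_castSucc v 0).symm, (x_castSucc v 1).symm, rfl]

end Hirzebruch

/-! ### The isomorphism of the scroll with a Hirzebruch surface -/

namespace ScrollData

open Hirzebruch

variable {F : BiPoly} (D : ScrollData F)

theorem coord_zero_or_one_ne_zero (v : Cone (zeroLocus F)) : D.coord v 0 ≠ 0 ∨ D.coord v 1 ≠ 0 := by
  by_contra! h
  refine D.coord_ne_zero v (funext fun i => ?_)
  fin_cases i
  exacts [h.1, h.2]

/-- The map of cones from the divisor to the Hirzebruch surface. -/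
noncomputable def toHirzebruch (v : Cone (zeroLocus F)) : Cone (hirzebruch (D.a - D.b)) :=
  Hirzebruch.conePoint _ v.1.z v.1.z_ne (D.coord v 0) (D.coord v 1) (D.coord_zero_or_one_ne_zero v)

/-- The inverse of `toHirzebruch`. -/
noncomputable def ofHirzebruch (v : Cone (hirzebruch (D.a - D.b))) : Cone (zeroLocus F) :=
  D.conePoint v.1.z v.1.z_ne ![Hirzebruch.coord v, v.1.x 2] fun h =>
    (coord_or_x_two_ne_zero v).elim (fun h0 => h0 (congrFun h 0)) (fun h1 => h1 (congrFun h 1))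

theorem ofHirzebruch_toHirzebruch (v : Cone (zeroLocus F)) :
    D.ofHirzebruch (D.toHirzebruch v) = v := by
  conv_rhs => rw [← D.conePoint_coord v]
  have h : ![Hirzebruch.coord (D.toHirzebruch v), (D.toHirzebruch v).1.x 2] = D.coord v := by
    ext i; fin_cases i
    · exact Hirzebruch.coord_conePoint _ _ _ _ _
    · rfl
  simp only [ofHirzebruch, h]
  rfl

theorem toHirzebruch_ofHirzebruch (v : Cone (hirzebruch (D.a - D.b))) :
    D.toHirzebruch (D.ofHirzebruch v) = v := by
  conv_rhs => rw [← Hirzebruch.conePoint_coord v]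
  have h0 : D.coord (D.ofHirzebruch v) 0 = Hirzebruch.coord v :=
    congrFun (D.coord_conePoint _ _) 0
  have h1 : D.coord (D.ofHirzebruch v) 1 = v.1.x 2 := congrFun (D.coord_conePoint _ _) 1
  simp only [toHirzebruch, h0, h1]
  rfl

/-- The three coordinates `z₀ⁿ S`, `z₁ⁿ S`, `T` have the same weight because `n - a = -b` for `n = a
- b`. -/
theorem isConeMap_toHirzebruch : IsConeMap (1, 0) (-(D.b : ℤ), 1) D.toHirzebruch where
  z x i := isSecAt_z i x
  x x j := by
    have hS : ∀ i : Fin 2, IsSecAt (-(D.b : ℤ), 1) x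
        (fun v => v.1.z i ^ (D.a - D.b) * D.coord v 0) := fun i => by
      have := ((isSecAt_z i x).pow (D.a - D.b)).mul (D.isSecAt_coord_zero x)
      have h := D.le
      convert this using 1
      ext <;> simp
      omega
    fin_cases j
    · exact hS 0
    · exact hS 1
    · exact D.isSecAt_coord_one x

theorem isConeMap_ofHirzebruch : IsConeMap (1, 0) ((D.b : ℤ), 1) D.ofHirzebruch where
  z x i := isSecAt_z i x
  x x j := by
    refine IsSecAt.add (f := fun v => Hirzebruch.coord v * binForm D.a v.1.z (D.σ j))
      (g := fun v => v.1.x 2 * binForm D.b v.1.z (D.τ j)) ?_ ?_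
    · have := (Hirzebruch.isSecAt_coord x).mul (isSecAt_binForm D.a (D.σ j) x)
      have h := D.le
      convert this using 1
      ext <;> simp
      omega
    · simpa using (isSecAt_x 2 x).mul (isSecAt_binForm D.b (D.τ j) x)

/-- The isomorphism of the divisor with a Hirzebruch surface. -/
noncomputable def hirzebruchIso : VarietyIso (zeroLocus F) (hirzebruch (D.a - D.b)) :=
  D.isConeMap_toHirzebruch.varietyIso D.isConeMap_ofHirzebruch D.ofHirzebruch_toHirzebruch
    D.toHirzebruch_ofHirzebruch

theorem nonempty_moduleIso_hirzebruch_fibre : Nonempty (ModuleIso D.hirzebruchIso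
    (twist (zeroLocus F) 1 0) (twist (hirzebruch (D.a - D.b)) 1 0)) :=
  ⟨D.isConeMap_toHirzebruch.moduleIso D.isConeMap_ofHirzebruch D.ofHirzebruch_toHirzebruch
    D.toHirzebruch_ofHirzebruch (by simp [wt]) (by simp [wt])⟩

theorem nonempty_moduleIso_hirzebruch_plane : Nonempty (ModuleIso D.hirzebruchIso
    (twist (zeroLocus F) 0 1) (twist (hirzebruch (D.a - D.b)) D.b 1)) :=
  ⟨D.isConeMap_toHirzebruch.moduleIso D.isConeMap_ofHirzebruch D.ofHirzebruch_toHirzebruch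
    D.toHirzebruch_ofHirzebruch (by simp [wt]) (by simp [wt])⟩

end ScrollData

/-! ### Line bundles of divisors -/

section divisors

variable {X : Set BiProj} {ι : Type} {D : ι → Set X}

/-- `t` is a generator of the ideal of `D` at the point `x`. -/
structure IsLocalEquation (D : Set X) (x : X) (t : Cone X → ℂ) : Prop where
  isSecAt : IsSecAt 0 x t
  mem_iff : ∃ V : Opens X, x ∈ V ∧ ∀ v : Cone X, v.base ∈ V → (v.base ∈ D ↔ t v = 0)
  exists_factor : ∀ f, IsSecAt 0 x f →
    (∃ V : Opens X, x ∈ V ∧ ∀ v : Cone X, v.base ∈ V → v.base ∈ D → f v = 0) →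
    ∃ g, IsSecAt 0 x g ∧ ∃ V : Opens X, x ∈ V ∧ ∀ v : Cone X, v.base ∈ V → f v = t v * g v

/-- The complement of the divisor is dense. -/
def DenseCompl (D : ι → Set X) : Prop :=
  ∀ (V : Opens X) (x : X), x ∈ V → ∃ y ∈ V, ∀ i, y ∉ D i

theorem DenseCompl.eq_zero (hD : DenseCompl D) {k : ℤ × ℤ} {f : Cone X → ℂ} {v : Cone X}
    (hf : IsSecAt k v.base f) (V : Opens X) (hvV : v.base ∈ V)
    (h : ∀ w : Cone X, w.base ∈ V → (∀ i, w.base ∉ D i) → f w = 0) : f v = 0 := by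
  by_contra h0
  obtain ⟨W, hvW, hW⟩ := hf.exists_ne_zero h0
  obtain ⟨y, hy, hyD⟩ := hD (W ⊓ V) _ ⟨hvW, hvV⟩
  obtain ⟨w, rfl⟩ := Cone.exists_base y
  exact hW w hy.1 (h w hy.2 hyD)

/-- Two local extensions agree off the divisor, hence everywhere on the overlap by density, so they
glue. -/
theorem DenseCompl.exists_extension (hD : DenseCompl D) {k : ℤ × ℤ} {f : Cone X → ℂ}
    (V : Opens X) (h : ∀ x ∈ V, ∃ g, IsSecAt k x g ∧ ∃ W : Opens X, x ∈ W ∧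
      ∀ v : Cone X, v.base ∈ W → (∀ i, v.base ∉ D i) → f v = g v) :
    ∃ h : Cone X → ℂ, (∀ x ∈ V, IsSecAt k x h) ∧
      ∀ v : Cone X, v.base ∈ V → (∀ i, v.base ∉ D i) → h v = f v := by
  classical
  choose! g hg W hxW hW using h
  refine ⟨fun v => g v.base v, fun x hx => ?_, fun v hv hvD => (hW _ hv v (hxW _ hv) hvD).symm⟩
  obtain ⟨U, hxU, hU⟩ := (hg x hx).eventually
  refine (hg x hx).congr (U ⊓ V ⊓ W x) ⟨⟨hxU, hx⟩, hxW x hx⟩ fun v hv => sub_eq_zero.1 ?_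
  refine hD.eq_zero ((hU _ hv.1.1).sub (hg _ hv.1.2)) (W x ⊓ W v.base)
    ⟨hv.2, hxW _ hv.1.2⟩ fun w hw hwD => ?_
  rw [← hW x hx w hw.1 hwD, ← hW _ hv.1.2 w hw.2 hwD, sub_self]

/-- A representative in the cone of a point. -/
noncomputable def liftCone (x : X) : Cone X := (Cone.exists_base x).choose

theorem liftCone_base (x : X) : (liftCone x).base = x := (Cone.exists_base x).choose_spec

variable [Fintype ι]

theorem mem_univ_inf {W : ι → Opens X} {x : X} : x ∈ Finset.univ.inf W ↔ ∀ i, x ∈ W i := by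
  rw [← SetLike.mem_coe, Opens.coe_finset_inf]
  simp

/-- The section `σ` of weight `k` is a local generator of `𝒪(D)`, up to a unit. -/
structure IsDivisorSection (D : ι → Set X) (k : ℤ × ℤ) (σ : Cone X → ℂ) : Prop where
  dense : DenseCompl D
  isSecAt : ∀ x, IsSecAt k x σ
  exists_local : ∀ x, ∃ (t : ι → Cone X → ℂ) (u : Cone X → ℂ),
    (∀ i, IsLocalEquation (D i) x (t i)) ∧ IsSecAt k x u ∧ ∃ V : Opens X, x ∈ V ∧
      ∀ v : Cone X, v.base ∈ V → u v ≠ 0 ∧ σ v = u v * ∏ i, t i v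

theorem lift_mem {X : Set BiProj} {ι : Type} {D : ι → Set X} {U : Opens X}
    (y : {y : {y : X // ∀ i, y ∉ D i} // y.1 ∈ U}) :
    (liftCone y.1.1).base ∈ U := by rw [liftCone_base]; exact y.2

namespace IsDivisorSection

variable {k : ℤ × ℤ} {σ : Cone X → ℂ}

theorem exists_nhds (hσ : IsDivisorSection D k σ) (x : X) :
    ∃ (t : ι → Cone X → ℂ) (u : Cone X → ℂ) (V : Opens X), x ∈ V ∧
      (∀ i, IsLocalEquation (D i) x (t i)) ∧
      ∀ v : Cone X, v.base ∈ V → (∀ i, IsSecAt 0 v.base (t i)) ∧ IsSecAt k v.base u ∧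
        u v ≠ 0 ∧ σ v = u v * ∏ i, t i v ∧ ∀ i, v.base ∈ D i ↔ t i v = 0 := by
  obtain ⟨t, u, ht, hu, V, hxV, hV⟩ := hσ.exists_local x
  choose W hxW hW using fun i => (ht i).mem_iff
  choose W' hxW' hW' using fun i => (ht i).isSecAt.eventually
  obtain ⟨U, hxU, hU⟩ := hu.eventually
  refine ⟨t, u, V ⊓ U ⊓ ((Finset.univ.inf W) ⊓ (Finset.univ.inf W')),
    ⟨⟨hxV, hxU⟩, mem_univ_inf.2 hxW, mem_univ_inf.2 hxW'⟩, ht, fun v hv => ?_⟩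
  exact ⟨fun i => hW' i _ (mem_univ_inf.1 hv.2.2 i), hU _ hv.1.2, (hV v hv.1.1).1,
    (hV v hv.1.1).2, fun i => hW i v (mem_univ_inf.1 hv.2.1 i)⟩

theorem ne_zero (hσ : IsDivisorSection D k σ) {v : Cone X} (hv : ∀ i, v.base ∉ D i) :
    σ v ≠ 0 := by
  obtain ⟨t, u, V, hxV, -, hV⟩ := hσ.exists_nhds v.base
  obtain ⟨-, -, h1, h2, h3⟩ := hV v hxV
  rw [h2]
  exact mul_ne_zero h1 (Finset.prod_ne_zero_iff.2 fun i _ h => hv i ((h3 i).2 h))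

variable {a b : ℕ}

theorem div_eq_of_base_eq (hσ : IsDivisorSection D (wt (a, b)) σ) {U : Opens X}
    {g : {v : Cone X // v.base ∈ U} → ℂ} (hg : IsTwistedSection (a, b) U g) {v w : Cone X}
    (hv : v.base ∈ U) (hw : w.base ∈ U) (hvw : v.base = w.base) (hD : ∀ i, v.base ∉ D i) :
    g ⟨v, hv⟩ / σ v = g ⟨w, hw⟩ / σ w := by
  have h := ((isTwistedSection_iff_extendCone.1 hg _ hw).div (hσ.isSecAt w.base)
    (hσ.ne_zero (by rwa [← hvw])))
  rw [sub_self] at h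
  have := h.eq_of_base_eq hvw
  simpa only [extendCone_of_mem g hv, extendCone_of_mem g hw] using this

/-- If `τᵢ` vanishes on `Dᵢ` then locally `τᵢ = tᵢ τᵢ'`. With `σ = u ∏ tᵢ` the product `(g / σ) ∏
τᵢ` becomes `(g / u) ∏ τᵢ'`, which has no pole. -/
theorem div_mem (hσ : IsDivisorSection D (wt (a, b)) σ) {U : Opens X}
    {g : {v : Cone X // v.base ∈ U} → ℂ} (hg : IsTwistedSection (a, b) U g) :
    (fun y : {y : {y : X // ∀ i, y ∉ D i} // y.1 ∈ U} =>
      g ⟨liftCone y.1.1, lift_mem y⟩ / σ (liftCone y.1.1)) ∈ (ofDivisor X D).sections U := by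
  intro V hV τ hτ hτD
  obtain ⟨h, h1, h2⟩ := hσ.dense.exists_extension (k := 0)
    (f := fun v => extendCone g v / σ v * ∏ i, extendBase (τ i) v) V fun x hx => by
      obtain ⟨t, u, W, hxW, ht, hW⟩ := hσ.exists_nhds x
      have hτ' : ∀ i, ∃ τ', IsSecAt 0 x τ' ∧ ∃ W : Opens X, x ∈ W ∧
          ∀ v : Cone X, v.base ∈ W → extendBase (τ i) v = t i v * τ' v := fun i =>
        (ht i).exists_factor _ (isRegular_iff_extendBase.1 (hτ i) x hx)
          ⟨V, hx, fun v hv hvD => by rw [extendBase_of_mem _ hv]; exact hτD i ⟨_, hv⟩ hvD⟩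
      choose τ' hτ'1 W' hxW' hW' using hτ'
      obtain ⟨v, rfl⟩ := Cone.exists_base x
      have hg' := isTwistedSection_iff_extendCone.1 hg v.base (hV hx)
      refine ⟨fun v => extendCone g v / u v * ∏ i, τ' i v, ?_, W ⊓ Finset.univ.inf W',
        ⟨hxW, mem_univ_inf.2 hxW'⟩, fun w hw hwD => ?_⟩
      · have := (hg'.div (hW v hxW).2.1 (hW v hxW).2.2.1).mul
          (IsSecAt.prod Finset.univ fun i _ => hτ'1 i)
        simpa using this
      · have h2 : ∀ i, w.base ∈ W' i := mem_univ_inf.1 hw.2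
        obtain ⟨-, -, hu0, hσu, htD⟩ := hW w hw.1
        have ht0 : ∏ i, t i w ≠ 0 :=
          Finset.prod_ne_zero_iff.2 fun i _ h => hwD i ((htD i).2 h)
        dsimp only
        rw [hσu, Finset.prod_congr rfl fun i _ => hW' i w (h2 i), Finset.prod_mul_distrib]
        field_simp
  refine ⟨fun y => h (liftCone y.1), (isRegular_iff (f := h) fun v hv =>
    (h1 _ (by rw [liftCone_base]; exact hv)).eq_of_base_eq (liftCone_base v.base).symm).2 h1,
    fun y hy => ?_⟩
  have hy' : (liftCone y.1).base ∈ V := by rw [liftCone_base]; exact y.2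
  change h (liftCone y.1) = g ⟨liftCone y.1, hV hy'⟩ / σ (liftCone y.1) * _
  rw [h2 _ hy' (by rwa [liftCone_base]), extendCone_of_mem g (hV hy')]
  congr 1
  refine Finset.prod_congr rfl fun i _ => ?_
  rw [extendBase_of_mem _ hy']
  congr 2
  exact liftCone_base y.1

/-- Testing `s` against the local equations themselves makes `s ∏ tᵢ` regular, and multiplying by
the unit `u` gives `s σ`. The local results glue by density. -/
theorem exists_of_mem (hσ : IsDivisorSection D (wt (a, b)) σ) {U : Opens X}
    {s : {y : {y : X // ∀ i, y ∉ D i} // y.1 ∈ U} → ℂ} (hs : s ∈ (ofDivisor X D).sections U) :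
    ∃ g : {v : Cone X // v.base ∈ U} → ℂ, IsTwistedSection (a, b) U g ∧
      ∀ (v : Cone X) (hv : v.base ∈ U) (hD : ∀ i, v.base ∉ D i),
        g ⟨v, hv⟩ = s ⟨⟨v.base, hD⟩, hv⟩ * σ v := by
  classical
  obtain ⟨g, h1, h2⟩ := hσ.dense.exists_extension (k := wt (a, b))
    (f := fun v => (if h : v.base ∈ U ∧ ∀ i, v.base ∉ D i then s ⟨⟨v.base, h.2⟩, h.1⟩ else 0) *
      σ v) U fun x hx => by
      obtain ⟨t, u, W, hxW, ht, hW⟩ := hσ.exists_nhds x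
      obtain ⟨h, hh, hs'⟩ := hs (W ⊓ U) inf_le_right (fun i y => t i (liftCone y.1))
        (fun i => (isRegular_iff (f := t i) fun v hv =>
            ((hW (liftCone v.base) (by rw [liftCone_base]; exact hv.1)).1 i).eq_of_base_eq
              (liftCone_base v.base).symm).2 fun x hx => by
          obtain ⟨v, rfl⟩ := Cone.exists_base x
          exact (hW v hx.1).1 i)
        (fun i y hy => ((hW (liftCone y.1) (by rw [liftCone_base]; exact y.2.1)).2.2.2.2 i).1
          (by rwa [liftCone_base]))
      refine ⟨fun v => u v * extendBase h v, ?_, W ⊓ U, ⟨hxW, hx⟩, fun v hv hvD => ?_⟩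
      · obtain ⟨v, rfl⟩ := Cone.exists_base x
        simpa using (hW v hxW).2.1.mul (isRegular_iff_extendBase.1 hh v.base ⟨hxW, hx⟩)
      · dsimp only
        rw [dif_pos ⟨hv.2, hvD⟩, extendBase_of_mem h hv, hs' ⟨v.base, hv⟩ hvD]
        have h3 : ∀ i, t i (liftCone v.base) = t i v := fun i =>
          ((hW v hv.1).1 i).eq_of_base_eq (liftCone_base v.base)
        simp only [h3]
        rw [(hW v hv.1).2.2.2.1]
        ring
  refine ⟨fun v => g v.1, (isTwistedSection_iff fun v hv => rfl).2 h1, fun v hv hD => ?_⟩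
  dsimp only
  rw [h2 v hv hD, dif_pos ⟨hv, hD⟩]

/-- Division by the section `σ` identifies `𝒪(a, b)` with `𝒪(D)`. -/
noncomputable def divMap (hσ : IsDivisorSection D (wt (a, b)) σ) (U : Opens X) :
    (twist X a b).sections U →ₗ[ℂ] (ofDivisor X D).sections U where
  toFun g := ⟨fun y => g.1 ⟨liftCone y.1.1, lift_mem y⟩ / σ (liftCone y.1.1), hσ.div_mem g.2⟩
  map_add' _ _ := Subtype.ext (funext fun _ => add_div _ _ _)
  map_smul' _ _ := Subtype.ext (funext fun _ => mul_div_assoc _ _ _)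

theorem divMap_apply (hσ : IsDivisorSection D (wt (a, b)) σ) {U : Opens X}
    (g : (twist X a b).sections U) (v : Cone X) (hv : v.base ∈ U) (hD : ∀ i, v.base ∉ D i) :
    (hσ.divMap U g).1 ⟨⟨v.base, hD⟩, hv⟩ = g.1 ⟨v, hv⟩ / σ v :=
  hσ.div_eq_of_base_eq g.2 _ hv (liftCone_base v.base) (by rwa [liftCone_base])

theorem eq_zero_of_eq_zero (hσ : IsDivisorSection D (wt (a, b)) σ) {U : Opens X}
    {g : {v : Cone X // v.base ∈ U} → ℂ} (hg : IsTwistedSection (a, b) U g)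
    (h : ∀ (v : Cone X) (hv : v.base ∈ U), (∀ i, v.base ∉ D i) → g ⟨v, hv⟩ = 0) : g = 0 := by
  funext ⟨v, hv⟩
  rw [← extendCone_of_mem g hv]
  refine hσ.dense.eq_zero (isTwistedSection_iff_extendCone.1 hg v.base hv) U hv
    fun w hw hwD => ?_
  rw [extendCone_of_mem g hw, h w hw hwD]

theorem bijective_divMap (hσ : IsDivisorSection D (wt (a, b)) σ) (U : Opens X) :
    Function.Bijective (hσ.divMap U) := by
  constructor
  · refine (injective_iff_map_eq_zero _).2 fun g hg => Subtype.ext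
      (hσ.eq_zero_of_eq_zero g.2 fun v hv hD => ?_)
    have h1 := hσ.divMap_apply g v hv hD
    rw [hg] at h1
    exact (div_eq_zero_iff.1 h1.symm).resolve_right (hσ.ne_zero hD)
  · intro s
    obtain ⟨g, hg, h⟩ := hσ.exists_of_mem s.2
    refine ⟨⟨g, hg⟩, Subtype.ext (funext fun y => ?_)⟩
    obtain ⟨⟨y, hyD⟩, hy⟩ := y
    obtain ⟨v, rfl⟩ := Cone.exists_base y
    rw [hσ.divMap_apply ⟨g, hg⟩ v hy hyD]
    exact (div_eq_iff (hσ.ne_zero hyD)).2 (h v hy hyD)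

/-- An isomorphism with `𝒪(a, b)` gives one with `𝒪(D)`. -/
theorem nonempty_moduleIso (hσ : IsDivisorSection D (wt (a, b)) σ) {Y : Set BiProj}
    {φ : VarietyIso Y X} {L : FunctionModule Y} (h : Nonempty (ModuleIso φ L (twist X a b))) :
    Nonempty (ModuleIso φ L (ofDivisor X D)) := by
  obtain ⟨θ⟩ := h
  let E := fun U : Opens X => LinearEquiv.ofBijective (hσ.divMap U) (hσ.bijective_divMap U)
  refine ⟨⟨fun V => (E V).symm.trans (θ.equiv V), fun V g hg s t => ?_, fun U V hVU s t => ?_⟩⟩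
  · rw [LinearEquiv.trans_apply, LinearEquiv.trans_apply, ← θ.map_smul V g hg]
    refine congrArg (fun r => (θ.equiv V r).1 t) ?_
    rw [LinearEquiv.symm_apply_eq]
    refine Subtype.ext (funext fun y => ?_)
    obtain ⟨s, rfl⟩ := (E V).surjective s
    rw [LinearEquiv.symm_apply_apply]
    obtain ⟨⟨y, hyD⟩, hy⟩ := y
    obtain ⟨v, rfl⟩ := Cone.exists_base y
    change _ * (hσ.divMap V s).1 ⟨⟨v.base, hyD⟩, hy⟩ =
      (hσ.divMap V ⟨_, (twist X a b).smul_mem V g hg s.1 s.2⟩).1 ⟨⟨v.base, hyD⟩, hy⟩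
    rw [hσ.divMap_apply _ v hy hyD, hσ.divMap_apply _ v hy hyD]
    exact (mul_div_assoc _ _ _).symm
  · rw [LinearEquiv.trans_apply, LinearEquiv.trans_apply, ← θ.map_res U V hVU]
    refine congrArg (fun r => (θ.equiv V r).1 t) ?_
    rw [LinearEquiv.symm_apply_eq]
    refine Subtype.ext (funext fun y => ?_)
    obtain ⟨s, rfl⟩ := (E U).surjective s
    rw [LinearEquiv.symm_apply_apply]
    obtain ⟨⟨y, hyD⟩, hy⟩ := y
    obtain ⟨v, rfl⟩ := Cone.exists_base y
    change (hσ.divMap U s).1 ⟨⟨v.base, hyD⟩, hVU hy⟩ =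
      (hσ.divMap V ⟨_, (twist X a b).res_mem U V hVU s.1 s.2⟩).1 ⟨⟨v.base, hyD⟩, hy⟩
    exact (hσ.divMap_apply s v (hVU hy) hyD).trans
      (hσ.divMap_apply ⟨_, (twist X a b).res_mem U V hVU s.1 s.2⟩ v hy hyD).symm

end IsDivisorSection

end divisors

/-! ### Divisibility of bihomogeneous polynomials -/

theorem eval_aeval_eq {σ τ : Type*} (u : σ → MvPolynomial τ ℂ) (P : MvPolynomial σ ℂ)
    (c : τ → ℂ) : MvPolynomial.eval c (MvPolynomial.aeval u P) =
      MvPolynomial.eval (fun k => MvPolynomial.eval c (u k)) P := by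
  have h : (MvPolynomial.eval c).comp (MvPolynomial.aeval (R := ℂ) u).toRingHom =
      MvPolynomial.eval (fun k => MvPolynomial.eval c (u k)) :=
    MvPolynomial.ringHom_ext (fun r => by simp) fun k => by simp
  exact congrArg (fun φ => φ P) h

/-- Modulo `ℓ` each variable equals its substitute `u k`, so `P` is congruent to its substitution,
which is zero. -/
theorem dvd_of_subst {σ : Type*} {ℓ P : MvPolynomial σ ℂ} (u : σ → MvPolynomial σ ℂ)
    (hu : ∀ k, ℓ ∣ MvPolynomial.X k - u k)
    (hP : ∀ c, MvPolynomial.eval (fun k => MvPolynomial.eval c (u k)) P = 0) : ℓ ∣ P := by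
  have h0 : MvPolynomial.aeval u P = 0 := MvPolynomial.funext fun c => by
    rw [eval_aeval_eq, hP, map_zero]
  have h : (Ideal.Quotient.mk (Ideal.span {ℓ})).comp (MvPolynomial.aeval (R := ℂ) u).toRingHom =
      Ideal.Quotient.mk (Ideal.span {ℓ}) := by
    refine MvPolynomial.ringHom_ext (fun r => by simp [MvPolynomial.algebraMap_eq]) fun k => ?_
    simp only [RingHom.comp_apply, AlgHom.toRingHom_eq_coe, RingHom.coe_coe,
      MvPolynomial.aeval_X]
    refine (Ideal.Quotient.eq.2 (Ideal.mem_span_singleton.2 ?_)).symm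
    exact hu k
  have h1 := congrArg (fun φ => φ P) h
  simp only [RingHom.comp_apply, AlgHom.toRingHom_eq_coe, RingHom.coe_coe, h0, map_zero] at h1
  exact Ideal.mem_span_singleton.1 (Ideal.Quotient.eq_zero_iff_mem.1 h1.symm)

theorem IsBihomogeneous.exists_eq_mul {ℓ P : BiPoly} {d e : ℕ × ℕ} (hℓ : IsBihomogeneous ℓ d)
    (hP : IsBihomogeneous P (d + e)) (h : ℓ ∣ P) :
    ∃ R, IsBihomogeneous R e ∧ P = ℓ * R := by
  obtain ⟨R, rfl⟩ := h
  let w : Fin 2 ⊕ Fin 3 → ℕ × ℕ := Sum.elim (fun _ => (1, 0)) (fun _ => (0, 1))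
  let _ := MvPolynomial.weightedGradedAlgebra ℂ w
  -- The cofactor `R` need not be given as homogeneous; its component of degree `e` does the job, by
  -- comparing components of degree `d + e`.
  refine ⟨DirectSum.decompose (MvPolynomial.weightedHomogeneousSubmodule ℂ w) R e,
    SetLike.coe_mem (DirectSum.decompose (MvPolynomial.weightedHomogeneousSubmodule ℂ w) R e), ?_⟩
  rw [← DirectSum.coe_decompose_mul_add_of_left_mem
    (MvPolynomial.weightedHomogeneousSubmodule ℂ w) (i := d) (j := e) (b := R) hℓ]
  exact (DirectSum.decompose_of_mem_same _ hP).symm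

theorem IsBihomogeneous.aeval {P : BiPoly} {d : ℕ × ℕ} (hP : IsBihomogeneous P d)
    {u : Fin 2 ⊕ Fin 3 → BiPoly} {α β : ℕ × ℕ} (hz : ∀ i, IsBihomogeneous (u (Sum.inl i)) α)
    (hx : ∀ j, IsBihomogeneous (u (Sum.inr j)) β) :
    IsBihomogeneous (MvPolynomial.aeval u P) (d.1 • α + d.2 • β) := by
  rw [MvPolynomial.aeval_def, MvPolynomial.eval₂_eq']
  refine IsBihomogeneous.sum fun m hm => IsBihomogeneous.C_mul ?_ _
  obtain ⟨h1, h2⟩ := hP.sum_inl_eq (MvPolynomial.mem_support_iff.1 hm)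
  rw [← h1, ← h2, Finset.sum_smul, Finset.sum_smul, Fintype.prod_sum_type]
  exact (MvPolynomial.IsWeightedHomogeneous.prod _ _ _ fun i _ => (hz i).pow _).mul
    (MvPolynomial.IsWeightedHomogeneous.prod _ _ _ fun i _ => (hx i).pow _)

/-- Reduces the generation of the ideal to polynomials: it suffices that every `P` vanishing on `D`
becomes, as a function on `X` and after multiplication by some `K` nonzero at `v₀`, the restriction
of a multiple of `ℓ`. -/
theorem isLocalEquation_of_dvd {X : Set BiProj} {D : Set X} {ℓ m : BiPoly} {δ : ℕ × ℕ}
    (hℓ : IsBihomogeneous ℓ δ) (hm : IsBihomogeneous m δ) (v₀ : Cone X) (hm0 : v₀.1.eval m ≠ 0)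
    (hD : ∃ V : Opens X, v₀.base ∈ V ∧
      ∀ v : Cone X, v.base ∈ V → (v.base ∈ D ↔ v.1.eval ℓ = 0))
    (h : ∀ P d, IsBihomogeneous P d → (∀ v : Cone X, v.base ∈ D → v.1.eval P = 0) →
      ∃ (P₁ K : BiPoly) (e : ℕ × ℕ), IsBihomogeneous P₁ (e + d) ∧ IsBihomogeneous K e ∧
        v₀.1.eval K ≠ 0 ∧ (∀ v : Cone X, v.1.eval P₁ = v.1.eval K * v.1.eval P) ∧ ℓ ∣ P₁) :
    IsLocalEquation D v₀.base (fun v => v.1.eval ℓ / v.1.eval m) where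
  isSecAt := by simpa using (isSecAt_eval hℓ v₀.base).div (isSecAt_eval hm v₀.base) hm0
  mem_iff := by
    obtain ⟨V, hV, H⟩ := hD
    refine ⟨V ⊓ nonvanishing X hm, ⟨hV, (base_mem_nonvanishing hm v₀).2 hm0⟩, fun v hv => ?_⟩
    rw [H v hv.1, div_eq_zero_iff, or_iff_left ((base_mem_nonvanishing hm v).1 hv.2)]
  exists_factor := by
    rintro f ⟨V, hxV, p, q, P, Q, hP, hQ, e, hf⟩ ⟨V', hxV', hf'⟩
    -- The numerator `P` of `f` vanishes on `D` only near `v₀`; the factor `N` is zero outside that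
    -- neighbourhood, so `P * N` vanishes on all of `D`.
    obtain ⟨N, ν, hN, hN0, hNV⟩ := exists_nonvanishing_le (V ⊓ V') v₀ ⟨hxV, hxV'⟩
    obtain ⟨P₁, K, κ, hP₁, hK, hK0, hP₁K, hdvd⟩ := h (P * N) (p + ν) (hP.mul hN) fun v hv => by
      by_cases h0 : v.1.eval N = 0
      · simp only [Vec.eval] at h0 ⊢
        rw [map_mul, h0, mul_zero]
      · have hvV := hNV v h0
        have h1 := (hf v hvV.1).2
        rw [hf' v hvV.2 hv, zero_mul] at h1
        simp only [Vec.eval] at h1 ⊢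
        rw [map_mul, ← h1, zero_mul]
    have hdeg : IsBihomogeneous (P₁ * m) (δ + (κ + (p + ν))) := by
      rw [add_comm δ]
      exact hP₁.mul hm
    obtain ⟨R, hR, hRe⟩ := hℓ.exists_eq_mul hdeg (hdvd.mul_right m)
    have hQ0 := (hf v₀ hxV).1
    have hden : IsBihomogeneous (K * N * Q) (κ + ν + q) := (hK.mul hN).mul hQ
    have hden0 : v₀.1.eval (K * N * Q) ≠ 0 := by
      simp only [Vec.eval, map_mul] at *
      exact mul_ne_zero (mul_ne_zero hK0 hN0) hQ0
    refine ⟨fun v => v.1.eval R / v.1.eval (K * N * Q), ?_, nonvanishing X hden ⊓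
      nonvanishing X hm ⊓ nonvanishing X hN, ⟨⟨(base_mem_nonvanishing hden v₀).2 hden0,
        (base_mem_nonvanishing hm v₀).2 hm0⟩, (base_mem_nonvanishing hN v₀).2 hN0⟩,
      fun v hv => ?_⟩
    · have := (isSecAt_eval hR v₀.base).div (isSecAt_eval hden v₀.base) hden0
      convert this using 1
      rw [wt_add, wt_add, wt_add, wt_add, e]
      abel
    · have h1 := (base_mem_nonvanishing hden v).1 hv.1.1
      have h2 := (base_mem_nonvanishing hm v).1 hv.1.2
      have h3 := (base_mem_nonvanishing hN v).1 hv.2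
      have h4 := (hf v (hNV v h3).1).2
      have h5 := hP₁K v
      have h6 := congrArg (MvPolynomial.eval (Sum.elim v.1.z v.1.x)) hRe
      simp only [Vec.eval, map_mul] at *
      rw [div_mul_div_comm, ← h6, h5, ← h4, eq_div_iff (mul_ne_zero h2 h1)]
      ring

/-! ### Divisors on Hirzebruch surfaces -/

namespace Hirzebruch

variable {n : ℕ}

/-- The polynomials `(Z₀ⁿ Xᵢ, Z₁ⁿ Xᵢ, Zᵢⁿ X₂)`, with values in the Hirzebruch surface. -/
noncomputable def subst (n : ℕ) (i : Fin 2) : Fin 2 ⊕ Fin 3 → BiPoly :=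
  Sum.elim (fun k => MvPolynomial.X (Sum.inl k))
    ![MvPolynomial.X (Sum.inl 0) ^ n * MvPolynomial.X (Sum.inr i.castSucc),
      MvPolynomial.X (Sum.inl 1) ^ n * MvPolynomial.X (Sum.inr i.castSucc),
      MvPolynomial.X (Sum.inl i) ^ n * MvPolynomial.X (Sum.inr 2)]

theorem isBihomogeneous_subst {P : BiPoly} {d : ℕ × ℕ} (hP : IsBihomogeneous P d) (i : Fin 2) :
    IsBihomogeneous (MvPolynomial.aeval (subst n i) P) (d + (n * d.2, 0)) := by
  have h : ∀ k j, IsBihomogeneous (MvPolynomial.X (Sum.inl k) ^ n *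
      MvPolynomial.X (Sum.inr j) : BiPoly) (n, 1) := fun k j => by
    simpa using ((isBihomogeneous_X_inl (τ := Fin 3) k).pow n).mul (isBihomogeneous_X_inr j)
  have := hP.aeval (u := subst n i) (α := (1, 0)) (β := (n, 1))
    (fun k => isBihomogeneous_X_inl k) (fun j => by fin_cases j <;> exact h _ _)
  convert this using 1
  ext <;> simp [mul_comm]

theorem eval_subst (P : BiPoly) (i : Fin 2) (z : Fin 2 → ℂ) (x : Fin 3 → ℂ) (hz : z ≠ 0)
    (hw : x i.castSucc ≠ 0 ∨ z i ^ n * x 2 ≠ 0) :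
    MvPolynomial.eval (Sum.elim z x) (MvPolynomial.aeval (subst n i) P) =
      (conePoint n z hz (x i.castSucc) (z i ^ n * x 2) hw).1.eval P := by
  rw [eval_aeval_eq, Vec.eval]
  congr 2
  ext k
  rcases k with k | k
  · simp [subst, conePoint]
  · fin_cases k <;> simp [subst, conePoint]

theorem eval_subst_cone {P : BiPoly} {d : ℕ × ℕ} (hP : IsBihomogeneous P d) (i : Fin 2)
    (v : Cone (hirzebruch n)) :
    v.1.eval (MvPolynomial.aeval (subst n i) P) = v.1.z i ^ (n * d.2) * v.1.eval P := by
  have h : (fun k => MvPolynomial.eval (Sum.elim v.1.z v.1.x) (subst n i k)) =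
      Sum.elim ((1 : ℂ) • v.1.z) (v.1.z i ^ n • v.1.x) := by
    ext k
    rcases k with k | k
    · simp [subst]
    · have h0 := x_castSucc v 0
      have h1 := x_castSucc v 1
      simp only [Fin.castSucc_zero, Fin.castSucc_one] at h0 h1
      fin_cases k
      · simp [subst, h0, x_castSucc v i]; ring
      · simp [subst, h1, x_castSucc v i]; ring
      · simp [subst]
  rw [Vec.eval, eval_aeval_eq, h, hP.eval_smul, one_pow, one_mul, ← pow_mul, Vec.eval]

/-- The substitution `subst` parametrizes `𝔽ₙ` by an affine space, so no relation between the
variables remains there. The pulled back `P` vanishes on `ℓ = 0` where `zᵢ xⱼ ≠ 0`; the extra factor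
`zᵢ xⱼ` makes it vanish on all of `ℓ = 0`, and `u`, which maps into `ℓ = 0`, then yields
divisibility. -/
theorem exists_multiple {P ℓ : BiPoly} {d : ℕ × ℕ} (hP : IsBihomogeneous P d)
    {D : Set (hirzebruch n)} (hPD : ∀ v : Cone (hirzebruch n), v.base ∈ D → v.1.eval P = 0)
    (v₀ : Cone (hirzebruch n)) {i : Fin 2} (hi : v₀.1.z i ≠ 0) {j : Fin 3}
    (hj : v₀.1.x j ≠ 0) (hij : j = i.castSucc ∨ j = 2)
    (u : Fin 2 ⊕ Fin 3 → BiPoly) (hu : ∀ k, ℓ ∣ MvPolynomial.X k - u k)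
    (hℓ : ∀ c, MvPolynomial.eval (fun k => MvPolynomial.eval c (u k)) ℓ = 0)
    (hD : ∀ (z : Fin 2 → ℂ) (x : Fin 3 → ℂ) (hz : z ≠ 0)
      (hw : x i.castSucc ≠ 0 ∨ z i ^ n * x 2 ≠ 0), z i ≠ 0 →
      MvPolynomial.eval (Sum.elim z x) ℓ = 0 →
      (conePoint n z hz (x i.castSucc) (z i ^ n * x 2) hw).base ∈ D) :
    ∃ (P₁ K : BiPoly) (e : ℕ × ℕ), IsBihomogeneous P₁ (e + d) ∧ IsBihomogeneous K e ∧
        v₀.1.eval K ≠ 0 ∧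
        (∀ v : Cone (hirzebruch n), v.1.eval P₁ = v.1.eval K * v.1.eval P) ∧ ℓ ∣ P₁ := by
  have hZ := isBihomogeneous_X_inl (τ := Fin 3) i
  have hX := isBihomogeneous_X_inr (σ := Fin 2) j
  refine ⟨MvPolynomial.aeval (subst n i) P * (MvPolynomial.X (Sum.inl i) *
    MvPolynomial.X (Sum.inr j)), MvPolynomial.X (Sum.inl i) ^ (n * d.2) *
    (MvPolynomial.X (Sum.inl i) * MvPolynomial.X (Sum.inr j)), (n * d.2, 0) + (1, 1), ?_, ?_,
    ?_, fun v => ?_, dvd_of_subst u hu fun c => ?_⟩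
  · have := (isBihomogeneous_subst (n := n) hP i).mul (hZ.mul hX)
    convert this using 1
    simp only [Prod.mk_add_mk, add_zero, zero_add]
    ext <;> simp <;> ring
  · simpa using (hZ.pow (n * d.2)).mul (hZ.mul hX)
  · simpa [Vec.eval] using ⟨fun h => absurd h hi, hi, hj⟩
  · have := eval_subst_cone hP i v
    simp only [Vec.eval, map_mul, map_pow, MvPolynomial.eval_X, Sum.elim_inl,
      Sum.elim_inr] at this ⊢
    rw [this]
    ring
  · set c' : Fin 2 ⊕ Fin 3 → ℂ := fun k => MvPolynomial.eval c (u k) with hc'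
    obtain ⟨z, x, hzx⟩ : ∃ z x, c' = Sum.elim z x := ⟨_, _, (Sum.elim_comp_inl_inr c').symm⟩
    have h0 : MvPolynomial.eval (Sum.elim z x) ℓ = 0 := by rw [← hzx]; exact hℓ c
    rw [hzx, map_mul, map_mul, MvPolynomial.eval_X, MvPolynomial.eval_X, Sum.elim_inl,
      Sum.elim_inr]
    by_cases hzi : z i = 0
    · simp [hzi]
    by_cases hxj : x j = 0
    · simp [hxj]
    have hz : z ≠ 0 := fun h => hzi (by simp [h])
    have hw : x i.castSucc ≠ 0 ∨ z i ^ n * x 2 ≠ 0 := by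
      rcases hij with rfl | rfl
      · exact Or.inl hxj
      · exact Or.inr (mul_ne_zero (pow_ne_zero _ hzi) hxj)
    rw [eval_subst P i z x hz hw, hPD _ (hD z x hz hw hzi h0), zero_mul]

/-- The linear form on `ℙ¹` which vanishes at `[p]`. -/
noncomputable def pointForm (p : Fin 2 → ℂ) : BiPoly :=
  MvPolynomial.C (p 1) * MvPolynomial.X (Sum.inl 0) -
    MvPolynomial.C (p 0) * MvPolynomial.X (Sum.inl 1)

theorem isBihomogeneous_pointForm (p : Fin 2 → ℂ) : IsBihomogeneous (pointForm p) (1, 0) :=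
  ((isBihomogeneous_X_inl 0).C_mul _).sub ((isBihomogeneous_X_inl 1).C_mul _)

theorem eval_pointForm (p z : Fin 2 → ℂ) (x : Fin 3 → ℂ) :
    MvPolynomial.eval (Sum.elim z x) (pointForm p) = p 1 * z 0 - p 0 * z 1 := by
  simp [pointForm]

theorem mk_eq_mk_iff_pointForm {p z : Fin 2 → ℂ} (hp : p ≠ 0) (hz : z ≠ 0) :
    Projectivization.mk ℂ z hz = Projectivization.mk ℂ p hp ↔ p 1 * z 0 - p 0 * z 1 = 0 := by
  rw [Projectivization.mk_eq_mk_iff']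
  constructor
  · rintro ⟨a, rfl⟩
    simp
    ring
  · intro h
    obtain ⟨i, hi⟩ := Function.ne_iff.1 hp
    refine ⟨z i / p i, funext fun j => ?_⟩
    rw [Pi.smul_apply, smul_eq_mul, div_mul_eq_mul_div, div_eq_iff hi]
    fin_cases i <;> fin_cases j <;> simp <;>
      first | ring1 | linear_combination h | linear_combination -h

theorem base_mem_fibre {p : Fin 2 → ℂ} (hp : p ≠ 0) (v : Cone (hirzebruch n)) :
    v.base ∈ hirzebruchFibre n (Projectivization.mk ℂ p hp) ↔ v.1.eval (pointForm p) = 0 := by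
  rw [Vec.eval, eval_pointForm, ← mk_eq_mk_iff_pointForm hp v.1.z_ne]
  rfl

theorem base_mem_section (v : Cone (hirzebruch n)) :
    v.base ∈ hirzebruchSection n ↔ coord v = 0 := by
  obtain ⟨i, hi⟩ := Function.ne_iff.1 v.1.z_ne
  constructor
  · rintro ⟨w, hw, h0, h1⟩
    obtain ⟨a, b, -, -, -, hx⟩ := Vec.point_eq_iff.1 hw.symm
    have : v.1.x i.castSucc = 0 := by
      rw [hx]
      fin_cases i
      · simp [h0]
      · simp [h1]
    rw [x_castSucc] at this
    exact (mul_eq_zero.1 this).resolve_left (pow_ne_zero _ hi)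
  · intro h
    refine ⟨v.1, rfl, ?_, ?_⟩
    · exact (x_castSucc v 0).trans (by rw [h, mul_zero])
    · exact (x_castSucc v 1).trans (by rw [h, mul_zero])

theorem exists_chart (v : Cone (hirzebruch n)) : ∃ (i : Fin 2) (j : Fin 3), v.1.z i ≠ 0 ∧
    v.1.x j ≠ 0 ∧ (j = i.castSucc ∨ j = 2) := by
  obtain ⟨i, hi⟩ := Function.ne_iff.1 v.1.z_ne
  rcases coord_or_x_two_ne_zero v with h | h
  · exact ⟨i, _, hi, by rw [x_castSucc]; exact mul_ne_zero (pow_ne_zero _ hi) h, Or.inl rfl⟩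
  · exact ⟨i, 2, hi, h, Or.inr rfl⟩

theorem isLocalEquation_fibre {p : Fin 2 → ℂ} (hp : p ≠ 0) (v₀ : Cone (hirzebruch n))
    {i : Fin 2} (hi : v₀.1.z i ≠ 0) : IsLocalEquation
      (hirzebruchFibre n (Projectivization.mk ℂ p hp)) v₀.base
      (fun v => v.1.eval (pointForm p) / v.1.z i) := by
  have key : IsLocalEquation (hirzebruchFibre n (Projectivization.mk ℂ p hp)) v₀.base
      (fun v => v.1.eval (pointForm p) / v.1.eval (MvPolynomial.X (Sum.inl i))) := by
    refine isLocalEquation_of_dvd (isBihomogeneous_pointForm p) (isBihomogeneous_X_inl i) v₀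
      (by simpa [Vec.eval] using hi) ⟨⊤, trivial, fun v _ => base_mem_fibre hp v⟩
      fun P d hP hPD => ?_
    obtain ⟨i, j, hi, hj, hij⟩ := exists_chart v₀
    obtain ⟨k, hk⟩ := Function.ne_iff.1 hp
    have hk' : p k ≠ 0 := hk
    -- On `pointForm p = 0` the vector `z` is proportional to `p`, so `z_l = (p_l / p_k) z_k`.
    refine exists_multiple hP hPD v₀ hi hj hij (Sum.elim
      (fun l => MvPolynomial.C (p l / p k) * MvPolynomial.X (Sum.inl k))
      (fun l => MvPolynomial.X (Sum.inr l))) (fun l => ?_) (fun c => ?_)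
      fun z x hz hw _ h0 => (base_mem_fibre hp _).2 ?_
    · rcases l with l | l
      · have e : (MvPolynomial.X (Sum.inl l) - MvPolynomial.C (p l / p k) *
            MvPolynomial.X (Sum.inl k) : BiPoly) = MvPolynomial.C (p k)⁻¹ *
            (MvPolynomial.C (p k) * MvPolynomial.X (Sum.inl l) -
              MvPolynomial.C (p l) * MvPolynomial.X (Sum.inl k)) := by
          rw [mul_sub, ← mul_assoc, ← mul_assoc, ← map_mul, ← map_mul, inv_mul_cancel₀ hk',
            map_one, one_mul, mul_comm (p k)⁻¹, div_eq_mul_inv]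
        change pointForm p ∣ (MvPolynomial.X (Sum.inl l) - MvPolynomial.C (p l / p k) *
            MvPolynomial.X (Sum.inl k) : BiPoly)
        rw [e]
        refine Dvd.dvd.mul_left ?_ _
        fin_cases k <;> fin_cases l
        · simp
        · exact ⟨-1, by simp [pointForm]⟩
        · exact ⟨1, by simp [pointForm]⟩
        · simp
      · simp
    · have e : (fun l => MvPolynomial.eval c ((Sum.elim
          (fun l => MvPolynomial.C (p l / p k) * MvPolynomial.X (Sum.inl k))
          (fun l => MvPolynomial.X (Sum.inr l)) : Fin 2 ⊕ Fin 3 → BiPoly) l)) =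
          Sum.elim (fun l => p l / p k * c (Sum.inl k)) (fun l => c (Sum.inr l)) := by
        ext l; rcases l with l | l <;> simp
      rw [e, eval_pointForm]
      ring
    · rw [Vec.eval, eval_pointForm]
      rw [eval_pointForm] at h0
      exact h0
  simpa [Vec.eval] using key

theorem isLocalEquation_section (v₀ : Cone (hirzebruch n)) {i : Fin 2} (hi : v₀.1.z i ≠ 0)
    {j : Fin 3} (hj : v₀.1.x j ≠ 0) (hij : j = i.castSucc ∨ j = 2) :
    IsLocalEquation (hirzebruchSection n) v₀.base (fun v => v.1.x i.castSucc / v.1.x j) := by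
  have key : IsLocalEquation (hirzebruchSection n) v₀.base
      (fun v => v.1.eval (MvPolynomial.X (Sum.inr i.castSucc)) /
        v.1.eval (MvPolynomial.X (Sum.inr j))) := by
    refine isLocalEquation_of_dvd (isBihomogeneous_X_inr _) (isBihomogeneous_X_inr j) v₀
      (by simpa [Vec.eval] using hj) ⟨nonvanishing _ (isBihomogeneous_X_inl i),
        (base_mem_nonvanishing _ _).2 (by simpa [Vec.eval] using hi), fun v hv => ?_⟩
      fun P d hP hPD => ?_
    · have hvi := (base_mem_nonvanishing _ _).1 hv
      simp only [Vec.eval, MvPolynomial.eval_X, Sum.elim_inl, Sum.elim_inr] at hvi ⊢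
      rw [base_mem_section, x_castSucc, mul_eq_zero, or_iff_right (pow_ne_zero _ hvi)]
    refine exists_multiple hP hPD v₀ hi hj hij
      (Function.update (fun l => MvPolynomial.X l) (Sum.inr i.castSucc) 0) (fun l => ?_)
      (fun c => ?_) fun z x hz hw _ h0 => (base_mem_section _).2 ?_
    · by_cases h : l = Sum.inr i.castSucc
      · subst h; simp
      · simp [Function.update_of_ne h]
    · simp
    · simpa [coord_conePoint] using h0
  simpa [Vec.eval] using key

/-- Pulled back by `subst`, the conditions of lying in a given neighbourhood and off the fibre and
the section are the nonvanishing of nonzero polynomials. Their product is nonzero, hence nonzero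
somewhere. -/
theorem denseCompl {ι : Type} {p : Fin 2 → ℂ} (hp : p ≠ 0) (D : ι → Set (hirzebruch n))
    (hD : ∀ i, D i ⊆ hirzebruchFibre n (Projectivization.mk ℂ p hp) ∪ hirzebruchSection n) :
    DenseCompl D := by
  intro V x hx
  obtain ⟨v₀, rfl⟩ := Cone.exists_base x
  obtain ⟨N, d, hN, hN0, hNV⟩ := exists_nonvanishing_le V v₀ hx
  obtain ⟨i, hi⟩ := Function.ne_iff.1 v₀.1.z_ne
  have h1 : MvPolynomial.aeval (subst n i) N ≠ 0 := fun h => by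
    have := eval_subst_cone hN i v₀
    rw [h, Vec.eval, map_zero] at this
    exact mul_ne_zero (pow_ne_zero _ hi) hN0 this.symm
  have h2 : pointForm p ≠ 0 := by
    intro h
    obtain ⟨k, hk⟩ := Function.ne_iff.1 hp
    have e := fun z => eval_pointForm p z 0
    simp only [h, map_zero] at e
    fin_cases k
    · exact hk (by simpa using e ![0, 1])
    · exact hk (by simpa using (e ![1, 0]).symm)
  obtain ⟨c, hc⟩ : ∃ c, MvPolynomial.eval c (MvPolynomial.aeval (subst n i) N * pointForm p *
      MvPolynomial.X (Sum.inr i.castSucc)) ≠ 0 := by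
    by_contra! h
    exact mul_ne_zero (mul_ne_zero h1 h2) (MvPolynomial.X_ne_zero _)
      (MvPolynomial.funext fun c => by rw [h c, map_zero])
  obtain ⟨z, x, rfl⟩ : ∃ z x, c = Sum.elim z x := ⟨_, _, (Sum.elim_comp_inl_inr c).symm⟩
  rw [map_mul, map_mul, MvPolynomial.eval_X, Sum.elim_inr, eval_pointForm] at hc
  have hx0 := right_ne_zero_of_mul hc
  have hp0 := right_ne_zero_of_mul (left_ne_zero_of_mul hc)
  have hN1 := left_ne_zero_of_mul (left_ne_zero_of_mul hc)
  have hz : z ≠ 0 := fun h => hp0 (by simp [h])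
  rw [eval_subst N i z x hz (Or.inl hx0)] at hN1
  refine ⟨_, hNV _ hN1, fun k hk => ?_⟩
  rcases hD k hk with h | h
  · rw [base_mem_fibre, Vec.eval, eval_pointForm] at h
    exact hp0 h
  · rw [base_mem_section, coord_conePoint] at h
    exact hx0 h

theorem isDivisorSection_fibre {p : Fin 2 → ℂ} (hp : p ≠ 0) : IsDivisorSection
    (fun _ : Unit => hirzebruchFibre n (Projectivization.mk ℂ p hp)) (wt (1, 0))
    (fun v => v.1.eval (pointForm p)) where
  dense := denseCompl hp _ fun _ => Set.subset_union_left
  isSecAt x := isSecAt_eval (isBihomogeneous_pointForm p) x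
  exists_local x := by
    obtain ⟨v₀, rfl⟩ := Cone.exists_base x
    obtain ⟨i, hi⟩ := Function.ne_iff.1 v₀.1.z_ne
    obtain ⟨V, hV, h⟩ := (isSecAt_z i v₀.base).exists_ne_zero hi
    refine ⟨fun _ v => v.1.eval (pointForm p) / v.1.z i, fun v => v.1.z i,
      fun _ => isLocalEquation_fibre hp v₀ hi, isSecAt_z i _, V, hV, fun v hv => ⟨h v hv, ?_⟩⟩
    have := h v hv
    simp
    field_simp

theorem isDivisorSection_plane {p : Fin 2 → ℂ} (hp : p ≠ 0) {b N : ℕ} (hN : n + b = N) :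
    IsDivisorSection
    (fun i : Fin N ⊕ Unit => Sum.elim
      (fun _ => hirzebruchFibre n (Projectivization.mk ℂ p hp))
      (fun _ => hirzebruchSection n) i) (wt (b, 1))
    (fun v => coord v * v.1.eval (pointForm p) ^ N) where
  dense := denseCompl hp _ fun i => by
    rcases i with i | i
    · exact Set.subset_union_left
    · exact Set.subset_union_right
  isSecAt x := by
    have := (isSecAt_coord x).mul ((isSecAt_eval (isBihomogeneous_pointForm p) x).pow N)
    convert this using 1
    ext <;> simp [wt]
    omega
  exists_local x := by
    obtain ⟨v₀, rfl⟩ := Cone.exists_base x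
    obtain ⟨i, j, hi, hj, hij⟩ := exists_chart v₀
    obtain ⟨V, hV, h⟩ := (isSecAt_z i v₀.base).exists_ne_zero hi
    obtain ⟨W, hW, h'⟩ := (isSecAt_x j v₀.base).exists_ne_zero hj
    -- From `coord = xᵢ / zᵢⁿ` and `N = n + b`, the section equals `zᵢᵇ xⱼ · (ℓ / zᵢ)ᴺ · (xᵢ / xⱼ)`,
    -- which displays the unit and the local equations.
    refine ⟨Sum.elim (fun _ v => v.1.eval (pointForm p) / v.1.z i)
      (fun _ v => v.1.x i.castSucc / v.1.x j), fun v => v.1.z i ^ b * v.1.x j, ?_, ?_,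
      V ⊓ W, ⟨hV, hW⟩, fun v hv => ⟨mul_ne_zero (pow_ne_zero _ (h v hv.1)) (h' v hv.2), ?_⟩⟩
    · rintro (k | k)
      · exact isLocalEquation_fibre hp v₀ hi
      · exact isLocalEquation_section v₀ hi hj hij
    · have := ((isSecAt_z i v₀.base).pow b).mul (isSecAt_x j v₀.base)
      convert this using 1
      ext <;> simp [wt]
    · have h1 := h v hv.1
      have h2 := h' v hv.2
      simp only [Fintype.prod_sum_type, Sum.elim_inl, Sum.elim_inr, Finset.prod_const,
        Finset.card_univ, Fintype.card_fin, Finset.univ_unique, Finset.card_singleton, pow_one,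
        x_castSucc v i]
      rw [← hN, div_pow, pow_add _ n b, pow_add (v.1.z i)]
      field_simp

end Hirzebruch

theorem exists_hirzebruchIso {F : BiPoly} (D : ScrollData F) :
    ∃ n ∈ ({0, 2} : Set ℕ), ∃ φ : VarietyIso (zeroLocus F) (hirzebruch n),
      ∀ z : Projectivization ℂ (Fin 2 → ℂ),
        Nonempty (ModuleIso φ (twist (zeroLocus F) 1 0)
          (ofDivisor (hirzebruch n) (fun _ : Unit => hirzebruchFibre n z))) ∧
        Nonempty (ModuleIso φ (twist (zeroLocus F) 0 1)
          (ofDivisor (hirzebruch n)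
            (fun i : Fin ((n + 2) / 2) ⊕ Unit =>
              Sum.elim (fun _ => hirzebruchFibre n z) (fun _ => hirzebruchSection n) i))) := by
  have h1 := D.add_eq
  have h2 := D.le
  refine ⟨D.a - D.b, ?_, D.hirzebruchIso, fun z => ?_⟩
  · simp only [Set.mem_insert_iff, Set.mem_singleton_iff]
    omega
  · induction z using Projectivization.ind with
    | h p hp =>
      exact ⟨(Hirzebruch.isDivisorSection_fibre hp).nonempty_moduleIso
        D.nonempty_moduleIso_hirzebruch_fibre,
        -- The number of fibres is `(n + 2) / 2 = n + b`, since `n = a - b` and `a + b = 2`.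
        (Hirzebruch.isDivisorSection_plane hp (by omega)).nonempty_moduleIso
        D.nonempty_moduleIso_hirzebruch_plane⟩

/-! ### The global sections of `𝒪(0, 1)` and `𝒪(1, 1)` -/

/-- The values of a global section on the cone. -/
def evalH0 (X : Set BiProj) : H0 X →ₗ[ℂ] (Cone X → ℂ) where
  toFun s v := s.1 ⟨v, trivial⟩
  map_add' _ _ := rfl
  map_smul' _ _ := rfl

theorem evalH0_injective (X : Set BiProj) : Function.Injective (evalH0 X) := fun _ _ h =>
  Subtype.ext (funext fun v => congrFun h v.1)

theorem isSecAt_evalH0 {X : Set BiProj} (s : H0 X) (x : X) : IsSecAt (0, 1) x (evalH0 X s) :=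
  (isTwistedSection_iff (k := (0, 1)) (f := evalH0 X s) fun _ _ => rfl).1 s.2 x trivial

theorem exists_evalH0_eq {X : Set BiProj} {f : Cone X → ℂ} (hf : ∀ x, IsSecAt (0, 1) x f) :
    ∃ s : H0 X, evalH0 X s = f := by
  have h : IsTwistedSection (0, 1) ⊤ (fun v : {v : Cone X // v.base ∈ (⊤ : Opens X)} => f v.1) :=
    (isTwistedSection_iff (k := (0, 1)) (f := f) fun _ _ => rfl).2 fun x _ => hf x
  exact ⟨(⟨fun v => f v.1, h⟩ : (twist X 0 1).sections ⊤), funext fun _ => rfl⟩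

theorem isRestriction_iff {X : Set BiProj} {U : Opens X} {s : (twist X 0 1).sections U}
    {f : Cone X → ℂ} (hU : ∀ v : Cone X, v.base ∈ U)
    (hf : ∀ v : Cone X, s.1 ⟨v, hU v⟩ = f v) :
    IsRestriction s ↔ ∃ c : Fin 3 → ℂ, ∀ v, f v = ∑ j, c j * v.1.x j := by
  constructor
  · rintro ⟨P, hP, h⟩
    obtain ⟨q, -, hq⟩ := hP.exists_binForm
    refine ⟨fun j => (q j).coeff 0, fun v => (hf v).symm.trans ((h ⟨v, hU v⟩).trans ?_)⟩
    rw [Vec.eval, hq]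
    simp [binForm_apply]
  · rintro ⟨c, hc⟩
    refine ⟨∑ j, MvPolynomial.C (c j) * MvPolynomial.X (Sum.inr j),
      IsBihomogeneous.sum fun j _ => (isBihomogeneous_X_inr j).C_mul _, fun v => ?_⟩
    refine (hf v.1).trans ((hc v.1).trans ?_)
    simp [Vec.eval]

namespace ScrollData

variable {F : BiPoly} (D : ScrollData F)

/-- The pairs of binary forms of degrees `m`, `l`, as functions on the cone. -/
noncomputable def formMap (m l : ℕ) :
    (Polynomial.degreeLT ℂ (m + 1) × Polynomial.degreeLT ℂ (l + 1)) →ₗ[ℂ]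
      (Cone (zeroLocus F) → ℂ) :=
  (D.form m l).comp ((Polynomial.degreeLT ℂ (m + 1)).subtype.prodMap
    (Polynomial.degreeLT ℂ (l + 1)).subtype)

theorem mem_degreeLT_succ {m : ℕ} {p : Polynomial ℂ} :
    p ∈ Polynomial.degreeLT ℂ (m + 1) ↔ p.natDegree ≤ m := by
  rw [Polynomial.degreeLT_succ_eq_degreeLE, Polynomial.mem_degreeLE,
    Polynomial.natDegree_le_iff_degree_le]

theorem formMap_injective (m l : ℕ) : Function.Injective (D.formMap m l) := by
  refine (injective_iff_map_eq_zero _).2 fun p hp => ?_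
  have := D.form_eq_zero (mem_degreeLT_succ.1 p.1.2) (mem_degreeLT_succ.1 p.2.2) hp
  exact Prod.ext (Subtype.ext (congrArg Prod.fst this)) (Subtype.ext (congrArg Prod.snd this))

theorem finrank_degreeLT (m : ℕ) : Module.finrank ℂ (Polynomial.degreeLT ℂ m) = m := by
  rw [(Polynomial.degreeLTEquiv ℂ m).finrank_eq, Module.finrank_fin_fun]

instance (m : ℕ) : FiniteDimensional ℂ (Polynomial.degreeLT ℂ m) :=
  (Polynomial.degreeLTEquiv ℂ m).symm.finiteDimensional

theorem finrank_range_formMap (m l : ℕ) :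
    Module.finrank ℂ (LinearMap.range (D.formMap m l)) = m + 1 + (l + 1) := by
  rw [LinearMap.finrank_range_of_inj (D.formMap_injective m l), Module.finrank_prod,
    finrank_degreeLT, finrank_degreeLT]

theorem mem_range_formMap {m l : ℕ} {f : Cone (zeroLocus F) → ℂ} :
    f ∈ LinearMap.range (D.formMap m l) ↔ ∃ p : Polynomial ℂ × Polynomial ℂ,
      p.1.natDegree ≤ m ∧ p.2.natDegree ≤ l ∧ f = D.form m l p := by
  constructor
  · rintro ⟨p, rfl⟩
    exact ⟨(p.1, p.2), mem_degreeLT_succ.1 p.1.2, mem_degreeLT_succ.1 p.2.2, rfl⟩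
  · rintro ⟨p, h1, h2, rfl⟩
    exact ⟨(⟨p.1, mem_degreeLT_succ.2 h1⟩, ⟨p.2, mem_degreeLT_succ.2 h2⟩), rfl⟩

theorem range_evalH0 : LinearMap.range (evalH0 (zeroLocus F)) =
    LinearMap.range (D.formMap D.a D.b) := by
  ext f
  rw [D.mem_range_formMap]
  constructor
  · rintro ⟨s, rfl⟩
    exact D.exists_form_eq (isSecAt_evalH0 s)
  · rintro ⟨p, -, -, rfl⟩
    exact exists_evalH0_eq (D.isSecAt_form p)

/-- The global sections of `𝒪(0, 1)` as pairs of binary forms. -/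
noncomputable def h0Equiv : H0 (zeroLocus F) ≃ₗ[ℂ] LinearMap.range (D.formMap D.a D.b) :=
  (LinearEquiv.ofInjective _ (evalH0_injective _)).trans (LinearEquiv.ofEq _ _ D.range_evalH0)

theorem finiteDimensional_H0 {F : BiPoly} (D : ScrollData F) :
    FiniteDimensional ℂ (H0 (zeroLocus F)) :=
  D.h0Equiv.symm.finiteDimensional

theorem finrank_H0 {F : BiPoly} (D : ScrollData F) :
    Module.finrank ℂ (H0 (zeroLocus F)) = 4 := by
  have := D.add_eq
  rw [D.h0Equiv.finrank_eq, finrank_range_formMap]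
  omega

/-- The bilinear forms on `ℂ² × ℂ³` as functions on the cone. -/
def bilinMap (X : Set BiProj) : Module.Dual ℂ (Fin 2 × Fin 3 → ℂ) →ₗ[ℂ] (Cone X → ℂ) where
  toFun β v := β (tensor v.1.z v.1.x)
  map_add' _ _ := rfl
  map_smul' _ _ := rfl

theorem bilinMap_injective {F : BiPoly} (D : ScrollData F) :
    Function.Injective (bilinMap (zeroLocus F)) :=
  (injective_iff_map_eq_zero _).2 fun β h => D.eq_zero_of_tensor_eq_zero β (congrFun h)

theorem z_mul_form {m l : ℕ} {p : Polynomial ℂ × Polynomial ℂ} (h1 : p.1.natDegree ≤ m)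
    (h2 : p.2.natDegree ≤ l) (i : Fin 2) : ∃ p' : Polynomial ℂ × Polynomial ℂ,
      p'.1.natDegree ≤ m + 1 ∧ p'.2.natDegree ≤ l + 1 ∧
      ∀ v, v.1.z i * D.form m l p v = D.form (m + 1) (l + 1) p' v := by
  fin_cases i
  · refine ⟨p, h1.trans (Nat.le_succ _), h2.trans (Nat.le_succ _), fun v => ?_⟩
    rw [form_apply, form_apply, ← z_zero_mul_binForm h1, ← z_zero_mul_binForm h2]
    simp only [Fin.zero_eta]
    ring
  · refine ⟨(Polynomial.X * p.1, Polynomial.X * p.2), ?_, ?_, fun v => ?_⟩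
    · exact Polynomial.natDegree_mul_le.trans (by rw [Polynomial.natDegree_X]; omega)
    · exact Polynomial.natDegree_mul_le.trans (by rw [Polynomial.natDegree_X]; omega)
    · rw [form_apply, form_apply, ← z_one_mul_binForm, ← z_one_mul_binForm]
      simp only [Fin.mk_one]
      ring

theorem x_eq_form (v : Cone (zeroLocus F)) (j : Fin 3) :
    v.1.x j = D.form D.a D.b (D.σ j, D.τ j) v := by
  conv_lhs => rw [D.x_eq v]
  rfl

/-- Multiplying `xⱼ = S σⱼ + T τⱼ` by `zᵢ` gives one inclusion. Both spaces have dimension 6, the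
left one because bilinear forms inject and the right one because `(a + 2) + (b + 2) = 6`. -/
theorem range_bilinMap : LinearMap.range (bilinMap (zeroLocus F)) =
    LinearMap.range (D.formMap (D.a + 1) (D.b + 1)) := by
  have := D.add_eq
  have hfin : FiniteDimensional ℂ (LinearMap.range (D.formMap (D.a + 1) (D.b + 1))) :=
    inferInstance
  refine Submodule.eq_of_le_of_finrank_le ?_ ?_
  · rintro _ ⟨β, rfl⟩
    have e : bilinMap (zeroLocus F) β = ∑ p : Fin 2 × Fin 3, β (Pi.single p 1) •
        (fun v : Cone (zeroLocus F) => v.1.z p.1 * v.1.x p.2) := by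
      ext v
      rw [Finset.sum_apply]
      change β (tensor v.1.z v.1.x) = _
      rw [β.pi_apply_eq_sum_univ]
      refine Finset.sum_congr rfl fun p _ => ?_
      have : (fun k => if p = k then (1 : ℂ) else 0) = Pi.single p 1 := by
        ext k; simp [Pi.single_apply, eq_comm]
      rw [this]
      simp [tensor, mul_comm]
    rw [e]
    refine Submodule.sum_mem _ fun p _ => Submodule.smul_mem _ _ ?_
    obtain ⟨p', h1, h2, h3⟩ := D.z_mul_form (p := (D.σ p.2, D.τ p.2)) (D.natDegree_σ p.2)
      (D.natDegree_τ p.2) p.1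
    exact D.mem_range_formMap.2 ⟨p', h1, h2, funext fun v => by rw [← h3, D.x_eq_form]⟩
  · rw [finrank_range_formMap, LinearMap.finrank_range_of_inj D.bilinMap_injective,
      Subspace.dual_finrank_eq]
    simp
    omega

theorem exists_bilin {F : BiPoly} (D : ScrollData F) (i : Fin 2) (s : H0 (zeroLocus F)) :
    (fun v => v.1.z i * evalH0 _ s v) ∈ LinearMap.range (bilinMap (zeroLocus F)) := by
  obtain ⟨p, h1, h2, h3⟩ := D.exists_form_eq (isSecAt_evalH0 s)
  obtain ⟨p', h1', h2', h3'⟩ := D.z_mul_form h1 h2 i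
  rw [D.range_bilinMap]
  exact D.mem_range_formMap.2 ⟨p', h1', h2', funext fun v => by rw [← h3', h3]⟩

/-- Multiplication of sections of `𝒪(0, 1)` by the coordinate `zᵢ`. -/
noncomputable def zMul (i : Fin 2) : H0 (zeroLocus F) →ₗ[ℂ] (Cone (zeroLocus F) → ℂ) where
  toFun s v := v.1.z i * evalH0 _ s v
  map_add' s t := by ext v; rw [map_add]; exact mul_add _ _ _
  map_smul' c s := by
    ext v; rw [map_smul]; exact mul_left_comm (v.1.z i) c (evalH0 _ s v)

/-- Multiplication of sections of `𝒪(0, 1)` by the coordinate `zᵢ`, with values in bilinear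
forms. -/
noncomputable def mulZ (i : Fin 2) :
    H0 (zeroLocus F) →ₗ[ℂ] Module.Dual ℂ (Fin 2 × Fin 3 → ℂ) :=
  (LinearEquiv.ofInjective _ D.bilinMap_injective).symm.toLinearMap.comp
    (LinearMap.codRestrict (LinearMap.range (bilinMap (zeroLocus F))) (zMul i)
      (D.exists_bilin i))

theorem mulZ_tensor (i : Fin 2) (s : H0 (zeroLocus F)) (v : Cone (zeroLocus F)) :
    D.mulZ i s (tensor v.1.z v.1.x) = v.1.z i * evalH0 _ s v := by
  have := congrArg Subtype.val ((LinearEquiv.ofInjective _ D.bilinMap_injective).apply_symm_apply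
    ⟨_, D.exists_bilin i s⟩)
  exact congrFun this v

theorem mulZ_eq_of_tensor {i : Fin 2} {s : H0 (zeroLocus F)}
    {β : Module.Dual ℂ (Fin 2 × Fin 3 → ℂ)}
    (h : ∀ v : Cone (zeroLocus F), β (tensor v.1.z v.1.x) = v.1.z i * evalH0 _ s v) :
    D.mulZ i s = β :=
  D.bilinMap_injective (funext fun v => (D.mulZ_tensor i s v).trans (h v).symm)

/-- On the cone the form is `(z₁ z₀' - z₀ z₁') s`, where `z'` is the variable; if it is zero, `s`
vanishes off one fibre, so its coefficients have infinitely many zeros. -/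
theorem mulZ_wedge_injective {z : Fin 2 → ℂ} (hz : z ≠ 0) :
    Function.Injective (z 1 • D.mulZ 0 - z 0 • D.mulZ 1) := by
  refine (injective_iff_map_eq_zero _).2 fun s hs => ?_
  obtain ⟨p, h1, h2, h3⟩ := D.exists_form_eq (isSecAt_evalH0 s)
  have hv : ∀ v : Cone (zeroLocus F), z 1 * v.1.z 0 - z 0 * v.1.z 1 ≠ 0 →
      D.form D.a D.b p v = 0 := by
    intro v hv
    have := congrArg (fun β => β (tensor v.1.z v.1.x)) hs
    simp only [LinearMap.sub_apply, LinearMap.smul_apply, D.mulZ_tensor, smul_eq_mul,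
      LinearMap.zero_apply, h3] at this
    refine (mul_eq_zero.1 ?_).resolve_left hv
    linear_combination this
  have h10 : ∀ y : ℂ, (![1, y] : Fin 2 → ℂ) ≠ 0 := fun y h => by simpa using congrFun h 0
  have hinf : {y : ℂ | z 1 - z 0 * y ≠ 0}.Infinite := by
    refine ((Polynomial.C (z 1) - Polynomial.C (z 0) * Polynomial.X).finite_setOfPred_isRoot
      ?_).infinite_compl.mono fun y hy => ?_
    · intro h
      have e0 := congrArg (Polynomial.eval 0) h
      have e1 := congrArg (Polynomial.eval 1) h
      simp only [Polynomial.eval_sub, Polynomial.eval_mul, Polynomial.eval_C, Polynomial.eval_X,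
        Polynomial.eval_zero] at e0 e1
      refine hz (funext fun i => ?_)
      fin_cases i
      · simp only [Fin.zero_eta, Pi.zero_apply]; linear_combination e0 - e1
      · simp only [Fin.mk_one, Pi.zero_apply]; linear_combination e0
    · intro h
      apply hy
      simpa [Polynomial.IsRoot] using h
  have hp : p = 0 := by
    refine Prod.ext ?_ ?_
    · refine Polynomial.eq_of_infinite_eval_eq _ _ (hinf.mono fun y hy => ?_)
      have hw : (![1, 0] : Fin 2 → ℂ) ≠ 0 := fun h => by simpa using congrFun h 0
      have := hv (D.conePoint _ (h10 y) _ hw) (by simpa [conePoint] using hy)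
      rw [form_apply, coord_conePoint] at this
      simpa [conePoint, binForm_one_left h1] using this
    · refine Polynomial.eq_of_infinite_eval_eq _ _ (hinf.mono fun y hy => ?_)
      have hw : (![0, 1] : Fin 2 → ℂ) ≠ 0 := fun h => by simpa using congrFun h 1
      have := hv (D.conePoint _ (h10 y) _ hw) (by simpa [conePoint] using hy)
      rw [form_apply, coord_conePoint] at this
      simpa [conePoint, binForm_one_left h2] using this
  refine evalH0_injective _ ?_
  rw [h3, hp, map_zero, map_zero]

end ScrollData

/-! ### Pencils of decomposable tensors -/

theorem exists_smul_of_minors {ι : Type*} {x y : ι → ℂ} (hx : x ≠ 0)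
    (h : ∀ j k, x j * y k = x k * y j) : ∃ c : ℂ, y = c • x := by
  obtain ⟨i, hi⟩ := Function.ne_iff.1 hx
  have hi' : x i ≠ 0 := hi
  refine ⟨y i / x i, funext fun j => ?_⟩
  rw [Pi.smul_apply, smul_eq_mul, div_mul_eq_mul_div, eq_div_iff hi']
  linear_combination h i j

open Matrix in
theorem exists_smul_of_cross_eq_zero {e e' : Fin 3 → ℂ} (he : e ≠ 0)
    (hc : crossProduct e e' = 0) : ∃ c : ℂ, e' = c • e := by
  have h0 := congrFun hc 0
  have h1 := congrFun hc 1
  have h2 := congrFun hc 2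
  simp only [cross_apply, Matrix.cons_val, Pi.zero_apply] at h0 h1 h2
  refine exists_smul_of_minors he fun j k => ?_
  fin_cases j <;> fin_cases k <;> simp only [Fin.zero_eta, Fin.mk_one, Fin.reduceFinMk,
    Fin.isValue]
  · linear_combination h2
  · linear_combination -h1
  · linear_combination -h2
  · linear_combination h0
  · linear_combination h1
  · linear_combination -h0

/-- A 2 × 2 minor of `z ⊗ x + z' ⊗ x'` is the product of the determinants of `(z, z')` and of the
corresponding components of `(x, x')`. -/
theorem minors_of_tensor_add {z z' z'' : Fin 2 → ℂ} {x x' x'' : Fin 3 → ℂ}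
    (h : tensor z x + tensor z' x' = tensor z'' x'') (hz : z 0 * z' 1 - z 1 * z' 0 ≠ 0)
    (j k : Fin 3) : x j * x' k = x k * x' j := by
  have e : ∀ i l, z i * x l + z' i * x' l = z'' i * x'' l := fun i l => congrFun h (i, l)
  refine mul_left_cancel₀ hz ?_
  have h1 := e 0 j
  have h2 := e 0 k
  have h3 := e 1 j
  have h4 := e 1 k
  linear_combination (z 1 * x k + z' 1 * x' k) * h1 - (z 1 * x j + z' 1 * x' j) * h2 +
    z'' 0 * x'' j * h4 - z'' 0 * x'' k * h3

theorem exists_combination {z z' : Fin 2 → ℂ} (hz : z 0 * z' 1 - z 1 * z' 0 ≠ 0)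
    (w : Fin 2 → ℂ) : ∃ S T : ℂ, w = S • z + T • z' := by
  refine ⟨(w 0 * z' 1 - w 1 * z' 0) / (z 0 * z' 1 - z 1 * z' 0),
    (z 0 * w 1 - z 1 * w 0) / (z 0 * z' 1 - z 1 * z' 0), funext fun i => ?_⟩
  rw [Pi.add_apply, Pi.smul_apply, Pi.smul_apply, smul_eq_mul, smul_eq_mul,
    div_mul_eq_mul_div, div_mul_eq_mul_div, ← add_div, eq_div_iff hz]
  fin_cases i <;> simp only [Fin.zero_eta, Fin.mk_one] <;> ring

theorem tensor_add_right (z : Fin 2 → ℂ) (x y : Fin 3 → ℂ) :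
    tensor z (x + y) = tensor z x + tensor z y := by
  ext i; simp [tensor, mul_add]

theorem tensor_smul_right (c : ℂ) (z : Fin 2 → ℂ) (x : Fin 3 → ℂ) :
    tensor z (c • x) = c • tensor z x := by
  ext i; simp only [tensor, Pi.smul_apply, smul_eq_mul]; ring

theorem tensor_add_left (z w : Fin 2 → ℂ) (x : Fin 3 → ℂ) :
    tensor (z + w) x = tensor z x + tensor w x := by
  ext i; simp [tensor, add_mul]

theorem tensor_smul_left (c : ℂ) (z : Fin 2 → ℂ) (x : Fin 3 → ℂ) :
    tensor (c • z) x = c • tensor z x := by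
  ext i; simp only [tensor, Pi.smul_apply, smul_eq_mul]; ring

theorem smul_right_of_tensor_eq {z w : Fin 2 → ℂ} {x y : Fin 3 → ℂ} (h : tensor z x = tensor w y)
    (hw : w ≠ 0) : ∃ c : ℂ, y = c • x := by
  obtain ⟨i, hi⟩ := Function.ne_iff.1 hw
  have hi' : w i ≠ 0 := hi
  refine ⟨z i / w i, funext fun j => ?_⟩
  have : z i * x j = w i * y j := congrFun h (i, j)
  rw [Pi.smul_apply, smul_eq_mul, div_mul_eq_mul_div, eq_div_iff hi', this, mul_comm]

theorem minor_of_tensor_eq {z w : Fin 2 → ℂ} {x y : Fin 3 → ℂ} (h : tensor z x = tensor w y)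
    (hx : x ≠ 0) : z 0 * w 1 = z 1 * w 0 := by
  obtain ⟨j, hj⟩ := Function.ne_iff.1 hx
  have h0 : z 0 * x j = w 0 * y j := congrFun h (0, j)
  have h1 : z 1 * x j = w 1 * y j := congrFun h (1, j)
  have hj' : x j ≠ 0 := hj
  refine mul_right_cancel₀ hj' ?_
  linear_combination w 1 * h0 - w 0 * h1

theorem Vec.point_eq_of_tensor_eq {v w : Vec} (h : tensor v.z v.x = tensor w.z w.x) :
    v.point = w.point := by
  obtain ⟨b, hb⟩ := smul_right_of_tensor_eq h w.z_ne
  have hm := minor_of_tensor_eq h v.x_ne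
  obtain ⟨a, ha⟩ := exists_smul_of_minors v.z_ne (y := w.z) fun i k => by
    fin_cases i <;> fin_cases k <;> simp only [Fin.zero_eta, Fin.mk_one]
    · exact hm
    · exact hm.symm
  refine (Vec.point_eq_iff.2 ⟨a, b, ?_, ?_, ha, hb⟩).symm
  · rintro rfl
    exact w.z_ne (by rw [ha, zero_smul])
  · rintro rfl
    exact w.x_ne (by rw [hb, zero_smul])

/-! ### Bilinear forms in terms of polynomials -/

/-- The restriction of bilinear forms to a section `ρ` of the scroll. -/
noncomputable def restrictBilin (ρ : Fin 3 → Polynomial ℂ) :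
    Module.Dual ℂ (Fin 2 × Fin 3 → ℂ) →ₗ[ℂ] Polynomial ℂ where
  toFun β := ∑ p, β (Pi.single p 1) • (Polynomial.X ^ (p.1 : ℕ) * ρ p.2)
  map_add' β γ := by simp [add_smul, Finset.sum_add_distrib]
  map_smul' c β := by simp [mul_smul, Finset.smul_sum]

theorem restrictBilin_apply (ρ : Fin 3 → Polynomial ℂ) (β : Module.Dual ℂ (Fin 2 × Fin 3 → ℂ)) :
    restrictBilin ρ β = ∑ p, β (Pi.single p 1) • (Polynomial.X ^ (p.1 : ℕ) * ρ p.2) := rfl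

theorem natDegree_restrictBilin {m : ℕ} {ρ : Fin 3 → Polynomial ℂ}
    (hρ : ∀ j, (ρ j).natDegree ≤ m) (β : Module.Dual ℂ (Fin 2 × Fin 3 → ℂ)) :
    (restrictBilin ρ β).natDegree ≤ m + 1 := by
  rw [restrictBilin_apply]
  refine Polynomial.natDegree_sum_le_of_forall_le _ _ fun p _ => ?_
  refine (Polynomial.natDegree_smul_le _ _).trans (Polynomial.natDegree_mul_le.trans ?_)
  have h1 := hρ p.2
  have h2 := p.1.2
  rw [Polynomial.natDegree_X_pow]
  omega

theorem binForm_restrictBilin {m : ℕ} {ρ : Fin 3 → Polynomial ℂ}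
    (hρ : ∀ j, (ρ j).natDegree ≤ m) (β : Module.Dual ℂ (Fin 2 × Fin 3 → ℂ)) (z : Fin 2 → ℂ) :
    binForm (m + 1) z (restrictBilin ρ β) = β (tensor z (formVec m z ρ)) := by
  rw [restrictBilin_apply, map_sum, β.pi_apply_eq_sum_univ]
  refine Finset.sum_congr rfl fun p _ => ?_
  have e : (fun k => if p = k then (1 : ℂ) else 0) = Pi.single p 1 := by
    ext k; simp [Pi.single_apply, eq_comm]
  rw [e, map_smul, smul_eq_mul, smul_eq_mul, mul_comm]
  congr 1
  obtain ⟨i, j⟩ := p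
  fin_cases i
  · simpa [tensor, formVec] using (z_zero_mul_binForm (hρ j) z).symm
  · simpa [tensor, formVec] using (z_one_mul_binForm m (ρ j) z).symm

namespace ScrollData

variable {F G : BiPoly} (D : ScrollData F) (E : ScrollData G)

theorem eq_zero_of_restrictBilin {G : BiPoly} (E : ScrollData G)
    {β : Module.Dual ℂ (Fin 2 × Fin 3 → ℂ)}
    (h1 : restrictBilin E.σ β = 0) (h2 : restrictBilin E.τ β = 0) : β = 0 := by
  refine E.eq_zero_of_tensor_eq_zero β fun v => ?_
  rw [E.x_eq v, tensor_add_right, tensor_smul_right, tensor_smul_right, map_add, map_smul,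
    map_smul, ← binForm_restrictBilin E.natDegree_σ, ← binForm_restrictBilin E.natDegree_τ, h1, h2]
  simp

open Matrix in
-- Two independent `e`, `e'` orthogonal to every `q(z)` make `q(z)` a multiple of the fixed vector
-- `e × e'`. A component of `q` at which that vector is nonzero has a root, and there all of `q`
-- would vanish.
theorem smul_of_forall_eval_eq_zero {F : BiPoly} (D : ScrollData F) {e e' : Fin 3 → ℂ}
    (he : e ≠ 0) (h : ∀ z, z ≠ 0 → MvPolynomial.eval (Sum.elim z e) F = 0)
    (h' : ∀ z, z ≠ 0 → MvPolynomial.eval (Sum.elim z e') F = 0) : ∃ c : ℂ, e' = c • e := by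
  by_cases hc : crossProduct e e' = 0
  · exact exists_smul_of_cross_eq_zero he hc
  · exfalso
    obtain ⟨j, hj⟩ := Function.ne_iff.1 hc
    obtain ⟨z, hz, hz0⟩ := exists_binForm_eq_zero (m := 2) (by norm_num) (D.q j)
    have h1 := h z hz
    have h2 := h' z hz
    rw [D.eval_eq] at h1 h2
    obtain ⟨c, hc'⟩ := exists_smul_of_orthogonal rfl hc h1 h2
    have h3 := congrFun hc' j
    rw [Pi.smul_apply, smul_eq_mul] at h3
    have h4 : c = 0 := (mul_eq_zero.1 (h3.symm.trans hz0)).resolve_right hj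
    exact D.q_ne z hz (by rw [hc', h4, zero_smul])

/-! ### Linear maps between Segre cones preserve the rulings -/

theorem exists_tensor_eq (B : (Fin 2 × Fin 3 → ℂ) ≃ₗ[ℂ] (Fin 2 × Fin 3 → ℂ))
    (hB : ∀ v : Cone (zeroLocus G), ∃ w : Cone (zeroLocus F),
      B (tensor v.1.z v.1.x) = tensor w.1.z w.1.x)
    {z : Fin 2 → ℂ} (hz : z ≠ 0) {w : Fin 2 → ℂ} (hw : w ≠ 0) :
    ∃ u : Cone (zeroLocus F), w 0 • B (tensor z (formVec E.a z E.σ)) +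
      w 1 • B (tensor z (formVec E.b z E.τ)) = tensor u.1.z u.1.x := by
  obtain ⟨u, hu⟩ := hB (E.conePoint z hz w hw)
  refine ⟨u, ?_⟩
  rw [← hu, ← map_smul, ← map_smul, ← map_add, ← tensor_smul_right, ← tensor_smul_right,
    ← tensor_add_right]
  rfl

/-- The images of `σ(z)`, `τ(z)` and of their sum are decomposable, so either the first factors or
the second factors are proportional. In the second case the fibre goes onto the whole line `ℙ¹ ×
{[x']}`, which therefore lies on the divisor of `F`. -/
theorem fibre_dichotomy (B : (Fin 2 × Fin 3 → ℂ) ≃ₗ[ℂ] (Fin 2 × Fin 3 → ℂ))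
    (hB : ∀ v : Cone (zeroLocus G), ∃ w : Cone (zeroLocus F),
      B (tensor v.1.z v.1.x) = tensor w.1.z w.1.x)
    {z : Fin 2 → ℂ} (hz : z ≠ 0) : ∃ z' z'' x' x'',
    B (tensor z (formVec E.a z E.σ)) = tensor z' x' ∧
    B (tensor z (formVec E.b z E.τ)) = tensor z'' x'' ∧
    (z' 0 * z'' 1 = z' 1 * z'' 0 ∨ z' 0 * z'' 1 - z' 1 * z'' 0 ≠ 0 ∧ x' ≠ 0 ∧
      (∃ c : ℂ, c ≠ 0 ∧ x'' = c • x') ∧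
      ∀ w, w ≠ 0 → MvPolynomial.eval (Sum.elim w x') F = 0) := by
  obtain ⟨u, hu⟩ := E.exists_tensor_eq B hB hz (w := ![1, 0]) fun h => by simpa using congrFun h 0
  obtain ⟨u', hu'⟩ := E.exists_tensor_eq B hB hz (w := ![0, 1]) fun h => by
    simpa using congrFun h 1
  obtain ⟨u'', hu''⟩ := E.exists_tensor_eq B hB hz (w := ![1, 1]) fun h => by
    simpa using congrFun h 1
  simp only [Matrix.cons_val_zero, Matrix.cons_val_one, one_smul, zero_smul, add_zero,
    zero_add] at hu hu' hu''
  refine ⟨u.1.z, u'.1.z, u.1.x, u'.1.x, hu, hu', ?_⟩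
  by_cases hd : u.1.z 0 * u'.1.z 1 - u.1.z 1 * u'.1.z 0 = 0
  · exact Or.inl (sub_eq_zero.1 hd)
  rw [hu, hu'] at hu''
  obtain ⟨c, hc⟩ := exists_smul_of_minors u.1.x_ne fun j k => minors_of_tensor_add hu'' hd j k
  have hc0 : c ≠ 0 := by
    rintro rfl
    exact u'.1.x_ne (by rw [hc, zero_smul])
  refine Or.inr ⟨hd, u.1.x_ne, ⟨c, hc0, hc⟩, fun w hw => ?_⟩
  obtain ⟨S, T, hST⟩ := exists_combination hd w
  have hne : (![S, T / c] : Fin 2 → ℂ) ≠ 0 := by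
    intro h
    have h0 : S = 0 := congrFun h 0
    have h1 : T / c = 0 := congrFun h 1
    have h2 : T = 0 := (div_eq_zero_iff.1 h1).resolve_right hc0
    exact hw (by rw [hST, h0, h2]; simp)
  obtain ⟨y, hy⟩ := E.exists_tensor_eq B hB hz hne
  have e : tensor w u.1.x = tensor y.1.z y.1.x := by
    rw [← hy, hu, hu', hc, tensor_smul_right, smul_smul]
    simp only [Matrix.cons_val_zero, Matrix.cons_val_one]
    rw [div_mul_cancel₀ _ hc0, ← tensor_smul_left, ← tensor_smul_left, ← tensor_add_left, ← hST]
  have hp := Vec.point_eq_of_tensor_eq (v := ⟨w, u.1.x, hw, u.1.x_ne⟩) (w := y.1) e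
  have hm : ∀ v : Vec, v.point = y.1.point → v.eval F = 0 := y.2
  exact hm ⟨w, u.1.x, hw, u.1.x_ne⟩ hp

/-- There is at most one exceptional fibre: two of them would have the same line `ℙ¹ × {[x']}` as
image, so by injectivity of `B` they would share a tensor, and then `y = y'`. -/
theorem infinite_setOf_minor_eq_zero {F : BiPoly} (D : ScrollData F)
    (B : (Fin 2 × Fin 3 → ℂ) ≃ₗ[ℂ] (Fin 2 × Fin 3 → ℂ))
    (hB : ∀ v : Cone (zeroLocus G), ∃ w : Cone (zeroLocus F),
      B (tensor v.1.z v.1.x) = tensor w.1.z w.1.x) :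
    {y : ℂ | ∃ z' z'' x' x'', B (tensor ![1, y] (formVec E.a ![1, y] E.σ)) = tensor z' x' ∧
      B (tensor ![1, y] (formVec E.b ![1, y] E.τ)) = tensor z'' x'' ∧
      z' 0 * z'' 1 = z' 1 * z'' 0}.Infinite := by
  have h10 : ∀ y : ℂ, (![1, y] : Fin 2 → ℂ) ≠ 0 := fun y h => by simpa using congrFun h 0
  rw [← compl_compl {y : ℂ | _}]
  refine (Set.Subsingleton.finite ?_).infinite_compl
  intro y hy y' hy'
  obtain ⟨z, w, x, x', h1, h2, h | ⟨hd, hx, ⟨c, hc, hx'⟩, hF⟩⟩ := E.fibre_dichotomy B hB (h10 y)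
  · exact absurd ⟨z, w, x, x', h1, h2, h⟩ hy
  obtain ⟨u, u', e, e', k1, k2, k | ⟨-, -, -, kF⟩⟩ := E.fibre_dichotomy B hB (h10 y')
  · exact absurd ⟨u, u', e, e', k1, k2, k⟩ hy'
  obtain ⟨l, hl⟩ := D.smul_of_forall_eval_eq_zero hx hF kF
  obtain ⟨S, T, hST⟩ := exists_combination hd u
  have key : tensor ![1, y'] (formVec E.a ![1, y'] E.σ) = tensor ![1, y]
      (l • (S • formVec E.a ![1, y] E.σ + (T / c) • formVec E.b ![1, y] E.τ)) := by
    refine B.injective ?_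
    rw [k1, hl, tensor_smul_right, tensor_smul_right, tensor_add_right, tensor_smul_right,
      tensor_smul_right, map_smul, map_add, map_smul, map_smul, h1, h2, hx', tensor_smul_right,
      smul_smul, div_mul_cancel₀ _ hc, hST, tensor_add_left, tensor_smul_left,
      tensor_smul_left]
  have hσ : formVec E.a ![1, y'] E.σ ≠ 0 := by
    intro h
    refine E.q_ne _ (h10 y') ?_
    rw [← E.cross, h, map_zero, LinearMap.zero_apply]
  have := minor_of_tensor_eq key.symm (fun h => ?_)
  · simpa using this.symm
  · rw [h] at key
    refine tensor_ne_zero (h10 y') hσ (key.trans ?_)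
    ext i
    simp [tensor]

/-- The component of index `p` of `B`, restricted to the sections `σ` and `τ` of the scroll. -/
noncomputable def component {G : BiPoly} (E : ScrollData G)
    (B : (Fin 2 × Fin 3 → ℂ) ≃ₗ[ℂ] (Fin 2 × Fin 3 → ℂ)) (κ : Fin 2) (p : Fin 2 × Fin 3) :
    Polynomial ℂ :=
  restrictBilin (![E.σ, E.τ] κ) (LinearMap.proj p ∘ₗ B.toLinearMap)

theorem natDegree_component (B : (Fin 2 × Fin 3 → ℂ) ≃ₗ[ℂ] (Fin 2 × Fin 3 → ℂ)) (κ : Fin 2)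
    (p : Fin 2 × Fin 3) : (E.component B κ p).natDegree ≤ ![E.a, E.b] κ + 1 := by
  refine natDegree_restrictBilin ?_ _
  fin_cases κ
  exacts [E.natDegree_σ, E.natDegree_τ]

theorem binForm_component (B : (Fin 2 × Fin 3 → ℂ) ≃ₗ[ℂ] (Fin 2 × Fin 3 → ℂ)) (κ : Fin 2)
    (p : Fin 2 × Fin 3) (z : Fin 2 → ℂ) :
    binForm (![E.a, E.b] κ + 1) z (E.component B κ p) =
      B (tensor z (formVec (![E.a, E.b] κ) z (![E.σ, E.τ] κ))) p := by
  refine binForm_restrictBilin ?_ _ z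
  fin_cases κ
  exacts [E.natDegree_σ, E.natDegree_τ]

/-- The entries of `B` are independent linear forms, and restriction to `σ` and `τ` loses nothing
because bilinear forms are determined on the cone. -/
theorem eq_zero_of_sum_component (B : (Fin 2 × Fin 3 → ℂ) ≃ₗ[ℂ] (Fin 2 × Fin 3 → ℂ))
    {e : Fin 2 × Fin 3 → ℂ} (h : ∀ κ, ∑ p, e p • E.component B κ p = 0) : e = 0 := by
  have h0 : (∑ p, e p • (LinearMap.proj p ∘ₗ B.toLinearMap) :
      Module.Dual ℂ (Fin 2 × Fin 3 → ℂ)) = 0 := by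
    refine E.eq_zero_of_restrictBilin ?_ ?_
    · rw [map_sum, ← h 0]
      exact Finset.sum_congr rfl fun p _ => map_smul _ _ _
    · rw [map_sum, ← h 1]
      exact Finset.sum_congr rfl fun p _ => map_smul _ _ _
  ext p
  have := congrArg (fun β => β (B.symm (Pi.single p 1))) h0
  simpa [Pi.single_apply] using this

/-- Away from the exceptional fibre the first factors of the images of `σ` and `τ` are proportional;
a polynomial identity valid at infinitely many `y` is valid identically. -/
theorem component_mul_component {F : BiPoly} (D : ScrollData F)
    (B : (Fin 2 × Fin 3 → ℂ) ≃ₗ[ℂ] (Fin 2 × Fin 3 → ℂ))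
    (hB : ∀ v : Cone (zeroLocus G), ∃ w : Cone (zeroLocus F),
      B (tensor v.1.z v.1.x) = tensor w.1.z w.1.x)
    (κ l : Fin 2) (j k : Fin 3) :
    E.component B κ (0, j) * E.component B l (1, k) =
      E.component B κ (1, j) * E.component B l (0, k) := by
  refine Polynomial.eq_of_infinite_eval_eq _ _
    ((infinite_setOf_minor_eq_zero E D B hB).mono fun y hy => ?_)
  obtain ⟨z', z'', x', x'', h1, h2, h⟩ := hy
  have e : ∀ κ p, (E.component B κ p).eval y = tensor (![z', z''] κ) (![x', x''] κ) p := by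
    intro κ p
    rw [← binForm_one_left (E.natDegree_component B κ p), binForm_component]
    fin_cases κ
    exacts [congrFun h1 p, congrFun h2 p]
  change Polynomial.eval y _ = Polynomial.eval y _
  rw [Polynomial.eval_mul, Polynomial.eval_mul, e, e, e, e]
  fin_cases κ <;> fin_cases l <;> simp only [tensor, Fin.zero_eta, Fin.mk_one,
    Matrix.cons_val_zero, Matrix.cons_val_one]
  · ring
  · linear_combination x' j * x'' k * h
  · linear_combination - x'' j * x' k * h
  · ring

/-- All rows of components have the same ratio `g₀ : g₁`, in lowest terms. Bezout coefficients `u`,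
`v` of the coprime pair produce the cofactors without division. -/
theorem exists_component_eq {F : BiPoly} (D : ScrollData F)
    (B : (Fin 2 × Fin 3 → ℂ) ≃ₗ[ℂ] (Fin 2 × Fin 3 → ℂ))
    (hB : ∀ v : Cone (zeroLocus G), ∃ w : Cone (zeroLocus F),
      B (tensor v.1.z v.1.x) = tensor w.1.z w.1.x) :
    ∃ (g : Fin 2 → Polynomial ℂ) (h : Fin 2 → Fin 3 → Polynomial ℂ),
      ∀ κ i j, E.component B κ (i, j) = g i * h κ j := by
  obtain ⟨κ, j, hne⟩ : ∃ κ j, E.component B κ (0, j) ≠ 0 ∨ E.component B κ (1, j) ≠ 0 := by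
    by_contra! hc
    have := E.eq_zero_of_sum_component B (e := Pi.single (0, 0) 1) fun κ => by
      refine Finset.sum_eq_zero fun p _ => ?_
      obtain ⟨i, j⟩ := p
      fin_cases i
      · exact (congrArg _ (hc κ j).1).trans (smul_zero _)
      · exact (congrArg _ (hc κ j).2).trans (smul_zero _)
    simpa using congrFun this (0, 0)
  obtain ⟨d, g₀, g₁, hd, h0, h1, u, v, huv⟩ := exists_coprime_factorization hne
  have hr : ∀ l k, g₀ * E.component B l (1, k) = g₁ * E.component B l (0, k) := by
    intro l k
    have := component_mul_component E D B hB κ l j k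
    rw [h0, h1] at this
    refine mul_left_cancel₀ hd ?_
    linear_combination this
  refine ⟨![g₀, g₁], fun l k => u * E.component B l (0, k) + v * E.component B l (1, k),
    fun l i k => ?_⟩
  fin_cases i <;> simp only [Fin.zero_eta, Fin.mk_one, Matrix.cons_val_zero, Matrix.cons_val_one]
  · linear_combination (-E.component B l (0, k)) * huv - v * hr l k
  · linear_combination (-E.component B l (1, k)) * huv + u * hr l k

/-- If some `gᵢ` had degree at least 2, the cofactors `h κ j` would have degrees below `a` and `b`.
The three pairs `(h 0 j, h 1 j)` would lie in a space of dimension `a + b = 2`, and a relation among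
them would contradict the independence of the entries of `B`. -/
theorem natDegree_le_one_of_component_eq (B : (Fin 2 × Fin 3 → ℂ) ≃ₗ[ℂ] (Fin 2 × Fin 3 → ℂ))
    {g : Fin 2 → Polynomial ℂ} {h : Fin 2 → Fin 3 → Polynomial ℂ}
    (hgh : ∀ κ i j, E.component B κ (i, j) = g i * h κ j) (i : Fin 2) :
    (g i).natDegree ≤ 1 := by
  by_contra! hi
  have hg : g i ≠ 0 := by
    intro h0
    rw [h0, Polynomial.natDegree_zero] at hi
    omega
  have hdeg : ∀ κ j, h κ j ∈ Polynomial.degreeLT ℂ (![E.a, E.b] κ) := by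
    intro κ j
    by_cases h0 : h κ j = 0
    · rw [h0]; exact Submodule.zero_mem _
    have := E.natDegree_component B κ (i, j)
    rw [hgh, Polynomial.natDegree_mul hg h0] at this
    rw [Polynomial.mem_degreeLT, Polynomial.degree_eq_natDegree h0]
    exact_mod_cast (by omega : (h κ j).natDegree < ![E.a, E.b] κ)
  let L : (Fin 3 → ℂ) →ₗ[ℂ] Polynomial.degreeLT ℂ E.a × Polynomial.degreeLT ℂ E.b :=
    (Fintype.linearCombination ℂ fun j => (⟨h 0 j, hdeg 0 j⟩ : Polynomial.degreeLT ℂ E.a)).prod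
      (Fintype.linearCombination ℂ fun j => (⟨h 1 j, hdeg 1 j⟩ : Polynomial.degreeLT ℂ E.b))
  obtain ⟨u, hu, hu0⟩ := L.ker.exists_mem_ne_zero_of_ne_bot (L.ker_ne_bot_of_finrank_lt (by
    rw [Module.finrank_prod, finrank_degreeLT, finrank_degreeLT, E.add_eq]
    simp))
  have hL0 : ∑ j, u j • h 0 j = 0 := by
    have := congrArg (fun x => (x.1 : Polynomial ℂ)) hu
    simpa [L, Fintype.linearCombination_apply] using this
  have hL1 : ∑ j, u j • h 1 j = 0 := by
    have := congrArg (fun x => (x.2 : Polynomial ℂ)) hu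
    simpa [L, Fintype.linearCombination_apply] using this
  have := E.eq_zero_of_sum_component B (e := fun p => if p.1 = i then u p.2 else 0) fun κ => by
    have hL : ∑ j, u j • h κ j = 0 := by fin_cases κ <;> assumption
    rw [Fintype.sum_prod_type, Finset.sum_eq_single i]
    · simp only [if_true, hgh, ← mul_smul_comm, ← Finset.mul_sum, hL, mul_zero]
    · intro i' _ hi'
      simp [hi']
    · simp
  exact hu0 (funext fun j => by simpa using congrFun this (i, j))

/-- A linear isomorphism between the cones of two smooth divisors of bidegree `(2, 1)` respects
the projections to `ℙ¹`. -/
theorem exists_ruling_equiv {F G : BiPoly} (E : ScrollData G) (D : ScrollData F)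
    (B : (Fin 2 × Fin 3 → ℂ) ≃ₗ[ℂ] (Fin 2 × Fin 3 → ℂ))
    (hB : ∀ v : Cone (zeroLocus G), ∃ w : Cone (zeroLocus F),
      B (tensor v.1.z v.1.x) = tensor w.1.z w.1.x) :
    ∃ M : (Fin 2 → ℂ) ≃ₗ[ℂ] (Fin 2 → ℂ), ∀ v : Cone (zeroLocus G), ∃ x,
      B (tensor v.1.z v.1.x) = tensor (M v.1.z) x := by
  obtain ⟨g, h, hgh⟩ := exists_component_eq E D B hB
  have hg := E.natDegree_le_one_of_component_eq B hgh
  -- Constant `g₀`, `g₁` would be linearly dependent, giving a relation between entries of `B`. A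
  -- factor of exact degree 1 is needed to bound the degrees of the cofactors.
  obtain ⟨i, hi⟩ : ∃ i, (g i).natDegree = 1 := by
    by_contra! hc
    have hC : ∀ i, g i = Polynomial.C ((g i).coeff 0) := fun i =>
      Polynomial.eq_C_of_natDegree_eq_zero (by have := hg i; have := hc i; omega)
    have rel : ∀ c₀ c₁ : ℂ, c₀ * (g 0).coeff 0 + c₁ * (g 1).coeff 0 = 0 → c₀ = 0 ∧ c₁ = 0 := by
      intro c₀ c₁ hcc
      have := E.eq_zero_of_sum_component B (e := fun p => if p.2 = 0 then ![c₀, c₁] p.1 else 0)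
        fun κ => by
          rw [Fintype.sum_prod_type_right, Finset.sum_eq_single 0]
          · simp only [if_true, hgh, ← smul_mul_assoc, ← Finset.sum_mul]
            rw [Fin.sum_univ_two, hC 0, hC 1]
            simp only [Matrix.cons_val_zero, Matrix.cons_val_one, Polynomial.smul_C, smul_eq_mul,
              ← Polynomial.C_add, hcc, map_zero, zero_mul]
          · intro j' _ hj'
            simp [hj']
          · simp
      exact ⟨by simpa using congrFun this (0, 0), by simpa using congrFun this (1, 0)⟩
    have h1 := rel ((g 1).coeff 0) (-(g 0).coeff 0) (by ring)
    have h2 := rel 1 0 (by rw [neg_eq_zero.1 h1.2]; ring)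
    exact one_ne_zero h2.1
  have hh : ∀ κ j, (h κ j).natDegree ≤ ![E.a, E.b] κ := by
    intro κ j
    by_cases h0 : h κ j = 0
    · rw [h0]; simp
    have hgi : g i ≠ 0 := by rintro h'; rw [h'] at hi; simp at hi
    have := E.natDegree_component B κ (i, j)
    rw [hgh, Polynomial.natDegree_mul hgi h0] at this
    omega
  have hM : ∀ κ z i j, B (tensor z (formVec (![E.a, E.b] κ) z (![E.σ, E.τ] κ))) (i, j) =
      binForm 1 z (g i) * binForm (![E.a, E.b] κ) z (h κ j) := by
    intro κ z i j
    rw [← binForm_component, hgh, binForm_one_mul (hg i) (hh κ j)]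
  let M₀ : (Fin 2 → ℂ) →ₗ[ℂ] (Fin 2 → ℂ) :=
    { toFun := fun z i => binForm 1 z (g i)
      map_add' := fun z w => by
        ext i; simp [binForm_apply, Finset.sum_range_succ]; ring
      map_smul' := fun c z => by
        ext i; simp [binForm_apply, Finset.sum_range_succ]; ring }
  have hx : ∀ v : Cone (zeroLocus G), ∃ x, B (tensor v.1.z v.1.x) = tensor (M₀ v.1.z) x := by
    intro v
    refine ⟨fun j => E.coord v 0 * binForm E.a v.1.z (h 0 j) +
      E.coord v 1 * binForm E.b v.1.z (h 1 j), funext fun p => ?_⟩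
    have e0 := hM 0 v.1.z p.1 p.2
    have e1 := hM 1 v.1.z p.1 p.2
    simp only [Matrix.cons_val_zero, Matrix.cons_val_one] at e0 e1
    conv_lhs => rw [E.x_eq v]
    rw [tensor_add_right, tensor_smul_right, tensor_smul_right, map_add, map_smul, map_smul,
      Pi.add_apply, Pi.smul_apply, Pi.smul_apply, e0, e1]
    change _ = binForm 1 v.1.z (g p.1) * _
    simp only [smul_eq_mul]
    ring
  -- A zero of `M₀` would make `B` kill a nonzero tensor.
  have hinj : Function.Injective M₀ := by
    refine (injective_iff_map_eq_zero _).2 fun z hz => ?_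
    by_contra hz0
    have hw : (![1, 0] : Fin 2 → ℂ) ≠ 0 := fun h => by simpa using congrFun h 0
    obtain ⟨x, hx⟩ := hx (E.conePoint z hz0 _ hw)
    refine B.map_ne_zero_iff.2 (tensor_ne_zero (E.conePoint z hz0 _ hw).1.z_ne
      (E.conePoint z hz0 _ hw).1.x_ne) (hx.trans ?_)
    have : (E.conePoint z hz0 _ hw).1.z = z := rfl
    rw [this, hz]
    ext p
    simp [tensor]
  exact ⟨LinearEquiv.ofInjectiveEndo M₀ hinj, hx⟩

end ScrollData

/-! ### Linear isomorphisms of Segre cones -/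

theorem isSecAt_tensor {X : Set BiProj} (β : Module.Dual ℂ (Fin 2 × Fin 3 → ℂ)) (x : X) :
    IsSecAt (1, 1) x (fun v => β (tensor v.1.z v.1.x)) := by
  have e : (fun v : Cone X => β (tensor v.1.z v.1.x)) =
      fun v => ∑ p : Fin 2 × Fin 3, β (Pi.single p 1) * (v.1.z p.1 * v.1.x p.2) := by
    ext v
    rw [β.pi_apply_eq_sum_univ]
    refine Finset.sum_congr rfl fun p _ => ?_
    have : (fun k => if p = k then (1 : ℂ) else 0) = Pi.single p 1 := by
      ext k; simp [Pi.single_apply, eq_comm]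
    rw [this, smul_eq_mul, mul_comm]
    rfl
  rw [e]
  exact IsSecAt.sum _ fun p _ => ((isSecAt_z p.1 x).mul (isSecAt_x p.2 x)).const_mul _

/-- A bijection between the cones over `X` and `Y` which is induced by the linear isomorphism
`B` of the spaces of tensors and the linear isomorphism `M` on the first factor. -/
structure ConeEquiv (X Y : Set BiProj) (B : (Fin 2 × Fin 3 → ℂ) ≃ₗ[ℂ] (Fin 2 × Fin 3 → ℂ)) where
  M : (Fin 2 → ℂ) ≃ₗ[ℂ] (Fin 2 → ℂ)
  toFun : Cone X → Cone Y
  invFun : Cone Y → Cone X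
  left_inv : ∀ v, invFun (toFun v) = v
  right_inv : ∀ w, toFun (invFun w) = w
  z_eq : ∀ v, (toFun v).1.z = M v.1.z
  tensor_eq : ∀ v, tensor (toFun v).1.z (toFun v).1.x = B (tensor v.1.z v.1.x)

namespace ConeEquiv

variable {X Y : Set BiProj} {B : (Fin 2 × Fin 3 → ℂ) ≃ₗ[ℂ] (Fin 2 × Fin 3 → ℂ)}

theorem isConeMap (χ : ConeEquiv X Y B) : IsConeMap (1, 0) (0, 1) χ.toFun := by
  have hz : ∀ x i, IsSecAt (1, 0) x (fun v => (χ.toFun v).1.z i) := by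
    intro x i
    have e : (fun v => (χ.toFun v).1.z i) =
        fun v : Cone X => ∑ k, χ.M (Pi.single k 1) i * v.1.z k := by
      ext v
      rw [χ.z_eq]
      conv_lhs => rw [pi_eq_sum_univ' v.1.z]
      simp [mul_comm]
    rw [e]
    exact IsSecAt.sum _ fun k _ => (isSecAt_z k x).const_mul _
  refine ⟨hz, fun x j => ?_⟩
  obtain ⟨v, rfl⟩ := Cone.exists_base x
  -- Once the first factor is known to be linear, `xⱼ` of the image is the entry `(i, j)` of `B (z ⊗
  -- x)` divided by a nonzero `zᵢ` of the image.
  obtain ⟨i, hi⟩ := Function.ne_iff.1 (χ.toFun v).1.z_ne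
  have hi' : (χ.toFun v).1.z i ≠ 0 := hi
  obtain ⟨W, hvW, hW⟩ := (hz v.base i).exists_ne_zero hi'
  refine ((isSecAt_tensor (LinearMap.proj (i, j) ∘ₗ B.toLinearMap) v.base).div (hz v.base i)
    hi').congr W hvW fun w hw => ?_
  rw [div_eq_iff (hW w hw)]
  have : (χ.toFun w).1.z i * (χ.toFun w).1.x j = B (tensor w.1.z w.1.x) (i, j) :=
    congrFun (χ.tensor_eq w) (i, j)
  rw [mul_comm, this]
  rfl

/-- The inverse of an isomorphism of cones. -/
def symm (χ : ConeEquiv X Y B) : ConeEquiv Y X B.symm where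
  M := χ.M.symm
  toFun := χ.invFun
  invFun := χ.toFun
  left_inv := χ.right_inv
  right_inv := χ.left_inv
  z_eq w := by rw [LinearEquiv.eq_symm_apply, ← χ.z_eq, χ.right_inv]
  tensor_eq w := by rw [LinearEquiv.eq_symm_apply, ← χ.tensor_eq, χ.right_inv]

/-- The isomorphism of varieties induced by an isomorphism of cones. -/
noncomputable def varietyIso (χ : ConeEquiv X Y B) : VarietyIso X Y :=
  χ.isConeMap.varietyIso χ.symm.isConeMap χ.left_inv χ.right_inv

theorem varietyIso_base (χ : ConeEquiv X Y B) (v : Cone X) :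
    χ.varietyIso.toHomeomorph v.base = (χ.toFun v).base :=
  χ.isConeMap.varietyIso_base χ.symm.isConeMap χ.left_inv χ.right_inv v

/-- The isomorphism of line bundles induced by an isomorphism of cones. -/
noncomputable def moduleIso (χ : ConeEquiv X Y B) (a b : ℕ) :
    ModuleIso χ.varietyIso (twist X a b) (twist Y a b) :=
  χ.isConeMap.moduleIso χ.symm.isConeMap χ.left_inv χ.right_inv (by simp [wt]) (by simp [wt])

theorem segre_varietyIso {A A₀ : (Fin 2 × Fin 3 → ℂ) ≃ₗ[ℂ] (Fin 6 → ℂ)}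
    (χ : ConeEquiv X Y (A.trans A₀.symm)) (x : X) :
    segre A₀ (χ.varietyIso.toHomeomorph x) = segre A x := by
  obtain ⟨v, rfl⟩ := Cone.exists_base x
  rw [χ.varietyIso_base]
  change segre A₀ (χ.toFun v).1.point = segre A v.1.point
  rw [segre_point, segre_point]
  congr 1
  rw [χ.tensor_eq]
  simp

end ConeEquiv

/-- The vector obtained by rescaling the two groups of coordinates. -/
def Cone.rescale {X : Set BiProj} (v : Cone X) {a b : ℂ} (ha : a ≠ 0) (hb : b ≠ 0) : Cone X :=
  ⟨⟨a • v.1.z, b • v.1.x, smul_ne_zero ha v.1.z_ne, smul_ne_zero hb v.1.x_ne⟩, by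
    have : Vec.point ⟨a • v.1.z, b • v.1.x, smul_ne_zero ha v.1.z_ne,
      smul_ne_zero hb v.1.x_ne⟩ = v.1.point := Vec.point_eq_iff.2 ⟨a, b, ha, hb, rfl, rfl⟩
    rw [this]
    exact v.2⟩

theorem exists_smul_of_tensor_eq {z w : Fin 2 → ℂ} {x y : Fin 3 → ℂ}
    (h : tensor z x = tensor w y) (hz : z ≠ 0) (hx : x ≠ 0) : ∃ c : ℂ, w = c • z := by
  have hm := minor_of_tensor_eq h hx
  refine exists_smul_of_minors hz fun i k => ?_
  fin_cases i <;> fin_cases k <;> simp only [Fin.zero_eta, Fin.mk_one]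
  · exact hm
  · exact hm.symm

theorem eq_of_tensor_eq {z : Fin 2 → ℂ} {x y : Fin 3 → ℂ} (hz : z ≠ 0)
    (h : tensor z x = tensor z y) : x = y := by
  obtain ⟨i, hi⟩ := Function.ne_iff.1 hz
  exact funext fun j => mul_left_cancel₀ hi (congrFun h (i, j))

theorem ScrollData.nonempty_coneEquiv {F G : BiPoly} (D : ScrollData F) (E : ScrollData G)
    (B : (Fin 2 × Fin 3 → ℂ) ≃ₗ[ℂ] (Fin 2 × Fin 3 → ℂ))
    (hB : ∀ v : Cone (zeroLocus G), ∃ w : Cone (zeroLocus F),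
      B (tensor v.1.z v.1.x) = tensor w.1.z w.1.x)
    (hB' : ∀ w : Cone (zeroLocus F), ∃ v : Cone (zeroLocus G),
      B (tensor v.1.z v.1.x) = tensor w.1.z w.1.x) :
    Nonempty (ConeEquiv (zeroLocus G) (zeroLocus F) B) := by
  obtain ⟨M, hM⟩ := E.exists_ruling_equiv D B hB
  have hz : ∀ (v : Cone (zeroLocus G)) (w : Cone (zeroLocus F)),
      B (tensor v.1.z v.1.x) = tensor w.1.z w.1.x → ∃ c : ℂ, c ≠ 0 ∧ M v.1.z = c • w.1.z := by
    intro v w h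
    obtain ⟨x, hx⟩ := hM v
    obtain ⟨c, hc⟩ := exists_smul_of_tensor_eq (h.symm.trans hx) w.1.z_ne w.1.x_ne
    refine ⟨c, ?_, hc⟩
    rintro rfl
    exact M.map_ne_zero_iff.2 v.1.z_ne (by rw [hc, zero_smul])
  have h1 : ∀ v : Cone (zeroLocus G), ∃ w : Cone (zeroLocus F), w.1.z = M v.1.z ∧
      tensor w.1.z w.1.x = B (tensor v.1.z v.1.x) := by
    intro v
    obtain ⟨w, hw⟩ := hB v
    obtain ⟨c, hc, e⟩ := hz v w hw
    -- A tensor fixes its two factors only up to inverse scalars; rescaling makes the first factor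
    -- equal to `M z` on the nose.
    refine ⟨w.rescale hc (inv_ne_zero hc), e.symm, ?_⟩
    change tensor (c • w.1.z) (c⁻¹ • w.1.x) = _
    rw [tensor_smul_left, tensor_smul_right, smul_inv_smul₀ hc, hw]
  have h2 : ∀ w : Cone (zeroLocus F), ∃ v : Cone (zeroLocus G), w.1.z = M v.1.z ∧
      tensor w.1.z w.1.x = B (tensor v.1.z v.1.x) := by
    intro w
    obtain ⟨v, hv⟩ := hB' w
    obtain ⟨c, hc, e⟩ := hz v w hv
    refine ⟨v.rescale (inv_ne_zero hc) hc, ?_, ?_⟩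
    · change _ = M (c⁻¹ • v.1.z)
      rw [map_smul, e, inv_smul_smul₀ hc]
    · change _ = B (tensor (c⁻¹ • v.1.z) (c • v.1.x))
      rw [tensor_smul_left, tensor_smul_right, inv_smul_smul₀ hc, hv]
  choose f hfz hft using h1
  choose g hgz hgt using h2
  refine ⟨⟨M, f, g, fun v => ?_, fun w => ?_, hfz, hft⟩⟩
  · have e : (g (f v)).1.z = v.1.z := M.injective ((hgz (f v)).symm.trans (hfz v))
    refine Subtype.ext (Vec.ext' e (eq_of_tensor_eq v.1.z_ne (B.injective ?_)))
    rw [← hft v, hgt (f v), e]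
  · have e : (f (g w)).1.z = w.1.z := (hfz (g w)).trans (hgz w).symm
    refine Subtype.ext (Vec.ext' e (eq_of_tensor_eq w.1.z_ne ?_))
    rw [hgt w, ← hft (g w), e]

theorem exists_tensor_eq_of_segre_mem {A A₀ : (Fin 2 × Fin 3 → ℂ) ≃ₗ[ℂ] (Fin 6 → ℂ)}
    {X : Set BiProj} {v : Vec} (h : segre A v.point ∈ segre A₀ '' X) :
    ∃ w : Cone X, A (tensor v.z v.x) = A₀ (tensor w.1.z w.1.x) := by
  obtain ⟨p, hp, e⟩ := h
  obtain ⟨w, rfl⟩ := Vec.exists_point p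
  rw [segre_point, segre_point, Projectivization.mk_eq_mk_iff'] at e
  obtain ⟨c, hc⟩ := e
  have hc0 : c ≠ 0 := by
    rintro rfl
    rw [zero_smul] at hc
    exact A₀.map_ne_zero_iff.2 (tensor_ne_zero w.z_ne w.x_ne) hc.symm
  refine ⟨Cone.rescale (X := X) ⟨w, hp⟩ (inv_ne_zero hc0) one_ne_zero, ?_⟩
  change _ = A₀ (tensor (c⁻¹ • w.z) ((1 : ℂ) • w.x))
  rw [one_smul, tensor_smul_left, map_smul, ← hc, inv_smul_smul₀ hc0]

theorem ScrollData.nonempty_coneEquiv_of_segre {F G : BiPoly} (D : ScrollData F)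
    (E : ScrollData G) {A A₀ : (Fin 2 × Fin 3 → ℂ) ≃ₗ[ℂ] (Fin 6 → ℂ)}
    (h : segre A '' zeroLocus G = segre A₀ '' zeroLocus F) :
    Nonempty (ConeEquiv (zeroLocus G) (zeroLocus F) (A.trans A₀.symm)) := by
  refine D.nonempty_coneEquiv E _ (fun v => ?_) fun w => ?_
  · obtain ⟨w, hw⟩ := exists_tensor_eq_of_segre_mem (A := A) (v := v.1)
      (h ▸ Set.mem_image_of_mem _ v.2)
    exact ⟨w, by simp [hw]⟩
  · obtain ⟨v, hv⟩ := exists_tensor_eq_of_segre_mem (A := A₀) (v := w.1)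
      (h ▸ Set.mem_image_of_mem _ w.2)
    exact ⟨v, by simp [← hv]⟩

/-! ### Isomorphisms of `𝒪(0, 1)` -/

/-- The coordinate `xⱼ` as a section of `𝒪(0, 1)`. -/
noncomputable def coordSection (X : Set BiProj) (j : Fin 3) : H0 X :=
  (exists_evalH0_eq fun x => isSecAt_x j x).choose

theorem evalH0_coordSection (X : Set BiProj) (j : Fin 3) (v : Cone X) :
    evalH0 X (coordSection X j) v = v.1.x j :=
  congrFun (exists_evalH0_eq fun x => isSecAt_x (X := X) j x).choose_spec v

theorem isSecAt_div_coord {X : Set BiProj} (s : H0 X) {j : Fin 3} {v : Cone X}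
    (hv : v.1.x j ≠ 0) : IsSecAt 0 v.base (fun w => evalH0 X s w / w.1.x j) := by
  simpa using (isSecAt_evalH0 s v.base).div (isSecAt_x j v.base) hv

namespace ModuleIso

variable {X Y : Set BiProj} {ψ : VarietyIso X Y}

/-- The image of a global section, as a function on the cone. -/
noncomputable def onCone (θ : ModuleIso ψ (twist X 0 1) (twist Y 0 1)) (s : H0 Y)
    (v : Cone X) : ℂ :=
  (θ.equiv ⊤ s).1 ⟨v, trivial⟩

theorem isSecAt_onCone (θ : ModuleIso ψ (twist X 0 1) (twist Y 0 1)) (s : H0 Y) (x : X) :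
    IsSecAt (0, 1) x (θ.onCone s) :=
  (isTwistedSection_iff (k := (0, 1)) (f := θ.onCone s) fun _ _ => rfl).1
    (θ.equiv ⊤ s).2 x trivial

/-- On the open set `xⱼ ≠ 0` the quotient `s / xⱼ` is a regular function, so linearity of `θ` there
expresses `θ(s)` through `θ(xⱼ)`. -/
theorem onCone_mul (θ : ModuleIso ψ (twist X 0 1) (twist Y 0 1)) (s : H0 Y) (j : Fin 3)
    {v : Cone X} {w : Cone Y} (h : ψ.toHomeomorph v.base = w.base) (hw : w.1.x j ≠ 0) :
    θ.onCone s v * w.1.x j = evalH0 Y s w * θ.onCone (coordSection Y j) v := by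
  set V : Opens Y := nonvanishing Y (isBihomogeneous_X_inr j) with hV
  have hmem : ∀ u : Cone Y, u.base ∈ V ↔ u.1.x j ≠ 0 := by
    intro u
    rw [hV, base_mem_nonvanishing]
    simp [Vec.eval]
  let g : V → ℂ := fun y => evalH0 Y s (Cone.exists_base y.1).choose /
    (Cone.exists_base y.1).choose.1.x j
  have hg : ∀ (u : Cone Y) (hu : u.base ∈ V), evalH0 Y s u / u.1.x j = g ⟨u.base, hu⟩ := by
    intro u hu
    have e := (Cone.exists_base u.base).choose_spec
    exact IsSecAt.eq_of_base_eq e.symm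
      (isSecAt_div_coord s (v := (Cone.exists_base u.base).choose)
        ((hmem _).1 (by rw [e]; exact hu)))
  have hgs : ∀ (u : Cone Y) (hu : u.base ∈ V),
      g ⟨u.base, hu⟩ * evalH0 Y (coordSection Y j) u = evalH0 Y s u := by
    intro u hu
    rw [← hg u hu, evalH0_coordSection, div_mul_cancel₀ _ ((hmem u).1 hu)]
  have hreg : IsRegular V g := (isRegular_iff hg).2 fun x hx => by
    obtain ⟨u, rfl⟩ := Cone.exists_base x
    exact isSecAt_div_coord s ((hmem u).1 hx)
  have hv : v.base ∈ ψ.preimage V := by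
    change ψ.toHomeomorph v.base ∈ V
    rw [h]
    exact (hmem w).2 hw
  have e1 := θ.map_res ⊤ V le_top s ⟨v, hv⟩
  have e2 := θ.map_res ⊤ V le_top (coordSection Y j) ⟨v, hv⟩
  have e3 := θ.map_smul V g hreg ⟨_, (twist Y 0 1).res_mem ⊤ V le_top _ (coordSection Y j).2⟩
    ⟨v, hv⟩
  have e4 : (⟨_, (twist Y 0 1).smul_mem V g hreg _
      ((twist Y 0 1).res_mem ⊤ V le_top _ (coordSection Y j).2)⟩ : (twist Y 0 1).sections V) =
      ⟨_, (twist Y 0 1).res_mem ⊤ V le_top _ s.2⟩ := by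
    exact Subtype.ext (funext fun u => hgs u.1 u.2)
  rw [e4, e1, e2] at e3
  have e5 : g ⟨ψ.toHomeomorph v.base, hv⟩ = evalH0 Y s w / w.1.x j := by
    rw [hg w ((hmem w).2 hw)]
    congr 1
    exact Subtype.ext h
  have e6 : θ.onCone s v = evalH0 Y s w / w.1.x j * θ.onCone (coordSection Y j) v := by
    rw [← e5]
    exact e3
  rw [e6]
  field_simp

end ModuleIso

namespace ConeEquiv

variable {F G : BiPoly} {B : (Fin 2 × Fin 3 → ℂ) ≃ₗ[ℂ] (Fin 2 × Fin 3 → ℂ)}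

/-- The ratio of `θ` to the pullback along `χ` is a global function of weight 0, hence constant. It
is nonzero because `θ` is injective on a space of dimension 4. -/
theorem exists_onCone_eq (χ : ConeEquiv (zeroLocus G) (zeroLocus F) B) (D : ScrollData F)
    (E : ScrollData G)
    (θ : ModuleIso χ.varietyIso (twist (zeroLocus G) 0 1) (twist (zeroLocus F) 0 1)) :
    ∃ c : ℂ, c ≠ 0 ∧ ∀ s v, θ.onCone s v = c * evalH0 (zeroLocus F) s (χ.toFun v) := by
  have hj : ∀ v, ∃ j, (χ.toFun v).1.x j ≠ 0 := fun v => Function.ne_iff.1 (χ.toFun v).1.x_ne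
  choose j hj using hj
  let u : Cone (zeroLocus G) → ℂ := fun v =>
    θ.onCone (coordSection _ (j v)) v / (χ.toFun v).1.x (j v)
  have hu : ∀ s v, θ.onCone s v = u v * evalH0 (zeroLocus F) s (χ.toFun v) := by
    intro s v
    have := θ.onCone_mul s (j v) (χ.varietyIso_base v) (hj v)
    change _ = _ / _ * _
    rw [div_mul_eq_mul_div, eq_div_iff (hj v), this, mul_comm]
  have hsec : ∀ x, IsSecAt 0 x u := by
    intro x
    obtain ⟨v, rfl⟩ := Cone.exists_base x
    have h1 := χ.isConeMap.x v.base (j v)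
    obtain ⟨W, hvW, hW⟩ := h1.exists_ne_zero (hj v)
    have h2 := ((θ.isSecAt_onCone (coordSection _ (j v)) v.base).div h1 (hj v)).congr W hvW
      (g := u) fun w hw => by
        rw [hu, evalH0_coordSection, mul_div_cancel_right₀ _ (hW w hw)]
    simpa using h2
  obtain ⟨c, hc⟩ := E.const_of_isSecAt_zero hsec
  refine ⟨c, ?_, fun s v => by rw [hu, hc]⟩
  rintro rfl
  have : ∀ s : H0 (zeroLocus F), s = 0 := by
    intro s
    have h0 : ∀ v, θ.onCone s v = 0 := fun v => by rw [hu, hc, zero_mul]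
    exact (θ.equiv ⊤).map_eq_zero_iff.1 (Subtype.ext (funext fun v => h0 v.1))
  have h4 := D.finrank_H0
  have : Subsingleton (H0 (zeroLocus F)) := ⟨fun s t => by rw [this s, this t]⟩
  rw [Module.finrank_zero_of_subsingleton] at h4
  omega

end ConeEquiv

/-! ### Hyperplanes of sections and their Segre products -/

/-- An injective map has surjective dual, and `W` is its own bidual. -/
theorem exists_apply_eq_of_injective {V W : Type*} [AddCommGroup V] [Module ℂ V]
    [AddCommGroup W] [Module ℂ W] [FiniteDimensional ℂ W] {f : V →ₗ[ℂ] Module.Dual ℂ W}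
    (hf : Function.Injective f) (p : Module.Dual ℂ V) : ∃ y, ∀ s, f s y = p s := by
  obtain ⟨φ, hφ⟩ := LinearMap.dualMap_surjective_of_injective hf p
  obtain ⟨y, rfl⟩ := (Module.evalEquiv ℂ W).surjective φ
  exact ⟨y, fun s => LinearMap.congr_fun hφ s⟩

theorem exists_tensor_of_minors {w : Fin 2 × Fin 3 → ℂ}
    (h : ∀ j k, w (0, j) * w (1, k) = w (0, k) * w (1, j)) : ∃ z x, w = tensor z x := by
  by_cases h0 : (fun j => w (0, j)) = 0
  · refine ⟨![0, 1], fun j => w (1, j), funext fun p => ?_⟩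
    obtain ⟨i, j⟩ := p
    fin_cases i
    · simpa [tensor] using congrFun h0 j
    · simp [tensor]
  · obtain ⟨c, hc⟩ := exists_smul_of_minors h0 (y := fun j => w (1, j)) h
    refine ⟨![1, c], fun j => w (0, j), funext fun p => ?_⟩
    obtain ⟨i, j⟩ := p
    fin_cases i
    · simp [tensor]
    · simpa [tensor] using congrFun hc j

theorem mk_mem_range_segre {A : (Fin 2 × Fin 3 → ℂ) ≃ₗ[ℂ] (Fin 6 → ℂ)} {y : Fin 6 → ℂ}
    (hy : y ≠ 0) : Projectivization.mk ℂ y hy ∈ Set.range (segre A) ↔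
      ∃ z x, A (tensor z x) = y := by
  constructor
  · rintro ⟨p, hp⟩
    obtain ⟨v, rfl⟩ := Vec.exists_point p
    rw [segre_point, Projectivization.mk_eq_mk_iff'] at hp
    obtain ⟨c, hc⟩ := hp
    have hc0 : c ≠ 0 := by
      rintro rfl
      rw [zero_smul] at hc
      exact A.map_ne_zero_iff.2 (tensor_ne_zero v.z_ne v.x_ne) hc.symm
    refine ⟨c⁻¹ • v.z, v.x, ?_⟩
    rw [tensor_smul_left, map_smul, ← hc, inv_smul_smul₀ hc0]
  · rintro ⟨z, x, rfl⟩
    have hz : z ≠ 0 := by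
      rintro rfl
      exact hy (by rw [← map_zero A]; congr 1; ext; simp [tensor])
    have hx : x ≠ 0 := by
      rintro rfl
      exact hy (by rw [← map_zero A]; congr 1; ext; simp [tensor])
    exact ⟨Vec.point ⟨z, x, hz, hx⟩, segre_point A ⟨z, x, hz, hx⟩⟩

namespace ScrollData

variable {F : BiPoly} (D : ScrollData F)

/-- The quadric `r₀(s) r₁(t) - r₀(t) r₁(s)`, where `rᵢ(s)` is the bilinear form which agrees
with `zᵢ s` on the cone. -/
noncomputable def minor (s t : H0 (zeroLocus F)) (y : Fin 2 × Fin 3 → ℂ) : ℂ :=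
  D.mulZ 0 s y * D.mulZ 1 t y - D.mulZ 0 t y * D.mulZ 1 s y

/-- The common zeros of the quadrics defined by the sections in the kernel of `p`. -/
def minorLocus (p : Module.Dual ℂ (H0 (zeroLocus F))) : Set (Fin 2 × Fin 3 → ℂ) :=
  {y | ∀ s t, p s = 0 → p t = 0 → D.minor s t y = 0}

/-- For `s` in the kernel of `p`, the pair `(r₀(s), r₁(s))` at `y` is proportional to `z`; two such
pairs have vanishing determinant. -/
theorem mem_minorLocus_of_wedge {p : Module.Dual ℂ (H0 (zeroLocus F))} {z : Fin 2 → ℂ}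
    (hz : z ≠ 0) {y : Fin 2 × Fin 3 → ℂ}
    (hy : ∀ s, z 1 * D.mulZ 0 s y - z 0 * D.mulZ 1 s y = p s) : y ∈ D.minorLocus p := by
  intro s t hs ht
  have h1 := (hy s).trans hs
  have h2 := (hy t).trans ht
  obtain ⟨i, hi⟩ := Function.ne_iff.1 hz
  have hi' : z i ≠ 0 := hi
  refine (mul_eq_zero.1 ?_).resolve_left hi'
  rw [minor]
  fin_cases i <;> simp only [Fin.zero_eta, Fin.mk_one]
  · linear_combination D.mulZ 0 t y * h1 - D.mulZ 0 s y * h2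
  · linear_combination D.mulZ 1 t y * h1 - D.mulZ 1 s y * h2

/-- For `v` on the cone choose `y` with `z₁ r₀(s)(y) - z₀ r₁(s)(y) = p(s)` for all `s`. Both `y` and
`y + z ⊗ x` lie in the locus of `p`. The minor of `s`, `t` increases between them by `t(v) p(s) -
s(v) p(t)`, so `t(v) p(s) = 0`. -/
theorem eq_zero_of_minorLocus_subset {p p' : Module.Dual ℂ (H0 (zeroLocus F))}
    (h : D.minorLocus p ⊆ D.minorLocus p') {s t : H0 (zeroLocus F)} (hs : p' s = 0)
    (hs' : p s ≠ 0) (ht : p t = 0) (ht' : p' t = 0) : t = 0 := by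
  refine evalH0_injective _ (funext fun v => ?_)
  obtain ⟨y, hy⟩ := exists_apply_eq_of_injective (D.mulZ_wedge_injective v.1.z_ne) p
  simp only [LinearMap.sub_apply, LinearMap.smul_apply, smul_eq_mul] at hy
  have h1 := h (D.mem_minorLocus_of_wedge v.1.z_ne hy) s t hs ht'
  have h2 := h (D.mem_minorLocus_of_wedge v.1.z_ne (y := y + tensor v.1.z v.1.x) fun s => by
    rw [map_add, map_add, D.mulZ_tensor, D.mulZ_tensor, ← hy]; ring) s t hs ht'
  simp only [minor, map_add, D.mulZ_tensor] at h1 h2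
  have h3 := hy s
  have h4 := (hy t).trans ht
  rw [map_zero]
  refine (mul_eq_zero.1 ?_).resolve_left hs'
  linear_combination h2 - h1 + evalH0 _ s v * h4 - evalH0 _ t v * h3

theorem exists_smul_of_minorLocus_subset {p p' : Module.Dual ℂ (H0 (zeroLocus F))}
    (h : D.minorLocus p ⊆ D.minorLocus p') (hp' : p' ≠ 0) : ∃ c : ℂ, p = c • p' := by
  have hfin := D.finiteDimensional_H0
  have hle : ∀ s, p' s = 0 → p s = 0 := by
    intro s hs
    by_contra hs'
    -- Two linear conditions on a space of dimension 4 leave a nonzero `t`.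
    obtain ⟨t, ht, ht0⟩ := (p.prod p').ker.exists_mem_ne_zero_of_ne_bot
      ((p.prod p').ker_ne_bot_of_finrank_lt (by
        rw [D.finrank_H0, Module.finrank_prod, Module.finrank_self]; norm_num))
    exact ht0 (D.eq_zero_of_minorLocus_subset h hs hs' (congrArg Prod.fst ht)
      (congrArg Prod.snd ht))
  obtain ⟨u, hu⟩ : ∃ u, p' u ≠ 0 := by
    by_contra! hc
    exact hp' (LinearMap.ext hc)
  refine ⟨p u / p' u, LinearMap.ext fun s => ?_⟩
  have := hle (p' u • s - p' s • u) (by simp [mul_comm])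
  rw [map_sub, map_smul, map_smul, smul_eq_mul, smul_eq_mul] at this
  rw [LinearMap.smul_apply, smul_eq_mul, div_mul_eq_mul_div, eq_div_iff hu]
  linear_combination this

/-- The three sections `h` of `𝒪(0, 1)` are, up to a change of coordinates of `ℙ¹`, those which
the presentation `A` of a Segre product induces. -/
def IsFrame (A A₀ : (Fin 2 × Fin 3 → ℂ) ≃ₗ[ℂ] (Fin 6 → ℂ)) (h : Fin 3 → H0 (zeroLocus F)) :
    Prop :=
  ∃ M : (Fin 2 → ℂ) ≃ₗ[ℂ] (Fin 2 → ℂ), ∀ y i j,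
    D.mulZ i (h j) y = M (fun k => A.symm (A₀ y) (k, j)) i

variable {D} {A A₀ : (Fin 2 × Fin 3 → ℂ) ≃ₗ[ℂ] (Fin 6 → ℂ)} {h : Fin 3 → H0 (zeroLocus F)}

theorem IsFrame.exists_mulZ_eq (hh : D.IsFrame A A₀ h) {z : Fin 2 → ℂ} (hz : z ≠ 0) :
    ∃ w : Fin 2 → ℂ, w ≠ 0 ∧ ∀ x y, A (tensor z x) = A₀ y → ∀ i j,
      D.mulZ i (h j) y = w i * x j := by
  obtain ⟨M, hM⟩ := hh
  refine ⟨M z, M.map_ne_zero_iff.2 hz, fun x y hy i j => ?_⟩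
  have : (fun k => A.symm (A₀ y) (k, j)) = x j • z := by
    rw [← hy, LinearEquiv.symm_apply_apply]
    ext k
    simp [tensor, mul_comm]
  rw [hM, this, map_smul, Pi.smul_apply, smul_eq_mul, mul_comm]

theorem IsFrame.eq_zero (hh : D.IsFrame A A₀ h) {y : Fin 2 × Fin 3 → ℂ}
    (hy : ∀ i j, D.mulZ i (h j) y = 0) : y = 0 := by
  obtain ⟨M, hM⟩ := hh
  have : ∀ j, (fun k => A.symm (A₀ y) (k, j)) = 0 := fun j =>
    M.map_eq_zero_iff.1 (funext fun i => (hM y i j).symm.trans (hy i j))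
  have h0 : A.symm (A₀ y) = 0 := funext fun p => congrFun (this p.2) p.1
  exact A₀.map_eq_zero_iff.1 (A.symm.map_eq_zero_iff.1 h0)

theorem IsFrame.linearIndependent (hh : D.IsFrame A A₀ h) : LinearIndependent ℂ h := by
  refine Fintype.linearIndependent_iff.2 fun c hc j => ?_
  obtain ⟨w, hw, H⟩ := hh.exists_mulZ_eq (z := ![1, 0]) fun h => by simpa using congrFun h 0
  obtain ⟨i, hi⟩ := Function.ne_iff.1 hw
  have hi' : w i ≠ 0 := hi
  have := congrArg (fun s => D.mulZ i s (A₀.symm (A (tensor ![1, 0] (Pi.single j 1))))) hc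
  simp only [map_sum, map_smul, LinearMap.sum_apply, LinearMap.smul_apply, map_zero,
    LinearMap.zero_apply] at this
  rw [Finset.sum_congr rfl fun k _ => by
    rw [H (Pi.single j 1) _ (A₀.apply_symm_apply _).symm]] at this
  simpa [Pi.single_apply, hi'] using this

/-- On the plane of the Segre product over `[z]` all columns `(r₀(s), r₁(s))` with `s` in the span
are multiples of one vector `w`, so the minors vanish. Conversely, vanishing minors of the frame
give a rank-one matrix, and undoing `M` recovers a decomposable tensor. -/
theorem IsFrame.mk_mem_range_segre_iff (hh : D.IsFrame A A₀ h)
    {p : Module.Dual ℂ (H0 (zeroLocus F))}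
    (hp : ∀ s, p s = 0 ↔ s ∈ Submodule.span ℂ (Set.range h)) {y : Fin 6 → ℂ} (hy : y ≠ 0) :
    Projectivization.mk ℂ y hy ∈ Set.range (segre A) ↔ A₀.symm y ∈ D.minorLocus p := by
  rw [mk_mem_range_segre]
  constructor
  · rintro ⟨z, x, rfl⟩ s t hs ht
    have hz : z ≠ 0 := by
      rintro rfl
      exact hy (by rw [← map_zero A]; congr 1; ext; simp [tensor])
    obtain ⟨w, -, H⟩ := hh.exists_mulZ_eq hz
    replace H := H x _ (A₀.apply_symm_apply _).symm
    have key : ∀ s, p s = 0 → ∃ c : ℂ, ∀ i, D.mulZ i s (A₀.symm (A (tensor z x))) = w i * c := by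
      intro s hs
      rw [hp] at hs
      induction hs using Submodule.span_induction with
      | mem s hs =>
        obtain ⟨j, rfl⟩ := hs
        exact ⟨x j, fun i => H i j⟩
      | zero => exact ⟨0, fun i => by simp⟩
      | add s t _ _ hs ht =>
        obtain ⟨c, hc⟩ := hs
        obtain ⟨d, hd⟩ := ht
        exact ⟨c + d, fun i => by rw [map_add, LinearMap.add_apply, hc, hd, mul_add]⟩
      | smul a s _ hs =>
        obtain ⟨c, hc⟩ := hs
        exact ⟨a * c, fun i => by
          rw [map_smul, LinearMap.smul_apply, hc, smul_eq_mul, mul_left_comm]⟩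
    obtain ⟨c, hc⟩ := key s hs
    obtain ⟨d, hd⟩ := key t ht
    rw [minor, hc, hc, hd, hd]
    ring
  · intro H
    obtain ⟨M, hM⟩ := hh
    have hker : ∀ j, p (h j) = 0 := fun j => (hp _).2 (Submodule.subset_span ⟨j, rfl⟩)
    obtain ⟨z, x, hzx⟩ := exists_tensor_of_minors (w := fun q => D.mulZ q.1 (h q.2) (A₀.symm y))
      fun j k => sub_eq_zero.1 (H (h j) (h k) (hker j) (hker k))
    refine ⟨M.symm z, x, ?_⟩
    rw [← LinearEquiv.eq_symm_apply]
    ext q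
    have e1 : (fun k => A.symm y (k, q.2)) = x q.2 • M.symm z := by
      rw [← map_smul, LinearEquiv.eq_symm_apply]
      ext i
      have := (hM (A₀.symm y) i q.2).symm.trans (congrFun hzx (i, q.2))
      rw [LinearEquiv.apply_symm_apply] at this
      rw [this, Pi.smul_apply, smul_eq_mul, tensor, mul_comm]
    have := congrFun e1 q.1
    rw [this, Pi.smul_apply, smul_eq_mul, tensor, mul_comm]

/-- The frame spans a subspace of dimension 3 in a space of dimension 4. -/
theorem IsFrame.exists_dual (hh : D.IsFrame A A₀ h) :
    ∃ p : Module.Dual ℂ (H0 (zeroLocus F)), p ≠ 0 ∧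
      ∀ s, p s = 0 ↔ s ∈ Submodule.span ℂ (Set.range h) := by
  have hfin := D.finiteDimensional_H0
  have h3 := finrank_span_eq_card hh.linearIndependent
  rw [Fintype.card_fin] at h3
  have h4 := D.finrank_H0
  obtain ⟨p, hp0, hp⟩ := Submodule.exists_le_ker_of_lt_top (Submodule.span ℂ (Set.range h))
    (lt_top_iff_ne_top.2 fun e => by rw [e, finrank_top] at h3; omega)
  refine ⟨p, hp0, fun s => ?_⟩
  have hk := Module.Dual.finrank_ker_add_one_of_ne_zero hp0
  rw [Submodule.eq_of_le_of_finrank_le hp (by omega)]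
  rfl

end ScrollData

namespace ConeEquiv

variable {F G : BiPoly} {A A₀ : (Fin 2 × Fin 3 → ℂ) ≃ₗ[ℂ] (Fin 6 → ℂ)}
  (χ : ConeEquiv (zeroLocus G) (zeroLocus F) (A.trans A₀.symm))

/-- The sections of `𝒪(0, 1)` on the target which are the coordinates `xⱼ` of the source. -/
noncomputable def frame (j : Fin 3) : H0 (zeroLocus F) :=
  (exists_evalH0_eq fun x => χ.symm.isConeMap.x x j).choose

theorem evalH0_frame (j : Fin 3) (w : Cone (zeroLocus F)) :
    evalH0 _ (χ.frame j) w = (χ.invFun w).1.x j :=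
  congrFun (exists_evalH0_eq fun x => χ.symm.isConeMap.x x j).choose_spec w

/-- Both sides are bilinear forms, so it is enough to compare them on the cone over `R`, where both
equal `zᵢ` times the coordinate `xⱼ` of the source. -/
theorem isFrame (D : ScrollData F) : D.IsFrame A A₀ χ.frame := by
  refine ⟨χ.M, fun y i j => ?_⟩
  have := D.mulZ_eq_of_tensor (i := i) (s := χ.frame j)
    (β := LinearMap.proj i ∘ₗ χ.M.toLinearMap ∘ₗ (LinearMap.pi fun k => LinearMap.proj (k, j)) ∘ₗ
      A.symm.toLinearMap ∘ₗ A₀.toLinearMap) fun w => by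
    have e : A.symm (A₀ (tensor w.1.z w.1.x)) = tensor (χ.invFun w).1.z (χ.invFun w).1.x := by
      have := χ.symm.tensor_eq w
      exact this.symm
    have e2 : (fun k => A.symm (A₀ (tensor w.1.z w.1.x)) (k, j)) =
        (χ.invFun w).1.x j • (χ.invFun w).1.z := by
      rw [e]
      ext k
      simp [tensor, mul_comm]
    change χ.M (fun k => A.symm (A₀ (tensor w.1.z w.1.x)) (k, j)) i = _
    rw [e2, map_smul, ← χ.z_eq, χ.right_inv, evalH0_frame, Pi.smul_apply, smul_eq_mul, mul_comm]
  rw [this]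
  rfl

/-- Up to a constant `θ` is the pullback along `χ`, under which the frame goes to the coordinates
`xⱼ`; these span the restricted sections. -/
theorem isRestriction_iff (D : ScrollData F) (E : ScrollData G)
    (θ : ModuleIso χ.varietyIso (twist (zeroLocus G) 0 1) (twist (zeroLocus F) 0 1))
    (s : H0 (zeroLocus F)) :
    IsRestriction (θ.equiv ⊤ s) ↔ s ∈ Submodule.span ℂ (Set.range χ.frame) := by
  obtain ⟨c, hc, hθ⟩ := χ.exists_onCone_eq D E θ
  have hU : ∀ v : Cone (zeroLocus G), v.base ∈ χ.varietyIso.preimage ⊤ := fun _ => trivial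
  refine (SegreScroll.isRestriction_iff (f := θ.onCone s) hU fun _ => rfl).trans ?_
  rw [Submodule.mem_span_range_iff_exists_fun]
  constructor
  · rintro ⟨a, ha⟩
    refine ⟨fun j => c⁻¹ * a j, evalH0_injective _ (funext fun w => ?_)⟩
    have := (hθ s (χ.invFun w)).symm.trans (ha _)
    rw [χ.right_inv] at this
    rw [← mul_right_inj' hc, this]
    simp only [map_sum, map_smul, Finset.sum_apply, Pi.smul_apply, evalH0_frame, smul_eq_mul,
      Finset.mul_sum]
    exact Finset.sum_congr rfl fun j _ => by rw [mul_assoc, mul_inv_cancel_left₀ hc]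
  · rintro ⟨a, rfl⟩
    refine ⟨fun j => c * a j, fun v => ?_⟩
    rw [hθ]
    simp only [map_sum, map_smul, Finset.sum_apply, Pi.smul_apply, evalH0_frame, smul_eq_mul,
      Finset.mul_sum, χ.left_inv]
    exact Finset.sum_congr rfl fun j _ => by ring

end ConeEquiv

/-! ### Construction of the Segre product of a hyperplane -/

theorem binForm_mul {m n : ℕ} {g h : Polynomial ℂ} (hg : g.natDegree ≤ m) (hh : h.natDegree ≤ n)
    (z : Fin 2 → ℂ) : binForm (m + n) z (g * h) = binForm m z g * binForm n z h := by
  by_cases hz : z 0 = 0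
  · have key : ∀ (l : ℕ) (c : Polynomial ℂ), binForm l z c = c.coeff l * z 1 ^ l := by
      intro l c
      rw [binForm_apply, Finset.sum_range_succ, Finset.sum_eq_zero fun i hi => ?_]
      · simp
      · rw [hz, zero_pow (Nat.sub_ne_zero_of_lt (Finset.mem_range.1 hi)), zero_mul, mul_zero]
    rw [key, key, key, Polynomial.coeff_mul_add_eq_of_natDegree_le hg hh]
    ring
  · rw [vec_two_eq hz, binForm_smul, binForm_smul, binForm_smul, binForm_one_left hg,
      binForm_one_left hh, binForm_one_left (Polynomial.natDegree_mul_le.trans (by omega)),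
      Polynomial.eval_mul]
    ring

open Matrix in
theorem formVec_cross {m n : ℕ} {α β : Fin 3 → Polynomial ℂ} (hα : ∀ j, (α j).natDegree ≤ m)
    (hβ : ∀ j, (β j).natDegree ≤ n) (z : Fin 2 → ℂ) :
    formVec (m + n) z (crossProduct α β) = crossProduct (formVec m z α) (formVec n z β) := by
  ext j
  fin_cases j <;> simp [formVec, cross_apply, binForm_mul, hα, hβ]

/-- The polynomial of bidegree `(2, 1)` with given coefficients. -/
noncomputable def linPoly (q : Fin 3 → Polynomial ℂ) : BiPoly :=
  ∑ j, binPoly 2 (q j) * MvPolynomial.X (Sum.inr j)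

theorem isBihomogeneous_linPoly (q : Fin 3 → Polynomial ℂ) : IsBihomogeneous (linPoly q) (2, 1) :=
  IsBihomogeneous.sum fun j _ => (isBihomogeneous_binPoly 2 (q j)).mul (isBihomogeneous_X_inr j)

open Matrix in
theorem eval_linPoly (q : Fin 3 → Polynomial ℂ) (z : Fin 2 → ℂ) (x : Fin 3 → ℂ) :
    MvPolynomial.eval (Sum.elim z x) (linPoly q) = formVec 2 z q ⬝ᵥ x := by
  rw [linPoly, map_sum]
  simp [dotProduct, eval_binPoly, formVec]

theorem isSmooth_linPoly {q : Fin 3 → Polynomial ℂ} (hq : ∀ z, z ≠ 0 → formVec 2 z q ≠ 0) :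
    IsSmooth (linPoly q) := by
  intro v _
  obtain ⟨j, hj⟩ := Function.ne_iff.1 (hq v.z v.z_ne)
  refine ⟨Sum.inr j, ?_⟩
  rw [Vec.eval, (eval_pderiv_inl_of_eval_eq (eval_linPoly q) v.z).2 j v.x]
  exact hj

namespace ScrollData

variable {F : BiPoly} (D : ScrollData F)

/-- The bilinear forms defined by the sections in the kernel of `p` have no common zero. -/
def IsNondegenerate (p : Module.Dual ℂ (H0 (zeroLocus F))) : Prop :=
  ∀ y, (∀ i s, p s = 0 → D.mulZ i s y = 0) → y = 0

theorem IsFrame.isNondegenerate {D : ScrollData F}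
    {A A₀ : (Fin 2 × Fin 3 → ℂ) ≃ₗ[ℂ] (Fin 6 → ℂ)} {h : Fin 3 → H0 (zeroLocus F)}
    (hh : D.IsFrame A A₀ h) {p : Module.Dual ℂ (H0 (zeroLocus F))} (hp : ∀ j, p (h j) = 0) :
    D.IsNondegenerate p := fun _ hy => hh.eq_zero fun i j => hy i (h j) (hp j)

theorem exists_basis_ker {F : BiPoly} (D : ScrollData F)
    {p : Module.Dual ℂ (H0 (zeroLocus F))} (hp : p ≠ 0) :
    ∃ h : Fin 3 → H0 (zeroLocus F), ∀ s, p s = 0 ↔ s ∈ Submodule.span ℂ (Set.range h) := by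
  have hfin := D.finiteDimensional_H0
  have h4 := D.finrank_H0
  have hk := Module.Dual.finrank_ker_add_one_of_ne_zero hp
  have hfree : Module.Free ℂ p.ker := Module.Free.of_divisionRing ℂ p.ker
  let b := Module.finBasisOfFinrankEq ℂ p.ker (by omega : Module.finrank ℂ p.ker = 3)
  refine ⟨fun j => (b j : H0 (zeroLocus F)), fun s => ?_⟩
  have : Submodule.span ℂ (Set.range fun j => (b j : H0 (zeroLocus F))) = p.ker := by
    have := congrArg (Submodule.map p.ker.subtype) b.span_eq
    rw [Submodule.map_span, Submodule.map_top, Submodule.range_subtype, ← Set.range_comp] at this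
    exact this
  rw [this]
  rfl

open Matrix in
-- Nondegeneracy makes `L = (rᵢ(hⱼ))` invertible, and `A = A₀ ∘ L⁻¹`. On the cone `L (z ⊗ x) = z ⊗
-- (h₀, h₁, h₂)` with `hⱼ = S αⱼ + T βⱼ`. So in the new coordinates the surface is the scroll of
-- `α`, `β`, whose equation is `(α × β) · x = 0`.
theorem exists_presentation (A₀ : (Fin 2 × Fin 3 → ℂ) ≃ₗ[ℂ] (Fin 6 → ℂ))
    {p : Module.Dual ℂ (H0 (zeroLocus F))} (hp : p ≠ 0) (hnd : D.IsNondegenerate p) :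
    ∃ A G h, IsPresentation (segre A₀ '' zeroLocus F) (Set.range (segre A)) A G ∧
      D.IsFrame A A₀ h ∧ ∀ s, p s = 0 ↔ s ∈ Submodule.span ℂ (Set.range h) := by
  obtain ⟨h, hh⟩ := D.exists_basis_ker hp
  let L₀ : (Fin 2 × Fin 3 → ℂ) →ₗ[ℂ] (Fin 2 × Fin 3 → ℂ) :=
    LinearMap.pi fun q => D.mulZ q.1 (h q.2)
  have hL₀ : Function.Injective L₀ := by
    refine (injective_iff_map_eq_zero _).2 fun y hy => hnd y fun i s hs => ?_
    rw [hh] at hs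
    induction hs using Submodule.span_induction with
    | mem s hs =>
      obtain ⟨j, rfl⟩ := hs
      exact congrFun hy (i, j)
    | zero => simp
    | add s t _ _ hs ht => rw [map_add, LinearMap.add_apply, hs, ht, add_zero]
    | smul a s _ hs => rw [map_smul, LinearMap.smul_apply, hs, smul_zero]
  let L := LinearEquiv.ofInjectiveEndo L₀ hL₀
  have hL : ∀ y q, L y q = D.mulZ q.1 (h q.2) y := fun _ _ => rfl
  choose P hP1 hP2 hP using fun j => D.exists_form_eq (isSecAt_evalH0 (h j))
  let α : Fin 3 → Polynomial ℂ := fun j => (P j).1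
  let β : Fin 3 → Polynomial ℂ := fun j => (P j).2
  have hcone : ∀ v : Cone (zeroLocus F), L (tensor v.1.z v.1.x) = tensor v.1.z
      (D.coord v 0 • formVec D.a v.1.z α + D.coord v 1 • formVec D.b v.1.z β) := by
    intro v
    ext q
    rw [hL, D.mulZ_tensor, hP, form_apply]
    rfl
  have hcross : ∀ z, formVec 2 z (crossProduct α β) =
      crossProduct (formVec D.a z α) (formVec D.b z β) := by
    intro z
    rw [← formVec_cross hP1 hP2, D.add_eq]
  have hzero : ∀ z : Fin 2 → ℂ, tensor z 0 = 0 := fun z => by ext; simp [tensor]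
  -- Injectivity of `L` keeps `α(z)`, `β(z)` independent, so the new equation has no zero in `z` and
  -- is smooth.
  have hcomb : ∀ z, z ≠ 0 → ∀ w : Fin 2 → ℂ, w ≠ 0 →
      w 0 • formVec D.a z α + w 1 • formVec D.b z β ≠ 0 := by
    intro z hz w hw h0
    have := hcone (D.conePoint z hz w hw)
    rw [coord_conePoint] at this
    refine L.map_ne_zero_iff.2 (tensor_ne_zero (D.conePoint z hz w hw).1.z_ne
      (D.conePoint z hz w hw).1.x_ne) (this.trans ?_)
    have e : (D.conePoint z hz w hw).1.z = z := rfl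
    rw [e, h0, hzero]
  have hq : ∀ z, z ≠ 0 → formVec 2 z (crossProduct α β) ≠ 0 := by
    intro z hz h0
    rw [hcross] at h0
    have hα : formVec D.a z α ≠ 0 := fun h' =>
      hcomb z hz ![1, 0] (fun h => by simpa using congrFun h 0) (by simp [h'])
    obtain ⟨c, hc⟩ := exists_smul_of_cross_eq_zero hα h0
    exact hcomb z hz ![c, -1] (fun h => by simpa using congrFun h 1) (by simp [hc])
  have hA : ∀ y, (L.symm.trans A₀) (L y) = A₀ y := fun y => by simp
  refine ⟨L.symm.trans A₀, linPoly (crossProduct α β), h, ⟨rfl, isBihomogeneous_linPoly _,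
    isSmooth_linPoly hq, ?_⟩, ⟨LinearEquiv.refl ℂ _, fun y i j => ?_⟩, hh⟩
  · refine Set.Subset.antisymm ?_ ?_
    · rintro _ ⟨_, hv, rfl⟩
      obtain ⟨v, rfl⟩ := Vec.exists_point ‹_›
      rw [point_mem_zeroLocus (isBihomogeneous_linPoly _), Vec.eval, eval_linPoly] at hv
      obtain ⟨w, hw⟩ := exists_coord_of_cross (hcross v.z).symm (hq v.z v.z_ne) hv
      have hw0 : w ≠ 0 := by
        rintro rfl
        exact v.x_ne (by rw [hw]; simp)
      refine ⟨_, (D.conePoint v.z v.z_ne w hw0).2, ?_⟩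
      rw [segre_point, segre_point]
      congr 1
      have := hcone (D.conePoint v.z v.z_ne w hw0)
      rw [← hA, this, coord_conePoint, hw]
      rfl
    · rintro _ ⟨_, hv, rfl⟩
      obtain ⟨v, rfl⟩ := Vec.exists_point ‹_›
      have hx := hcomb v.z v.z_ne _ (D.coord_ne_zero ⟨v, hv⟩)
      refine ⟨Vec.point ⟨v.z, _, v.z_ne, hx⟩,
        (point_mem_zeroLocus (isBihomogeneous_linPoly _)).2 ?_, ?_⟩
      · rw [Vec.eval, eval_linPoly, hcross, dotProduct_add, dotProduct_smul, dotProduct_smul,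
          dotProduct_comm _ (formVec D.a v.z α), dotProduct_comm _ (formVec D.b v.z β)]
        simp
      · rw [segre_point, segre_point]
        congr 1
        have := hcone ⟨v, hv⟩
        rw [← hA, this]
  · rw [LinearEquiv.trans_symm, LinearEquiv.trans_apply, LinearEquiv.symm_apply_apply]
    rfl

end ScrollData

/-! ### Polynomial equations -/

theorem isHomogeneous_det {σ ι : Type*} [Fintype ι] [DecidableEq ι]
    {N : Matrix ι ι (MvPolynomial σ ℂ)} (hN : ∀ i j, (N i j).IsHomogeneous 1) :
    N.det.IsHomogeneous (Fintype.card ι) := by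
  rw [Matrix.det_apply]
  refine MvPolynomial.IsHomogeneous.sum _ _ _ fun π _ => ?_
  rw [Units.smul_def]
  refine (MvPolynomial.homogeneousSubmodule σ ℂ (Fintype.card ι)).smul_of_tower_mem
    ((Equiv.Perm.sign π : ℤˣ) : ℤ) ?_
  have := MvPolynomial.IsHomogeneous.prod Finset.univ (fun i => N (π i) i) (fun _ => 1)
    fun i _ => hN _ _
  simpa using this

namespace ScrollData

variable {F : BiPoly} (D : ScrollData F)

/-- The bilinear forms defined by the sections `p(u) hⱼ - p(hⱼ) u` in the kernel of `p`, as a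
matrix of linear forms in `p`. -/
noncomputable def kerMatrix (u : H0 (zeroLocus F)) (h : Fin 3 → H0 (zeroLocus F)) :
    Matrix (Fin 2 × Fin 3) (Fin 2 × Fin 3) (MvPolynomial (H0 (zeroLocus F)) ℂ) :=
  fun q l => MvPolynomial.C (D.mulZ q.1 (h q.2) (Pi.single l 1)) * MvPolynomial.X u -
    MvPolynomial.C (D.mulZ q.1 u (Pi.single l 1)) * MvPolynomial.X (h q.2)

theorem eval_det_kerMatrix (u : H0 (zeroLocus F)) (h : Fin 3 → H0 (zeroLocus F))
    (p : Module.Dual ℂ (H0 (zeroLocus F))) :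
    MvPolynomial.eval (fun s => p s) (D.kerMatrix u h).det =
      (Matrix.of fun q l : Fin 2 × Fin 3 =>
        D.mulZ q.1 (p u • h q.2 - p (h q.2) • u) (Pi.single l 1)).det := by
  have e : (MvPolynomial.eval fun s => p s).mapMatrix (D.kerMatrix u h) =
      Matrix.of fun q l : Fin 2 × Fin 3 =>
        D.mulZ q.1 (p u • h q.2 - p (h q.2) • u) (Pi.single l 1) := by
    ext q l
    rw [RingHom.mapMatrix_apply, Matrix.map_apply, kerMatrix, Matrix.of_apply, map_sub, map_mul,
      map_mul, MvPolynomial.eval_C, MvPolynomial.eval_C, MvPolynomial.eval_X, MvPolynomial.eval_X,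
      map_sub (D.mulZ q.1), map_smul, map_smul, LinearMap.sub_apply, LinearMap.smul_apply,
      LinearMap.smul_apply, smul_eq_mul, smul_eq_mul, mul_comm (p u), mul_comm (p (h q.2))]
  rw [RingHom.map_det, e]

theorem of_mulVec (γ : Fin 2 × Fin 3 → Module.Dual ℂ (Fin 2 × Fin 3 → ℂ))
    (y : Fin 2 × Fin 3 → ℂ) :
    (Matrix.of fun q l => γ q (Pi.single l 1)).mulVec y = fun q => γ q y := by
  ext q
  conv_rhs => rw [pi_eq_sum_univ' y]
  simp [Matrix.mulVec, dotProduct, mul_comm]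

/-- The sections `p(u) h - p(h) u` lie in the kernel of `p` for any `u`, `h`, and depend linearly on
`p`. If `p(u) ≠ 0` and `h` is a basis of the kernel, they are nonzero multiples of that basis. -/
theorem isNondegenerate_iff {F : BiPoly} (D : ScrollData F)
    {p : Module.Dual ℂ (H0 (zeroLocus F))} (hp : p ≠ 0) :
    D.IsNondegenerate p ↔
      ∃ u h, MvPolynomial.eval (fun s => p s) (D.kerMatrix u h).det ≠ 0 := by
  constructor
  · intro H
    obtain ⟨h, hh⟩ := D.exists_basis_ker hp
    obtain ⟨u, hu⟩ : ∃ u, p u ≠ 0 := by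
      by_contra! hc
      exact hp (LinearMap.ext hc)
    have hker : ∀ j, p (h j) = 0 := fun j => (hh _).2 (Submodule.subset_span ⟨j, rfl⟩)
    refine ⟨u, h, fun h0 => ?_⟩
    rw [eval_det_kerMatrix] at h0
    obtain ⟨y, hy, hy0⟩ := Matrix.exists_mulVec_eq_zero_iff.2 h0
    rw [of_mulVec] at hy0
    refine hy (H y fun i s hs => ?_)
    rw [hh] at hs
    induction hs using Submodule.span_induction with
    | mem s hs =>
      obtain ⟨j, rfl⟩ := hs
      have := congrFun hy0 (i, j)
      simpa [hker, hu] using this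
    | zero => simp
    | add s t _ _ hs ht => rw [map_add, LinearMap.add_apply, hs, ht, add_zero]
    | smul a s _ hs => rw [map_smul, LinearMap.smul_apply, hs, smul_zero]
  · rintro ⟨u, h, h0⟩ y hy
    rw [eval_det_kerMatrix] at h0
    refine Matrix.eq_zero_of_mulVec_eq_zero h0 ?_
    rw [of_mulVec]
    exact funext fun q => hy _ _ (by simp [mul_comm])

/-- The bilinear form defined by the section `p(u) s - p(s) u` in the kernel of `p`, as a
polynomial in `p` and in the coordinates of `ℙ⁵`. -/
noncomputable def kerForm (A₀ : (Fin 2 × Fin 3 → ℂ) ≃ₗ[ℂ] (Fin 6 → ℂ)) (i : Fin 2)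
    (u s : H0 (zeroLocus F)) : MvPolynomial (H0 (zeroLocus F) ⊕ Fin 6) ℂ :=
  ∑ l, (MvPolynomial.C (D.mulZ i s (A₀.symm (Pi.single l 1))) * MvPolynomial.X (Sum.inl u) -
    MvPolynomial.C (D.mulZ i u (A₀.symm (Pi.single l 1))) * MvPolynomial.X (Sum.inl s)) *
      MvPolynomial.X (Sum.inr l)

theorem isBihomogeneous_kerForm (A₀ : (Fin 2 × Fin 3 → ℂ) ≃ₗ[ℂ] (Fin 6 → ℂ)) (i : Fin 2)
    (u s : H0 (zeroLocus F)) : IsBihomogeneous (D.kerForm A₀ i u s) (1, 1) :=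
  IsBihomogeneous.sum fun l _ => (((isBihomogeneous_X_inl u).C_mul _).sub
    ((isBihomogeneous_X_inl s).C_mul _)).mul (isBihomogeneous_X_inr l)

theorem eval_kerForm (A₀ : (Fin 2 × Fin 3 → ℂ) ≃ₗ[ℂ] (Fin 6 → ℂ)) (i : Fin 2)
    (u s : H0 (zeroLocus F)) (p : Module.Dual ℂ (H0 (zeroLocus F))) (y : Fin 6 → ℂ) :
    MvPolynomial.eval (Sum.elim (fun s => p s) y) (D.kerForm A₀ i u s) =
      D.mulZ i (p u • s - p s • u) (A₀.symm y) := by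
  conv_rhs => rw [pi_eq_sum_univ' y]
  rw [kerForm, map_sum, map_sum, map_sum]
  refine Finset.sum_congr rfl fun l _ => ?_
  simp
  ring

/-- The quadric defined by the sections `p(u) s - p(s) u` and `p(u) t - p(t) u` in the kernel
of `p`, as a polynomial in `p` and in the coordinates of `ℙ⁵`. -/
noncomputable def minorPoly (A₀ : (Fin 2 × Fin 3 → ℂ) ≃ₗ[ℂ] (Fin 6 → ℂ))
    (u s t : H0 (zeroLocus F)) : MvPolynomial (H0 (zeroLocus F) ⊕ Fin 6) ℂ :=
  D.kerForm A₀ 0 u s * D.kerForm A₀ 1 u t - D.kerForm A₀ 0 u t * D.kerForm A₀ 1 u s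

theorem isBihomogeneous_minorPoly (A₀ : (Fin 2 × Fin 3 → ℂ) ≃ₗ[ℂ] (Fin 6 → ℂ))
    (u s t : H0 (zeroLocus F)) : IsBihomogeneous (D.minorPoly A₀ u s t) (2, 2) :=
  ((D.isBihomogeneous_kerForm A₀ 0 u s).mul (D.isBihomogeneous_kerForm A₀ 1 u t)).sub
    ((D.isBihomogeneous_kerForm A₀ 0 u t).mul (D.isBihomogeneous_kerForm A₀ 1 u s))

theorem mem_minorLocus_iff (A₀ : (Fin 2 × Fin 3 → ℂ) ≃ₗ[ℂ] (Fin 6 → ℂ))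
    {p : Module.Dual ℂ (H0 (zeroLocus F))} (hp : p ≠ 0) (y : Fin 6 → ℂ) :
    A₀.symm y ∈ D.minorLocus p ↔ ∀ u s t,
      MvPolynomial.eval (Sum.elim (fun s => p s) y) (D.minorPoly A₀ u s t) = 0 := by
  have e : ∀ u s t, MvPolynomial.eval (Sum.elim (fun s => p s) y) (D.minorPoly A₀ u s t) =
      D.minor (p u • s - p s • u) (p u • t - p t • u) (A₀.symm y) := by
    intro u s t
    simp only [minorPoly, minor, map_sub (MvPolynomial.eval _), map_mul, eval_kerForm]
  simp only [e]
  constructor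
  · intro H u s t
    exact H _ _ (by simp [mul_comm]) (by simp [mul_comm])
  · intro H s t hs ht
    obtain ⟨u, hu⟩ : ∃ u, p u ≠ 0 := by
      by_contra! hc
      exact hp (LinearMap.ext hc)
    have := H u s t
    rw [hs, ht, zero_smul, sub_zero, sub_zero] at this
    simp only [minor, map_smul, LinearMap.smul_apply, smul_eq_mul] at this
    refine (mul_eq_zero.1 ?_).resolve_left (mul_ne_zero hu hu)
    rw [minor]
    linear_combination this

/-! ### The hyperplane of a Segre product -/

/-- The kernel of `p` is the hyperplane of the sections restricted from the Segre
product `S`, in terms of equations of `S`. -/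
structure IsHyperplaneOf (A₀ : (Fin 2 × Fin 3 → ℂ) ≃ₗ[ℂ] (Fin 6 → ℂ)) (S : Set P5)
    (p : Module.Dual ℂ (H0 (zeroLocus F))) : Prop where
  ne_zero : p ≠ 0
  isNondegenerate : D.IsNondegenerate p
  mem_iff : ∀ y : P5, y ∈ S ↔ A₀.symm y.rep ∈ D.minorLocus p

variable {D} {A A₀ : (Fin 2 × Fin 3 → ℂ) ≃ₗ[ℂ] (Fin 6 → ℂ)}
  {p p' : Module.Dual ℂ (H0 (zeroLocus F))} {S : Set P5}

theorem IsFrame.isHyperplaneOf {h : Fin 3 → H0 (zeroLocus F)} (hh : D.IsFrame A A₀ h)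
    (hp0 : p ≠ 0) (hp : ∀ s, p s = 0 ↔ s ∈ Submodule.span ℂ (Set.range h)) :
    D.IsHyperplaneOf A₀ (Set.range (segre A)) p where
  ne_zero := hp0
  isNondegenerate := hh.isNondegenerate fun j => (hp _).2 (Submodule.subset_span ⟨j, rfl⟩)
  mem_iff y := by
    conv_lhs => rw [← y.mk_rep]
    exact hh.mk_mem_range_segre_iff hp y.rep_nonzero

theorem IsHyperplaneOf.smul (H : D.IsHyperplaneOf A₀ S p) {c : ℂ} (hc : c ≠ 0) :
    D.IsHyperplaneOf A₀ S (c • p) := by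
  have e : ∀ s, (c • p) s = 0 ↔ p s = 0 := fun s => by simp [hc]
  refine ⟨smul_ne_zero hc H.ne_zero, fun y hy => H.isNondegenerate y fun i s hs =>
    hy i s ((e s).2 hs), fun y => (H.mem_iff y).trans ?_⟩
  exact forall₂_congr fun s t => by rw [e, e]

theorem IsHyperplaneOf.rep_mk (H : D.IsHyperplaneOf A₀ S p) :
    D.IsHyperplaneOf A₀ S (Projectivization.mk ℂ p H.ne_zero).rep := by
  obtain ⟨c, hc⟩ := Projectivization.exists_smul_eq_mk_rep ℂ p H.ne_zero
  rw [← hc]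
  exact H.smul c.ne_zero

/-- A common `S` forces the loci of the minors to agree at all nonzero vectors, the minors being
homogeneous of degree 2; at zero they vanish anyway. -/
theorem IsHyperplaneOf.exists_smul_eq (H : D.IsHyperplaneOf A₀ S p)
    (H' : D.IsHyperplaneOf A₀ S p') : ∃ c : ℂ, c ≠ 0 ∧ c • p' = p := by
  suffices h : D.minorLocus p ⊆ D.minorLocus p' by
    obtain ⟨c, hc⟩ := D.exists_smul_of_minorLocus_subset h H'.ne_zero
    refine ⟨c, ?_, hc.symm⟩
    rintro rfl
    exact H.ne_zero (by rw [hc, zero_smul])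
  intro w hw
  by_cases h0 : w = 0
  · intro s t _ _
    simp [minor, h0]
  have hy : A₀ w ≠ 0 := A₀.map_ne_zero_iff.2 h0
  have hrep : ∃ c : ℂ, c ≠ 0 ∧ A₀.symm (Projectivization.mk ℂ (A₀ w) hy).rep = c • w := by
    obtain ⟨c, hc⟩ := Projectivization.exists_smul_eq_mk_rep ℂ (A₀ w) hy
    refine ⟨c, c.ne_zero, ?_⟩
    rw [← hc, Units.smul_def, map_smul, A₀.symm_apply_apply]
  obtain ⟨c, hc, e⟩ := hrep
  have hm : ∀ s t, D.minor s t (c • w) = c ^ 2 * D.minor s t w := fun s t => by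
    simp only [minor, map_smul, smul_eq_mul]; ring
  have hmem := (H'.mem_iff (Projectivization.mk ℂ (A₀ w) hy)).1 ((H.mem_iff _).2 (by
    rw [e]
    intro s t hs ht
    rw [hm, hw s t hs ht, mul_zero]))
  rw [e] at hmem
  intro s t hs ht
  have := hmem s t hs ht
  rw [hm] at this
  exact (mul_eq_zero.1 this).resolve_left (pow_ne_zero 2 hc)

/-- A presentation of a Segre product containing the surface, together with the resulting
isomorphism of cones and hyperplane. -/
theorem exists_of_isPresentation {F G : BiPoly} (D : ScrollData F)
    {A A₀ : (Fin 2 × Fin 3 → ℂ) ≃ₗ[ℂ] (Fin 6 → ℂ)} {S : Set P5}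
    (hP : IsPresentation (segre A₀ '' zeroLocus F) S A G) :
    ∃ (_ : ScrollData G) (χ : ConeEquiv (zeroLocus G) (zeroLocus F) (A.trans A₀.symm))
      (p : Module.Dual ℂ (H0 (zeroLocus F))), D.IsHyperplaneOf A₀ S p ∧
        ∀ s, p s = 0 ↔ s ∈ Submodule.span ℂ (Set.range χ.frame) := by
  obtain ⟨rfl, hG, hs, h⟩ := hP
  obtain ⟨E⟩ := hs.nonempty_scrollData hG
  obtain ⟨χ⟩ := D.nonempty_coneEquiv_of_segre E h
  obtain ⟨p, hp0, hp⟩ := (χ.isFrame D).exists_dual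
  exact ⟨E, χ, p, (χ.isFrame D).isHyperplaneOf hp0 hp, hp⟩

/-- The hyperplane of a Segre product containing the surface. -/
theorem exists_isHyperplaneOf {F : BiPoly} (D : ScrollData F)
    {A₀ : (Fin 2 × Fin 3 → ℂ) ≃ₗ[ℂ] (Fin 6 → ℂ)}
    (S : SegreProductsContaining (segre A₀ '' zeroLocus F)) :
    ∃ p : DualSystem (zeroLocus F), D.IsHyperplaneOf A₀ S p.rep := by
  obtain ⟨A, G, hP⟩ := S.2
  obtain ⟨-, -, p, hp, -⟩ := D.exists_of_isPresentation hP
  exact ⟨_, hp.rep_mk⟩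

end ScrollData

end SegreScroll

/-! ### The theorem -/

theorem mainTheorem7
    (F : BiPoly) (hF : IsBihomogeneous F (2, 1)) (hsmooth : IsSmooth F) (hirr : Irreducible F)
    (A₀ : (Fin 2 × Fin 3 → ℂ) ≃ₗ[ℂ] (Fin 6 → ℂ)) :
    -- `R = zeroLocus F` is a Hirzebruch surface with the stated line bundles
    (∃ n ∈ ({0, 2} : Set ℕ), ∃ φ : VarietyIso (zeroLocus F) (hirzebruch n),
      ∀ z : Projectivization ℂ (Fin 2 → ℂ),
        Nonempty (ModuleIso φ (twist (zeroLocus F) 1 0)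
          (ofDivisor (hirzebruch n) (fun _ : Unit => hirzebruchFibre n z))) ∧
        Nonempty (ModuleIso φ (twist (zeroLocus F) 0 1)
          (ofDivisor (hirzebruch n)
            (fun i : Fin ((n + 2) / 2) ⊕ Unit =>
              Sum.elim (fun _ => hirzebruchFibre n z) (fun _ => hirzebruchSection n) i)))) ∧
    -- the cubic Segre products containing `R ⊆ ℙ⁵` as a divisor of bidegree `(2, 1)`
    (∃ Φ : SegreProductsContaining (segre A₀ '' zeroLocus F) → DualSystem (zeroLocus F),
      Function.Injective Φ ∧ IsZariskiOpen (Set.range Φ) ∧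
      -- `Φ` sends `S` to the hyperplane of the sections restricted from `S`
      (∀ (S : SegreProductsContaining (segre A₀ '' zeroLocus F))
        (A : (Fin 2 × Fin 3 → ℂ) ≃ₗ[ℂ] (Fin 6 → ℂ)) (G : BiPoly),
        IsPresentation (segre A₀ '' zeroLocus F) S A G →
        ∃ ψ : VarietyIso (zeroLocus G) (zeroLocus F),
          (∀ x, segre A₀ (ψ.toHomeomorph x) = segre A x) ∧
          Nonempty (ModuleIso ψ (twist (zeroLocus G) 0 1) (twist (zeroLocus F) 0 1)) ∧
          ∀ (θ : ModuleIso ψ (twist (zeroLocus G) 0 1) (twist (zeroLocus F) 0 1))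
            (s : H0 (zeroLocus F)), (Φ S).rep s = 0 ↔ IsRestriction (θ.equiv ⊤ s)) ∧
      -- the Segre products form an algebraic family over the image of `Φ`
      ∃ T : Set (MvPolynomial (H0 (zeroLocus F) ⊕ Fin 6) ℂ),
        (∀ H ∈ T, ∃ d, IsBihomogeneous H d) ∧
        ∀ (S : SegreProductsContaining (segre A₀ '' zeroLocus F)) (y : P5),
          y ∈ (S : Set P5) ↔
            ∀ H ∈ T, MvPolynomial.eval (Sum.elim (fun s => (Φ S).rep s) y.rep) H = 0) := by
  obtain ⟨D⟩ := hsmooth.nonempty_scrollData hF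
  refine ⟨exists_hirzebruchIso D, ?_⟩
  choose Φ hΦ using fun S => D.exists_isHyperplaneOf (A₀ := A₀) S
  refine ⟨Φ, fun S S' h => ?_, ?_, fun S A G hP => ?_, ?_⟩
  -- Injectivity: a Segre product is recovered from its hyperplane as the zero locus of the minors.
  · refine Subtype.ext (Set.ext fun y => ?_)
    rw [(hΦ S).mem_iff, (hΦ S').mem_iff, h]
  · refine ⟨{P | ∃ u h, P = (D.kerMatrix u h).det}, ?_, fun p => ?_⟩
    · rintro _ ⟨u, h, rfl⟩
      exact ⟨_, isHomogeneous_det fun q l =>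
        (MvPolynomial.isHomogeneous_C_mul_X _ _).sub (MvPolynomial.isHomogeneous_C_mul_X _ _)⟩
    -- The image consists exactly of the nondegenerate hyperplanes; the product built from such a
    -- `p` has both `p` and its value under `Φ` as hyperplanes, so these are proportional.
    · have hiff : p ∈ Set.range Φ ↔ D.IsNondegenerate p.rep := by
        constructor
        · rintro ⟨S, rfl⟩
          exact (hΦ S).isNondegenerate
        · intro hp
          obtain ⟨A, G, h, hP, hh, hker⟩ := D.exists_presentation A₀ p.rep_nonzero hp
          refine ⟨⟨_, A, G, hP⟩, ?_⟩
          obtain ⟨c, -, hc⟩ := (hΦ ⟨_, A, G, hP⟩).exists_smul_eq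
            (hh.isHyperplaneOf p.rep_nonzero hker)
          rw [← Projectivization.mk_rep (Φ _), ← Projectivization.mk_rep p]
          exact (Projectivization.mk_eq_mk_iff' ℂ _ _ _ _).2 ⟨c, hc⟩
      rw [hiff, D.isNondegenerate_iff p.rep_nonzero]
      constructor
      · rintro ⟨u, h, h0⟩
        exact ⟨_, ⟨u, h, rfl⟩, h0⟩
      · rintro ⟨_, ⟨u, h, rfl⟩, h0⟩
        exact ⟨u, h, h0⟩
  · obtain ⟨E, χ, p, hp, hker⟩ := D.exists_of_isPresentation hP
    refine ⟨χ.varietyIso, χ.segre_varietyIso, ⟨χ.moduleIso 0 1⟩, fun θ s => ?_⟩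
    -- `Φ S` may come from a different presentation of `S`; since the locus of minors determines the
    -- hyperplane, the forms are proportional.
    obtain ⟨c, hc, e⟩ := (hΦ S).exists_smul_eq hp
    rw [χ.isRestriction_iff D E θ, ← hker, ← e, LinearMap.smul_apply, smul_eq_mul,
      mul_eq_zero, or_iff_right hc]
  · refine ⟨{H | ∃ u s t, H = D.minorPoly A₀ u s t}, ?_, fun S y => ?_⟩
    · rintro _ ⟨u, s, t, rfl⟩
      exact ⟨_, D.isBihomogeneous_minorPoly A₀ u s t⟩
    · rw [(hΦ S).mem_iff, D.mem_minorLocus_iff A₀ (hΦ S).ne_zero]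
      constructor
      · rintro h _ ⟨u, s, t, rfl⟩
        exact h u s t
      · exact fun h u s t => h _ ⟨u, s, t, rfl⟩
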